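/- **Proposition 3.2 (Estimate of logarithmic derivatives).** Let $$\Theta_0:=\inf_{\alpha\in\mathbb R}\ \inf\Big\{\int_0^\infty \big(|u'|^2+(t+\alpha)^2|u|^2\big)\,dt \;:\; \|u\|_{L^2(\mathbb R^+)}=1\Big\},$$ and let $1<b<\Theta_0^{-1}$. For $c_0>0$, $\varepsilon\in(0,1)$ put $t_\varepsilon:=c_0|\log\varepsilon|$, $I_\varepsilon:=[0,t_\varepsilon]$, and for $k,\alpha\in\mathbb R$ and $f\in H^1(I_\varepsilon)$ (real valued) put $$\mathcal E^{\rm 1D}_{k,\alpha}[f]:=\int_0^{t_\varepsilon}(1-\varepsilon kt)\Big\{|f'|^2+\frac{(t+\alpha-\frac12\varepsilon kt^2)^2}{(1-\varepsilon kt)^2}f^2-\frac1{2b}\big(2f^2-f^4\big)\Big\}\,dt,\qquad E^{\rm 1D}(k,\alpha):=\inf_{f\in H^1(I_\varepsilon)}\mathcal E^{\rm 1D}_{k,\alpha}[f].$$ An *optimal pair* for $k$ is a pair $(\alpha(k),f_k)$ such that $\alpha(k)$ minimizes $\alpha\mapsto E^{\rm 1D}(k,\alpha)$, over all $\alpha\in\mathbb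 R$ if $k>0$ and over all $\alpha\ge-\frac12t_\varepsilon$ if $k\le0$, and $f_k\ge0$ minimizes $\mathcal E^{\rm 1D}_{k,\alpha(k)}$ over $H^1(I_\varepsilon)$. (If $k\le 0$, the constraint selects the profile that lives near $t=0$; without it, reflection $t\mapsto t_\varepsilon-t$ produces a minimizer that lives near the artificial end point $t=t_\varepsilon$.) Then there are constants $\bar c>0$ and $a>0$, depending only on $b$, such that for every $c_0\ge\bar c$ and every $K>0$ there are $C>0$ and $\varepsilon_0\in(0,1)$, depending only on $b,c_0,K$, with the following property. For all $\varepsilon\in(0,\varepsilon_0)$, all $k,k'\in[-K,K]$ and all optimal pairs $(\alpha(k),f_k)$, $(\alpha(k'),f_{k'})$ for $k$ and $k'$, the functions $f_k$ and $f_{k'}$ are strictly positive on $I_\varepsilon$ and $$\Big\|\frac{f_k'}{f_k}-\frac{f_{k'}'}{f_{k'}}\Big\|_{L^\infty(I_\varepsilon)}\le C\,\big(\varepsilon|k-k'|\big)^{1/2}\,|\log\varepsilon|^{a}.$$ In particular the bound holds on all of $I_\varepsilon$, including the region where the profiles are exponentially small. -/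

import Mathlib

open MeasureTheory Set
open scoped ENNReal

noncomputable section

namespace SurfaceSC

/-- `H¹(0,T)`: on a bounded interval, the (continuous representatives of the) `H¹` functions are
exactly the absolutely continuous functions whose a.e. derivative is square integrable.  The values
of `f` outside `[0,T]` play no role. -/
def MemH1 (T : ℝ) (f : ℝ → ℝ) : Prop :=
  AbsolutelyContinuousOnInterval f 0 T ∧ MemLp (deriv f) 2 (volume.restrict (Icc 0 T))

/-- Form domain of the shifted harmonic oscillator on the half-line with Neumann condition:
locally absolutely continuous `u` on `[0,∞)` with `u`, `u'` and `(t + α) u` square integrable. -/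
def OscDomain (α : ℝ) (u : ℝ → ℝ) : Prop :=
  (∀ T > 0, AbsolutelyContinuousOnInterval u 0 T) ∧
  MemLp u 2 (volume.restrict (Ioi 0)) ∧
  MemLp (deriv u) 2 (volume.restrict (Ioi 0)) ∧
  MemLp (fun t => (t + α) * u t) 2 (volume.restrict (Ioi 0))

/-- Lowest energy of the harmonic oscillator `-∂ₜ² + (t + α)²` on the half-line. -/
def oscEnergy (α : ℝ) : ℝ :=
  sInf {E : ℝ | ∃ u : ℝ → ℝ, OscDomain α u ∧ (∫ t in Ioi 0, u t ^ 2) = 1 ∧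
    E = ∫ t in Ioi 0, (deriv u t ^ 2 + (t + α) ^ 2 * u t ^ 2)}

/-- The spectral constant `Θ₀`. -/
def Theta0 : ℝ := ⨅ α : ℝ, oscEnergy α

/-- Right end point `t_ε = c₀ |log ε|` of the interval `I_ε = [0, c₀ |log ε|]`. -/
def tEnd (c₀ ε : ℝ) : ℝ := c₀ * |Real.log ε|

/-- The potential `V_{k,α}`. -/
def potential (ε k α t : ℝ) : ℝ :=
  (t + α - ε * k * t ^ 2 / 2) ^ 2 / (1 - ε * k * t) ^ 2

/-- The one-dimensional functional `E^{1D}_{k,α}[f]`. -/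
def energy1D (b c₀ ε k α : ℝ) (f : ℝ → ℝ) : ℝ :=
  ∫ t in (0 : ℝ)..tEnd c₀ ε, (1 - ε * k * t) *
    (deriv f t ^ 2 + potential ε k α t * f t ^ 2 - 1 / (2 * b) * (2 * f t ^ 2 - f t ^ 4))

/-- `f` minimizes `E^{1D}_{k,α}` over `H¹(I_ε)`. -/
def IsMinimizer1D (b c₀ ε k α : ℝ) (f : ℝ → ℝ) : Prop :=
  MemH1 (tEnd c₀ ε) f ∧
  ∀ h : ℝ → ℝ, MemH1 (tEnd c₀ ε) h → energy1D b c₀ ε k α f ≤ energy1D b c₀ ε k α h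

/-- The ground state energy `E^{1D}(k,α)`. -/
def groundEnergy1D (b c₀ ε k α : ℝ) : ℝ :=
  sInf (energy1D b c₀ ε k α '' {h | MemH1 (tEnd c₀ ε) h})

/-- Phases over which the ground state energy is minimized: all reals if `k > 0`, and
`α ≥ -t_ε/2` if `k ≤ 0`.

The reflection `t ↦ t_ε - t` maps the problem with parameters `(k, α)` to the one with parameters
`(-k/(1 - εkt_ε), -(α + t_ε - εkt_ε²/2)/(1 - εkt_ε))`, up to the positive factor `1 - εkt_ε`.  Hence
beside the phase of the profile that lives near the boundary `t = 0` there is a mirror phase, close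
to `-t_ε`, whose profile lives near the artificial end point `t = t_ε`.  It has a higher energy if
`k > 0`, the same one if `k = 0` and a lower one if `k < 0`; the constraint discards it. -/
def phases (c₀ ε k : ℝ) : Set ℝ := {α | k ≤ 0 → -(tEnd c₀ ε / 2) ≤ α}

/-- `α` is an optimal phase `α(k)` and `f` is an optimal profile `f_k`: `α` minimizes the ground
state energy, and `f` is a nonnegative minimizer of the functional with that phase. -/
structure IsOptimalPair (b c₀ ε k α : ℝ) (f : ℝ → ℝ) : Prop where
  mem_phases : α ∈ phases c₀ ε k
  phase_min : IsMinOn (groundEnergy1D b c₀ ε k) (phases c₀ ε k) α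
  profile_min : IsMinimizer1D b c₀ ε k α f
  profile_nonneg : ∀ t ∈ Icc 0 (tEnd c₀ ε), 0 ≤ f t

end SurfaceSC

end

namespace SurfaceSC

/-! ### Elementary tools -/

/-! Put `m = ε k` and `T = t_ε`. A minimizer solves `(w f')' = coef · f` with Neumann conditions;
write `g = w f'`. The region where profiles are exponentially small is handled by the Wronskian `g u
- v f` of two profiles. It vanishes at `T`, and its derivative is the difference of the coefficients
times `f u`, plus `g v` times a difference of inverse weights. From `t` onward each profile is at
most a constant times its value at `t`, so integrating from `T` back to `t` and dividing by `f(t)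
u(t)` costs only powers of `T` (`abs_logDeriv_sub_le`). It remains to show that phases and squared
profiles differ by at most `√|m - m'|` times a power of `T`.

This closeness comes from the energies. Testing each functional with the other optimal pair shows
that `(α', u)` exceeds the minimal energy for `m` by `O(|m - m'|)` (`enr_le_enr_add`). The
substitution `u = f · (u / f)` turns the excess into an integral of squares, plus a cross term
between `δ = α' - α` and the difference of logarithmic derivatives, with factor `F / f²`
(`energy_splitting`). Here `F` is the primitive of `2 (ph / w) f²`; optimality of the phase says
exactly that `F(T) = 0` (`exists_optimalProfile`).

The cross term is harmless as soon as `r = -F / f²` stays below one. With `β = ph / w` and `p = f' /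
f` one has `r' = -2β - 2rp`, while an approximate first integral gives `p² ≥ β² + r - 1/b` up to
small errors. At an interior maximum `r p = -β`, and `r` close to `1` would then contradict `b > 1`
(`ratio_le`). The margin is of order `T⁻²`, and so is the coercivity constant (`coercivity`,
`sup_sq_sub_sq_le`).

Uniformity of the constants uses `b < Θ₀⁻¹`, which provides a trial state of energy at most `-c`
(`exists_trial`). Negative energy confines the phase to one of the two ends (`exists_localization`),
the far end is excluded by reflection or by the constraint (`PhaseOptimal.abs_lt`), and then one
constant `L` controls the shape of all profiles (`Profile.exists_tame`). -/

theorem le_of_hasDerivAt_nonneg {F F' : ℝ → ℝ} {a b : ℝ}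
    (h : ∀ t ∈ Icc a b, HasDerivAt F (F' t) t) (h' : ∀ t ∈ Icc a b, 0 ≤ F' t)
    {s t : ℝ} (hs : a ≤ s) (hst : s ≤ t) (ht : t ≤ b) : F s ≤ F t := by
  have hm : MonotoneOn F (Icc a b) := by
    apply monotoneOn_of_deriv_nonneg (convex_Icc a b)
    · exact fun x hx => (h x hx).continuousAt.continuousWithinAt
    · exact fun x hx => (h x (interior_subset hx)).differentiableAt.differentiableWithinAt
    · intro x hx
      rw [(h x (interior_subset hx)).deriv]
      exact h' x (interior_subset hx)
  exact hm ⟨hs, hst.trans ht⟩ ⟨hs.trans hst, ht⟩ hst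

theorem le_of_hasDerivAt_nonpos {F F' : ℝ → ℝ} {a b : ℝ}
    (h : ∀ t ∈ Icc a b, HasDerivAt F (F' t) t) (h' : ∀ t ∈ Icc a b, F' t ≤ 0)
    {s t : ℝ} (hs : a ≤ s) (hst : s ≤ t) (ht : t ≤ b) : F t ≤ F s := by
  have := le_of_hasDerivAt_nonneg (F := fun t => - F t) (F' := fun t => - F' t)
    (fun t ht => (h t ht).neg) (fun t ht => by linarith [h' t ht]) hs hst ht
  linarith

theorem abs_sub_le_of_abs_deriv_le {F F' : ℝ → ℝ} {a b C : ℝ}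
    (h : ∀ t ∈ Icc a b, HasDerivAt F (F' t) t) (h' : ∀ t ∈ Icc a b, |F' t| ≤ C)
    {s t : ℝ} (hs : a ≤ s) (hst : s ≤ t) (ht : t ≤ b) : |F t - F s| ≤ C * (t - s) := by
  have h1 := le_of_hasDerivAt_nonneg (F := fun t => C * t - F t) (F' := fun t => C * 1 - F' t)
    (fun t ht => ((hasDerivAt_id t).const_mul C).sub (h t ht))
    (fun t ht => by linarith [(abs_le.1 (h' t ht)).2]) hs hst ht
  have h2 := le_of_hasDerivAt_nonneg (F := fun t => C * t + F t) (F' := fun t => C * 1 + F' t)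
    (fun t ht => ((hasDerivAt_id t).const_mul C).add (h t ht))
    (fun t ht => by linarith [(abs_le.1 (h' t ht)).1]) hs hst ht
  rw [abs_le]; constructor <;> linarith

/-- Two-sided Gronwall inequality. -/
theorem gronwall_two_sided {n n' : ℝ → ℝ} {a b Γ : ℝ}
    (h : ∀ t ∈ Icc a b, HasDerivAt n (n' t) t) (h' : ∀ t ∈ Icc a b, |n' t| ≤ Γ * n t)
    (hΓ : 0 ≤ Γ) (hn : ∀ t ∈ Icc a b, 0 ≤ n t)
    {s t : ℝ} (hs : s ∈ Icc a b) (ht : t ∈ Icc a b) :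
    n s ≤ Real.exp (Γ * (b - a)) * n t := by
  rcases le_total s t with hst | hst
  · have h1 := le_of_hasDerivAt_nonneg (F := fun t => Real.exp (Γ * t) * n t)
      (F' := fun t => Real.exp (Γ * t) * (Γ * 1) * n t + Real.exp (Γ * t) * n' t)
      (fun t ht => (((hasDerivAt_id t).const_mul Γ).exp).mul (h t ht))
      (fun t ht => by
        have := (abs_le.1 (h' t ht)).1
        nlinarith [Real.exp_pos (Γ * t)]) hs.1 hst ht.2
    have e : Real.exp (Γ * t) = Real.exp (Γ * s) * Real.exp (Γ * (t - s)) := by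
      rw [← Real.exp_add]; ring_nf
    rw [e, mul_assoc] at h1
    have h2 := le_of_mul_le_mul_left h1 (Real.exp_pos _)
    refine h2.trans (mul_le_mul_of_nonneg_right (Real.exp_le_exp.2 ?_) (hn t ht))
    apply mul_le_mul_of_nonneg_left _ hΓ
    linarith [hs.1, ht.2]
  · have h1 := le_of_hasDerivAt_nonpos (F := fun t => Real.exp (-Γ * t) * n t)
      (F' := fun t => Real.exp (-Γ * t) * (-Γ * 1) * n t + Real.exp (-Γ * t) * n' t)
      (fun t ht => (((hasDerivAt_id t).const_mul (-Γ)).exp).mul (h t ht))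
      (fun t ht => by
        have := (abs_le.1 (h' t ht)).2
        nlinarith [Real.exp_pos (-Γ * t)]) ht.1 hst hs.2
    have e : Real.exp (-Γ * t) = Real.exp (-Γ * s) * Real.exp (Γ * (s - t)) := by
      rw [← Real.exp_add]; ring_nf
    rw [e, mul_assoc] at h1
    have h2 := le_of_mul_le_mul_left h1 (Real.exp_pos _)
    refine h2.trans (mul_le_mul_of_nonneg_right (Real.exp_le_exp.2 ?_) (hn t ht))
    apply mul_le_mul_of_nonneg_left _ hΓ
    linarith [ht.1, hs.2]

theorem integral_eq_sub_of_hasDerivAt_Icc {F F' : ℝ → ℝ} {a b : ℝ} (hab : a ≤ b)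
    (h : ∀ t ∈ Icc a b, HasDerivAt F (F' t) t) (hc : ContinuousOn F' (Icc a b)) :
    ∫ t in a..b, F' t = F b - F a := by
  apply intervalIntegral.integral_eq_sub_of_hasDerivAt
  · rwa [uIcc_of_le hab]
  · rw [← uIcc_of_le hab] at hc
    exact hc.intervalIntegrable

/-! ### Weight, phase and the Euler–Lagrange system -/

/-- The weight `1 - m t`, with `m = ε k`. -/
noncomputable def wt (m t : ℝ) : ℝ := 1 - m * t

/-- The shifted phase `t + α - m t² / 2`. -/
noncomputable def ph (m α t : ℝ) : ℝ := t + α - m * t ^ 2 / 2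

/-- The coefficient in the Euler–Lagrange equation `(w f')' = coef · f`. -/
noncomputable def coef (b m α t y : ℝ) : ℝ := ph m α t ^ 2 / wt m t - wt m t / b * (1 - y ^ 2)

/-- The energy density. -/
noncomputable def dens (b m α t y d : ℝ) : ℝ :=
  wt m t * d ^ 2 + ph m α t ^ 2 / wt m t * y ^ 2 - wt m t / (2 * b) * (2 * y ^ 2 - y ^ 4)

/-- The energy of a function `f` with derivative `d`. -/
noncomputable def enr (b m α T : ℝ) (f d : ℝ → ℝ) : ℝ := ∫ t in (0 : ℝ)..T, dens b m α t (f t) (d t)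

/-- Nonnegative solutions of the Euler–Lagrange system with Neumann conditions; `g = w f'`. -/
structure Profile (b m α T : ℝ) (f g : ℝ → ℝ) : Prop where
  hf : ∀ t ∈ Icc 0 T, HasDerivAt f (g t / wt m t) t
  hg : ∀ t ∈ Icc 0 T, HasDerivAt g (coef b m α t (f t) * f t) t
  g0 : g 0 = 0
  gT : g T = 0
  nonneg : ∀ t ∈ Icc 0 T, 0 ≤ f t

/-- Standing smallness assumptions on the interval and on the curvature. -/
structure Regime (m T : ℝ) : Prop where
  one_le : 1 ≤ T
  small : |m| * T ^ 2 ≤ 1 / 10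

namespace Regime
variable {m T t α A : ℝ}

theorem T_pos (h : Regime m T) : 0 < T := by linarith [h.one_le]

theorem abs_mul_le (h : Regime m T) (ht : t ∈ Icc 0 T) : |m * t| ≤ 1 / 10 := by
  have h1 := h.small
  have h2 := h.one_le
  rw [abs_mul, abs_of_nonneg ht.1]
  have h3 := abs_nonneg m
  have : t ≤ T ^ 2 := by nlinarith [ht.1, ht.2]
  nlinarith

theorem abs_mul_sq_le (h : Regime m T) (ht : t ∈ Icc 0 T) : |m * t ^ 2 / 2| ≤ 1 / 20 := by
  have h1 := h.small
  rw [abs_div, abs_mul, abs_of_nonneg (sq_nonneg t), abs_of_pos (by norm_num : (0:ℝ) < 2)]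
  have h3 := abs_nonneg m
  have : t ^ 2 ≤ T ^ 2 := pow_le_pow_left₀ ht.1 ht.2 2
  nlinarith

theorem wt_ge (h : Regime m T) (ht : t ∈ Icc 0 T) : 9 / 10 ≤ wt m t := by
  have := abs_le.1 (h.abs_mul_le ht); unfold wt; linarith

theorem wt_le (h : Regime m T) (ht : t ∈ Icc 0 T) : wt m t ≤ 11 / 10 := by
  have := abs_le.1 (h.abs_mul_le ht); unfold wt; linarith

theorem wt_pos (h : Regime m T) (ht : t ∈ Icc 0 T) : 0 < wt m t := by
  linarith [h.wt_ge ht]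

theorem inv_wt_le (h : Regime m T) (ht : t ∈ Icc 0 T) : 1 / wt m t ≤ 10 / 9 := by
  rw [div_le_iff₀ (h.wt_pos ht)]; linarith [h.wt_ge ht]

theorem ph_ge (h : Regime m T) (ht : t ∈ Icc 0 T) : t + α - 1 / 20 ≤ ph m α t := by
  have := abs_le.1 (h.abs_mul_sq_le ht); unfold ph; linarith

theorem ph_le (h : Regime m T) (ht : t ∈ Icc 0 T) : ph m α t ≤ t + α + 1 / 20 := by
  have := abs_le.1 (h.abs_mul_sq_le ht); unfold ph; linarith

theorem abs_ph_le (h : Regime m T) (ht : t ∈ Icc 0 T) (hα : |α| ≤ A) :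
    |ph m α t| ≤ t + A + 1 := by
  have h1 := h.ph_le (α := α) ht
  have h2 := h.ph_ge (α := α) ht
  have h3 := abs_le.1 hα
  rw [abs_le]; constructor <;> linarith [ht.1]

theorem zero_mem (h : Regime m T) : (0 : ℝ) ∈ Icc 0 T := ⟨le_rfl, h.T_pos.le⟩

theorem right_mem (h : Regime m T) : T ∈ Icc 0 T := ⟨h.T_pos.le, le_rfl⟩

end Regime

theorem hasDerivAt_wt (m t : ℝ) : HasDerivAt (wt m) (-m) t := by
  unfold wt
  simpa using ((hasDerivAt_id t).const_mul m).const_sub 1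

theorem hasDerivAt_ph (m α t : ℝ) : HasDerivAt (ph m α) (wt m t) t := by
  unfold ph wt
  have := ((hasDerivAt_id t).add_const α).sub ((((hasDerivAt_id t).pow 2).const_mul m).div_const 2)
  convert! this using 1
  simp; ring

theorem continuous_wt (m : ℝ) : Continuous (wt m) := by unfold wt; fun_prop

theorem continuous_ph (m α : ℝ) : Continuous (ph m α) := by unfold ph; fun_prop

end SurfaceSC

/-! ### Positivity, upper bound and energy identity for profiles. -/

namespace SurfaceSC

theorem lt_of_hasDerivAt_pos {F F' : ℝ → ℝ} {a b : ℝ}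
    (h : ∀ t ∈ Icc a b, HasDerivAt F (F' t) t) (h' : ∀ t ∈ Ioo a b, 0 < F' t)
    {s t : ℝ} (hs : a ≤ s) (hst : s < t) (ht : t ≤ b) : F s < F t := by
  have hm : StrictMonoOn F (Icc a b) := by
    apply strictMonoOn_of_deriv_pos (convex_Icc a b)
    · exact fun x hx => (h x hx).continuousAt.continuousWithinAt
    · intro x hx
      rw [(h x (interior_subset hx)).deriv]
      rw [interior_Icc] at hx
      exact h' x hx
  exact hm ⟨hs, hst.le.trans ht⟩ ⟨hs.trans hst.le, ht⟩ hst

namespace Profile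
variable {b m α T : ℝ} {f g : ℝ → ℝ}

theorem continuousOn_f (hP : Profile b m α T f g) : ContinuousOn f (Icc 0 T) :=
  fun t ht => (hP.hf t ht).continuousAt.continuousWithinAt

theorem continuousOn_g (hP : Profile b m α T f g) : ContinuousOn g (Icc 0 T) :=
  fun t ht => (hP.hg t ht).continuousAt.continuousWithinAt

theorem continuousOn_deriv (hP : Profile b m α T f g) (hR : Regime m T) :
    ContinuousOn (fun t => g t / wt m t) (Icc 0 T) :=
  hP.continuousOn_g.div (continuous_wt m).continuousOn fun _ ht => (hR.wt_pos ht).ne'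

theorem continuousOn_coef (hP : Profile b m α T f g) (hR : Regime m T) :
    ContinuousOn (fun t => coef b m α t (f t)) (Icc 0 T) := by
  unfold coef
  refine ContinuousOn.sub (ContinuousOn.div ((continuous_ph m α).pow 2).continuousOn
    (continuous_wt m).continuousOn fun _ ht => (hR.wt_pos ht).ne') ?_
  exact ((continuous_wt m).div_const b).continuousOn.mul
    (continuousOn_const.sub (hP.continuousOn_f.pow 2))

theorem g_eq_zero_of_isLocalExtr (hP : Profile b m α T f g) (hR : Regime m T) {s : ℝ}
    (hs : s ∈ Icc 0 T) (h : IsLocalExtr f s) : g s = 0 := by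
  have h1 := h.hasDerivAt_eq_zero (hP.hf s hs)
  rcases div_eq_zero_iff.1 h1 with h2 | h2
  · exact h2
  · exact absurd h2 (hR.wt_pos hs).ne'

theorem g_eq_zero_of_min (hP : Profile b m α T f g) (hR : Regime m T) {s : ℝ}
    (hs : s ∈ Icc 0 T) (h : ∀ t ∈ Icc 0 T, f s ≤ f t) : g s = 0 := by
  rcases eq_or_lt_of_le hs.1 with h0 | h0
  · rw [← h0]; exact hP.g0
  rcases eq_or_lt_of_le hs.2 with h1 | h1
  · rw [h1]; exact hP.gT
  refine hP.g_eq_zero_of_isLocalExtr hR hs (Or.inl ?_)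
  filter_upwards [Icc_mem_nhds h0 h1] with t ht using h t ht

theorem g_eq_zero_of_max (hP : Profile b m α T f g) (hR : Regime m T) {s : ℝ}
    (hs : s ∈ Icc 0 T) (h : ∀ t ∈ Icc 0 T, f t ≤ f s) : g s = 0 := by
  rcases eq_or_lt_of_le hs.1 with h0 | h0
  · rw [← h0]; exact hP.g0
  rcases eq_or_lt_of_le hs.2 with h1 | h1
  · rw [h1]; exact hP.gT
  refine hP.g_eq_zero_of_isLocalExtr hR hs (Or.inr ?_)
  filter_upwards [Icc_mem_nhds h0 h1] with t ht using h t ht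

theorem hasDerivAt_sq_add_sq (hP : Profile b m α T f g) {t : ℝ} (ht : t ∈ Icc 0 T) :
    HasDerivAt (fun t => f t ^ 2 + g t ^ 2)
      (2 * f t * (g t / wt m t) + 2 * g t * (coef b m α t (f t) * f t)) t := by
  have := ((hP.hf t ht).pow 2).add ((hP.hg t ht).pow 2)
  convert! this using 1
  simp

theorem abs_deriv_sq_add_sq_le (hR : Regime m T) {t C : ℝ} (ht : t ∈ Icc 0 T)
    (hC : |coef b m α t (f t)| ≤ C) :
    |2 * f t * (g t / wt m t) + 2 * g t * (coef b m α t (f t) * f t)| ≤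
      (2 + C) * (f t ^ 2 + g t ^ 2) := by
  have h1 : 2 * f t * (g t / wt m t) + 2 * g t * (coef b m α t (f t) * f t) =
    (2 * f t * g t) * (1 / wt m t + coef b m α t (f t)) := by ring
  rw [h1, abs_mul, mul_comm]
  have h2 : |2 * f t * g t| ≤ f t ^ 2 + g t ^ 2 := by
    rw [abs_le]; constructor <;> nlinarith [sq_nonneg (f t + g t), sq_nonneg (f t - g t)]
  have h3 : |1 / wt m t + coef b m α t (f t)| ≤ 2 + C := by
    refine (abs_add_le _ _).trans (add_le_add ?_ hC)
    rw [abs_of_pos (one_div_pos.2 (hR.wt_pos ht))]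
    linarith [hR.inv_wt_le ht]
  exact mul_le_mul h3 h2 (abs_nonneg _) ((abs_nonneg _).trans h3)

/-- A zero of a nonnegative profile is a minimum, so `g` vanishes there too. Gronwall for `f² + g²`,
in effect uniqueness for the first-order system, then spreads the zero over the whole interval. -/
theorem pos (hP : Profile b m α T f g) (hR : Regime m T) (hne : ∃ t ∈ Icc 0 T, f t ≠ 0) :
    ∀ t ∈ Icc 0 T, 0 < f t := by
  obtain ⟨C, hC⟩ := isCompact_Icc.exists_bound_of_continuousOn (hP.continuousOn_coef hR)
  intro s hs
  refine lt_of_le_of_ne (hP.nonneg s hs) fun h0 => ?_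
  obtain ⟨t, ht, hft⟩ := hne
  have hg0 : g s = 0 := hP.g_eq_zero_of_min hR hs fun t ht => by
    rw [← h0]; exact hP.nonneg t ht
  have hC0 : 0 ≤ 2 + C := by
    have := (norm_nonneg _).trans (hC s hs); linarith
  have h1 := gronwall_two_sided (n := fun t => f t ^ 2 + g t ^ 2) (Γ := 2 + C)
    (fun t ht => hP.hasDerivAt_sq_add_sq ht)
    (fun t ht => abs_deriv_sq_add_sq_le hR ht (hC t ht)) hC0 (fun t _ => by positivity) ht hs
  simp only [← h0, hg0] at h1
  have h2 : 0 < f t ^ 2 := by positivity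
  nlinarith [sq_nonneg (g t)]

theorem coef_mul_pos_of_one_lt (hR : Regime m T) (hb : 0 < b) {t : ℝ} (ht : t ∈ Icc 0 T)
    (h1 : 1 < f t) : 0 < coef b m α t (f t) * f t := by
  have hw := hR.wt_pos ht
  refine mul_pos ?_ (by linarith)
  unfold coef
  have h2 : 0 ≤ ph m α t ^ 2 / wt m t := by positivity
  have h3 : wt m t / b * (1 - f t ^ 2) < 0 :=
    mul_neg_of_pos_of_neg (by positivity) (by nlinarith)
  linarith

/-- Where `f > 1` the right-hand side `coef · f` is positive. From a maximum above `1`, where `g =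
0`, the flux leaves zero with the sign that makes `f` larger still. The argument runs to the right
of the maximum, or to its left if it sits at `T`. -/
theorem le_one (hP : Profile b m α T f g) (hR : Regime m T) (hb : 0 < b) :
    ∀ t ∈ Icc 0 T, f t ≤ 1 := by
  obtain ⟨s, hs, hmax⟩ := isCompact_Icc.exists_isMaxOn ⟨0, hR.zero_mem⟩ hP.continuousOn_f
  have hmax' : ∀ t ∈ Icc 0 T, f t ≤ f s := fun t ht => hmax ht
  intro t ht
  refine (hmax' t ht).trans ?_
  by_contra! h1
  have hgs := hP.g_eq_zero_of_max hR hs hmax'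
  have hev := (hP.hf s hs).continuousAt.eventually (lt_mem_nhds h1)
  obtain ⟨δ, hδ, hball⟩ := Metric.eventually_nhds_iff.1 hev
  rcases lt_or_ge s T with hsT | hsT
  · have hr : ∃ r, s < r ∧ r ≤ T ∧ r < s + δ := by
      refine ⟨min T (s + δ / 2), lt_min hsT (by linarith), min_le_left _ _, ?_⟩
      exact (min_le_right _ _).trans_lt (by linarith)
    obtain ⟨r, hr1, hr2, hr3⟩ := hr
    have hsub : ∀ t ∈ Icc s r, t ∈ Icc 0 T := fun t ht => ⟨hs.1.trans ht.1, ht.2.trans hr2⟩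
    have hg : ∀ t ∈ Ioc s r, 0 < g t := fun t ht => by
      rw [← hgs]
      refine lt_of_hasDerivAt_pos (a := s) (b := r) (fun t ht => hP.hg t (hsub t ht))
        (fun t ht => ?_) le_rfl ht.1 ht.2
      refine coef_mul_pos_of_one_lt hR hb (hsub t ⟨ht.1.le, ht.2.le⟩) (hball ?_)
      rw [Real.dist_eq, abs_of_pos (by linarith [ht.1])]; linarith [ht.2]
    have := lt_of_hasDerivAt_pos (a := s) (b := r) (fun t ht => hP.hf t (hsub t ht))
      (fun t ht => div_pos (hg t ⟨ht.1, ht.2.le⟩) (hR.wt_pos (hsub t ⟨ht.1.le, ht.2.le⟩)))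
      le_rfl hr1 le_rfl
    exact absurd (hmax' r (hsub r ⟨hr1.le, le_rfl⟩)) (not_le.2 this)
  · have hs0 : 0 < s := hR.T_pos.trans_le hsT
    have hr : ∃ r, r < s ∧ 0 ≤ r ∧ s - δ < r := by
      refine ⟨max 0 (s - δ / 2), max_lt hs0 (by linarith), le_max_left _ _, ?_⟩
      exact lt_of_lt_of_le (by linarith) (le_max_right _ _)
    obtain ⟨r, hr1, hr2, hr3⟩ := hr
    have hsub : ∀ t ∈ Icc r s, t ∈ Icc 0 T := fun t ht => ⟨hr2.trans ht.1, ht.2.trans hs.2⟩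
    have hg : ∀ t ∈ Ico r s, g t < 0 := fun t ht => by
      rw [← hgs]
      refine lt_of_hasDerivAt_pos (a := r) (b := s) (fun t ht => hP.hg t (hsub t ht))
        (fun t ht => ?_) ht.1 ht.2 le_rfl
      refine coef_mul_pos_of_one_lt hR hb (hsub t ⟨ht.1.le, ht.2.le⟩) (hball ?_)
      rw [Real.dist_eq, abs_of_neg (by linarith [ht.2])]; linarith [ht.1]
    have := lt_of_hasDerivAt_pos (F := fun t => - f t) (a := r) (b := s)
      (fun t ht => (hP.hf t (hsub t ht)).neg)
      (fun t ht => by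
        have := div_neg_of_neg_of_pos (hg t ⟨ht.1.le, ht.2⟩) (hR.wt_pos (hsub t ⟨ht.1.le, ht.2.le⟩))
        linarith)
      le_rfl hr1 le_rfl
    have := hmax' r (hsub r ⟨le_rfl, hr1.le⟩)
    linarith

theorem dens_eq (hR : Regime m T) {t : ℝ} (ht : t ∈ Icc 0 T) :
    dens b m α t (f t) (g t / wt m t) =
      (coef b m α t (f t) * f t * f t + g t * (g t / wt m t)) - wt m t / (2 * b) * f t ^ 4 := by
  have hw := (hR.wt_pos ht).ne'
  unfold dens coef
  rcases eq_or_ne b 0 with rfl | hb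
  · field_simp; simp; ring
  field_simp
  ring

/-- This is the equation tested with `f` itself: the density is `(g f)'` minus the quartic term, and
`g` vanishes at both ends. A negative energy therefore measures the size of `f`. -/
theorem enr_eq (hP : Profile b m α T f g) (hR : Regime m T) :
    enr b m α T f (fun t => g t / wt m t) = -∫ t in (0 : ℝ)..T, wt m t / (2 * b) * f t ^ 4 := by
  unfold enr
  have hT := hR.T_pos.le
  have hc1 : ContinuousOn (fun t => coef b m α t (f t) * f t * f t + g t * (g t / wt m t))
      (Icc 0 T) :=
    (((hP.continuousOn_coef hR).mul hP.continuousOn_f).mul hP.continuousOn_f).add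
      (hP.continuousOn_g.mul (hP.continuousOn_deriv hR))
  have hc2 : ContinuousOn (fun t => wt m t / (2 * b) * f t ^ 4) (Icc 0 T) :=
    ((continuous_wt m).div_const _).continuousOn.mul (hP.continuousOn_f.pow 4)
  have h1 := integral_eq_sub_of_hasDerivAt_Icc (F := fun t => g t * f t) hT
    (fun t ht => (hP.hg t ht).mul (hP.hf t ht)) hc1
  rw [intervalIntegral.integral_congr (g := fun t =>
    (coef b m α t (f t) * f t * f t + g t * (g t / wt m t)) - wt m t / (2 * b) * f t ^ 4),
    intervalIntegral.integral_sub, h1, hP.g0, hP.gT]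
  · simp
  · rw [← uIcc_of_le hT] at hc1; exact hc1.intervalIntegrable
  · rw [← uIcc_of_le hT] at hc2; exact hc2.intervalIntegrable
  · intro t ht
    rw [uIcc_of_le hT] at ht
    exact dens_eq hR ht

end Profile
end SurfaceSC

/-! ### Uniform shape of profiles with bounded phase and negative energy. -/

namespace SurfaceSC

/-- Quantitative shape of the profiles, with one constant `L`. -/
structure Tame (T L : ℝ) (f g : ℝ → ℝ) : Prop where
  one_le : 1 ≤ L
  pos : ∀ t ∈ Icc 0 T, 0 < f t
  le_one : ∀ t ∈ Icc 0 T, f t ≤ 1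
  decay : ∀ s t, 0 ≤ s → s ≤ t → t ≤ T → f t ≤ L * Real.exp (-2 * (t - s)) * f s
  abs_g_le : ∀ t ∈ Icc 0 T, |g t| ≤ L * (1 + t) ^ 2 * f t
  lower : ∀ t ∈ Icc (0 : ℝ) 1, 1 / L ≤ f t
  g_nonpos : ∀ t ∈ Icc 0 T, L ≤ t → g t ≤ 0

theorem exp_two_lt : Real.exp 2 < 8 := by
  have h : Real.exp 2 = Real.exp 1 ^ 2 := by rw [← Real.exp_nat_mul]; norm_num
  rw [h]
  have := Real.exp_one_lt_d9
  have := Real.exp_pos 1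
  nlinarith

theorem one_add_sq_le_exp {x : ℝ} (hx : 0 ≤ x) : (1 + x) ^ 2 ≤ 4 * Real.exp x := by
  have h := Real.add_one_le_exp (x / 2)
  have h1 : Real.exp x = Real.exp (x / 2) ^ 2 := by rw [← Real.exp_nat_mul]; ring_nf
  rw [h1]
  have : (1 + x) ≤ 2 * Real.exp (x / 2) := by linarith
  nlinarith

theorem integral_exp_neg_le {c T : ℝ} (hc : 0 < c) :
    ∫ t in (0 : ℝ)..T, Real.exp (-c * t) ≤ 1 / c := by
  have h : ∀ t : ℝ, HasDerivAt (fun t => -(1 / c) * Real.exp (-c * t)) (Real.exp (-c * t)) t := by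
    intro t
    have := (((hasDerivAt_id t).const_mul (-c)).exp).const_mul (-(1 / c))
    convert! this using 1
    field_simp
    simp
  rw [intervalIntegral.integral_eq_sub_of_hasDerivAt (fun t _ => h t)
    ((by fun_prop : Continuous fun t => Real.exp (-c * t)).intervalIntegrable _ _)]
  have := Real.exp_pos (-c * T)
  have : 0 < 1 / c * Real.exp (-c * T) := by positivity
  simp
  simp at this
  linarith

/-- Ten units beyond `A` the phase exceeds `9.9`, so the potential dominates the nonlinear term. The
value `64` is chosen for `unit_decay`. -/
theorem le_coef {b m α T A t y : ℝ} (hR : Regime m T) (hb : 1 ≤ b) (hα : |α| ≤ A)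
    (ht : t ∈ Icc 0 T) (hA : A + 10 ≤ t) : 64 ≤ coef b m α t y := by
  have h1 := hR.ph_ge (α := α) ht
  have h2 := (abs_le.1 hα).1
  have hw := hR.wt_pos ht
  have h3 : 80 ≤ ph m α t ^ 2 / wt m t := by
    rw [le_div_iff₀ hw]; nlinarith [hR.wt_le ht]
  have h4 : wt m t / b * (1 - y ^ 2) ≤ 11 / 10 := by
    have h5 : wt m t / b ≤ 11 / 10 := by
      rw [div_le_iff₀ (by linarith)]; nlinarith [hR.wt_le ht]
    have h6 : 0 ≤ wt m t / b := by positivity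
    nlinarith [sq_nonneg y]
  unfold coef; linarith

theorem abs_coef_le {b m α T A t y : ℝ} (hR : Regime m T) (hb : 1 ≤ b) (hα : |α| ≤ A)
    (ht : t ∈ Icc 0 T) (hy0 : 0 ≤ y) (hy : y ≤ 1) :
    |coef b m α t y| ≤ (2 * (A + 1) ^ 2 + 2) * (1 + t) ^ 2 := by
  have hA : 0 ≤ A := (abs_nonneg _).trans hα
  have h1 := hR.abs_ph_le ht hα
  have hw := hR.wt_pos ht
  have ht0 := ht.1
  have h3 : ph m α t ^ 2 / wt m t ≤ 2 * (A + 1) ^ 2 * (1 + t) ^ 2 := by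
    rw [div_le_iff₀ hw]
    have : ph m α t ^ 2 ≤ ((A + 1) * (1 + t)) ^ 2 := by
      rw [← sq_abs (ph m α t)]
      apply pow_le_pow_left₀ (abs_nonneg _)
      nlinarith
    have h4 := hR.wt_ge ht
    nlinarith [sq_nonneg ((A + 1) * (1 + t))]
  have h3' : 0 ≤ ph m α t ^ 2 / wt m t := by positivity
  have h5 : wt m t / b ≤ 11 / 10 := by
    rw [div_le_iff₀ (by linarith)]; nlinarith [hR.wt_le ht]
  have h6 : 0 ≤ wt m t / b := by positivity
  have h7 : 0 ≤ 1 - y ^ 2 := by nlinarith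
  have h8 : wt m t / b * (1 - y ^ 2) ≤ 2 * (1 + t) ^ 2 := by nlinarith [sq_nonneg y]
  have h9 := mul_nonneg h6 h7
  unfold coef
  rw [abs_le]; constructor <;> nlinarith [sq_nonneg (1 + t), sq_nonneg ((A + 1) * (1 + t))]

namespace Profile
variable {b m α T A : ℝ} {f g : ℝ → ℝ}

section tail
variable (hP : Profile b m α T f g) (hR : Regime m T) (hb : 1 ≤ b) (hα : |α| ≤ A)
include hP hR hb hα

theorem g_nonpos_tail {t : ℝ} (ht0 : A + 10 ≤ t) (ht : t ≤ T) : g t ≤ 0 := by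
  have hA : 0 ≤ A := (abs_nonneg _).trans hα
  have hsub : ∀ s ∈ Icc (A + 10) T, s ∈ Icc 0 T := fun s hs => ⟨by linarith [hs.1], hs.2⟩
  rw [← hP.gT]
  refine le_of_hasDerivAt_nonneg (fun s hs => hP.hg s (hsub s hs)) (fun s hs => ?_) ht0 ht le_rfl
  exact mul_nonneg (by linarith [le_coef (y := f s) hR hb hα (hsub s hs) hs.1])
    (hP.nonneg s (hsub s hs))

theorem antitone_tail {s t : ℝ} (hs : A + 10 ≤ s) (hst : s ≤ t) (ht : t ≤ T) : f t ≤ f s := by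
  have hA : 0 ≤ A := (abs_nonneg _).trans hα
  have hsub : ∀ s ∈ Icc (A + 10) T, s ∈ Icc 0 T := fun s hs => ⟨by linarith [hs.1], hs.2⟩
  refine le_of_hasDerivAt_nonpos (fun s hs => hP.hf s (hsub s hs)) (fun r hr => ?_) hs hst ht
  exact div_nonpos_of_nonpos_of_nonneg (hP.g_nonpos_tail hR hb hα hr.1 hr.2)
    (hR.wt_pos (hsub r hr)).le

/-- The equation is integrated twice. On `[s, s + 1]` the profile lies above its final value `c`, so
the flux is at most `-64 c (s + 1 - r)`; dividing by a weight at most `11/10` and integrating again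
gives `f(s) ≥ 30 c`, and `30 > e²`. -/
theorem unit_decay {s : ℝ} (hs : A + 10 ≤ s) (ht : s + 1 ≤ T) :
    f (s + 1) ≤ Real.exp (-2) * f s := by
  have hA : 0 ≤ A := (abs_nonneg _).trans hα
  have hsub : ∀ r ∈ Icc s (s + 1), r ∈ Icc 0 T :=
    fun r hr => ⟨by linarith [hr.1], hr.2.trans ht⟩
  set c := f (s + 1) with hc
  have hc0 : 0 ≤ c := hP.nonneg _ (hsub _ ⟨by linarith, le_rfl⟩)
  have h1 : ∀ r ∈ Icc s (s + 1), g r ≤ -(64 * c * (s + 1 - r)) := by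
    intro r hr
    have h2 := le_of_hasDerivAt_nonneg (F := fun r => g r - 64 * c * r)
      (F' := fun r => coef b m α r (f r) * f r - 64 * c * 1) (a := s) (b := s + 1)
      (fun r hr => (hP.hg r (hsub r hr)).sub ((hasDerivAt_id r).const_mul _))
      (fun r hr => by
        have h3 := le_coef (y := f r) hR hb hα (hsub r hr) (hs.trans hr.1)
        have h4 : c ≤ f r := hP.antitone_tail hR hb hα (hs.trans hr.1) hr.2 ht
        nlinarith) hr.1 hr.2 le_rfl
    have h5 := hP.g_nonpos_tail hR hb hα (t := s + 1) (by linarith) ht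
    linarith
  have h2 := le_of_hasDerivAt_nonpos (F := fun r => f r - 29 * c * (s + 1 - r) ^ 2)
    (F' := fun r => g r / wt m r + 58 * c * (s + 1 - r)) (a := s) (b := s + 1)
    (fun r hr => by
      have h3 := (hP.hf r (hsub r hr)).sub ((((hasDerivAt_id r).const_sub (s + 1)).pow 2).const_mul
        (29 * c))
      convert! h3 using 1
      simp; ring)
    (fun r hr => by
      have h3 := h1 r hr
      have hw := hR.wt_pos (hsub r hr)
      have hw2 := hR.wt_le (hsub r hr)
      have h4 : g r / wt m r ≤ -(58 * c * (s + 1 - r)) := by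
        rw [div_le_iff₀ hw]
        have : 0 ≤ c * (s + 1 - r) := mul_nonneg hc0 (by linarith [hr.2])
        nlinarith
      linarith) (s := s) (t := s + 1) le_rfl (by linarith) le_rfl
  have h3 : 30 * c ≤ f s := by
    simp only [sub_self] at h2
    rw [← hc] at h2
    ring_nf at h2 ⊢
    linarith
  rw [Real.exp_neg, ← div_eq_inv_mul, le_div_iff₀ (Real.exp_pos _)]
  nlinarith [exp_two_lt]

theorem decay_tail {s t : ℝ} (hs : A + 10 ≤ s) (hst : s ≤ t) (ht : t ≤ T) :
    f t ≤ Real.exp 2 * Real.exp (-2 * (t - s)) * f s := by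
  have hA : 0 ≤ A := (abs_nonneg _).trans hα
  have h1 : ∀ n : ℕ, s + n ≤ T → f (s + n) ≤ Real.exp (-2 * n) * f s := by
    intro n
    induction n with
    | zero => intro _; simp
    | succ n ih =>
      intro hn
      push_cast at hn ⊢
      have h2 := ih (by linarith)
      have h3 := hP.unit_decay hR hb hα (s := s + n)
        (by have : (0 : ℝ) ≤ n := n.cast_nonneg
            linarith) (by linarith)
      rw [← add_assoc]
      refine h3.trans ?_
      have : Real.exp (-2 * (↑n + 1)) = Real.exp (-2) * Real.exp (-2 * n) := by
        rw [← Real.exp_add]; ring_nf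
      rw [this, mul_assoc]
      exact mul_le_mul_of_nonneg_left h2 (Real.exp_pos _).le
  set n := ⌊t - s⌋₊ with hn
  have h2 : (n : ℝ) ≤ t - s := Nat.floor_le (by linarith)
  have h3 : t - s < n + 1 := Nat.lt_floor_add_one _
  have h4 := h1 n (by linarith)
  have hn0 : (0 : ℝ) ≤ n := n.cast_nonneg
  have h5 := hP.antitone_tail hR hb hα (s := s + n) (t := t) (by linarith) (by linarith) ht
  refine h5.trans (h4.trans ?_)
  refine mul_le_mul_of_nonneg_right ?_ (hP.nonneg s ⟨by linarith, by linarith⟩)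
  rw [← Real.exp_add]
  exact Real.exp_le_exp.2 (by linarith)

/-- Integration back from `g(T) = 0`: the quadratic growth of the coefficient costs a factor `exp (r
- s)`, the decay of `f` gains `exp (-2 (r - s))`, so a multiple of `exp (-(r - s))` is a barrier for
`-g`. -/
theorem abs_g_le_tail {s : ℝ} (hs : A + 10 ≤ s) (hsT : s ≤ T) :
    |g s| ≤ 4 * (2 * (A + 1) ^ 2 + 2) * Real.exp 2 * (1 + s) ^ 2 * f s := by
  have hA : 0 ≤ A := (abs_nonneg _).trans hα
  have hsub : ∀ r ∈ Icc s T, r ∈ Icc 0 T := fun r hr => ⟨by linarith [hr.1], hr.2⟩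
  set B := 2 * (A + 1) ^ 2 + 2 with hB
  have hB0 : 0 < B := by positivity
  set c := 4 * B * Real.exp 2 * (1 + s) ^ 2 * f s with hc
  have hfs := hP.nonneg s ⟨by linarith, hsT⟩
  have hc0 : 0 ≤ c := by positivity
  have h1 := le_of_hasDerivAt_nonpos (F := fun r => g r + c * Real.exp (-(r - s)))
    (F' := fun r => coef b m α r (f r) * f r - c * Real.exp (-(r - s))) (a := s) (b := T)
    (fun r hr => by
      have h3 := (hP.hg r (hsub r hr)).add
        ((((hasDerivAt_id r).sub_const s).neg.exp).const_mul c)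
      convert! h3 using 1
      simp; ring)
    (fun r hr => by
      have h2 := (abs_le.1 (abs_coef_le hR hb hα (hsub r hr) (hP.nonneg r (hsub r hr))
        (hP.le_one hR (by linarith) r (hsub r hr)))).2
      have h3 := hP.decay_tail hR hb hα hs hr.1 hr.2
      have h4 := one_add_sq_le_exp (x := r - s) (by linarith [hr.1])
      have h5 : (1 + r) ^ 2 ≤ (1 + s) ^ 2 * (4 * Real.exp (r - s)) := by
        have : (1 + r) ^ 2 ≤ ((1 + s) * (1 + (r - s))) ^ 2 := by
          apply pow_le_pow_left₀ (by linarith [hr.1]); nlinarith [hr.1]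
        rw [mul_pow] at this
        exact this.trans (mul_le_mul_of_nonneg_left h4 (by positivity))
      have h6 : coef b m α r (f r) * f r ≤ B * ((1 + s) ^ 2 * (4 * Real.exp (r - s))) *
          (Real.exp 2 * Real.exp (-2 * (r - s)) * f s) := by
        refine mul_le_mul (h2.trans (mul_le_mul_of_nonneg_left h5 hB0.le)) h3
          (hP.nonneg r (hsub r hr)) (by positivity)
      have h7 : Real.exp (-(r - s)) = Real.exp (r - s) * Real.exp (-2 * (r - s)) := by
        rw [← Real.exp_add]; ring_nf
      rw [h7, hc]
      linarith) (s := s) (t := T) le_rfl hsT le_rfl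
  simp only [sub_self, neg_zero, Real.exp_zero, mul_one, hP.gT, zero_add] at h1
  have h2 : 0 ≤ c * Real.exp (-(T - s)) := by positivity
  have h3 := hP.g_nonpos_tail hR hb hα hs hsT
  rw [abs_of_nonpos h3]
  linarith

end tail

-- By the energy identity, energy at most `-c` bounds the maximum of `f` over `[0, t₀]` from below,
-- because that maximum also controls the tail. Two-sided Gronwall carries the lower bound to the
-- minimum over `[0, t₀]`; beyond `t₀` the tail estimates apply.
set_option maxHeartbeats 1000000 in
theorem exists_tame {b A c : ℝ} (hb : 1 < b) (hA : 0 ≤ A) (hc : 0 < c) :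
    ∃ L : ℝ, 1 ≤ L ∧ ∀ (m T α : ℝ) (f g : ℝ → ℝ), Regime m T → L ≤ T → |α| ≤ A →
      Profile b m α T f g → enr b m α T f (fun t => g t / wt m t) ≤ -c → Tame T L f g := by
  set t₀ := A + 10 with ht₀
  set B := 2 * (A + 1) ^ 2 + 2 with hB
  have hB0 : 0 < B := by positivity
  have ht₀0 : 0 < t₀ := by positivity
  set E := Real.exp (8 * (1 + t₀)) with hE
  set C₅ := 4 * B * Real.exp 2 * (1 + t₀) ^ 2 with hC₅
  have hC₅0 : 0 < C₅ := by positivity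
  set K := Real.exp ((2 + B * (1 + t₀) ^ 2) * (t₀ - 0)) * (1 + C₅ ^ 2) with hK
  have hK1 : 1 ≤ K := by
    have h1 : 1 ≤ Real.exp ((2 + B * (1 + t₀) ^ 2) * (t₀ - 0)) := Real.one_le_exp (by simp; positivity)
    nlinarith [sq_nonneg C₅]
  set ℓ := c / (E * K) with hℓ
  have hE0 : 0 < E := Real.exp_pos _
  have hℓ0 : 0 < ℓ := by positivity
  -- `L` is the sum of the constants required by the fields of `Tame`; each field keeps one summand
  -- and drops the others.
  set L := 1 + t₀ + 1 / ℓ + Real.exp (2 * t₀) / ℓ + 4 * B * Real.exp 2 +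
    B * (1 + t₀) ^ 2 * t₀ / ℓ + Real.exp 2 + Real.exp 2 * Real.exp (2 * t₀) / ℓ with hL
  have p1 : 0 < 1 / ℓ := by positivity
  have p2 : 0 < Real.exp (2 * t₀) / ℓ := by positivity
  have p3 : 0 < 4 * B * Real.exp 2 := by positivity
  have p4 : 0 < B * (1 + t₀) ^ 2 * t₀ / ℓ := by positivity
  have p5 : 0 < Real.exp 2 := by positivity
  have p6 : 0 < Real.exp 2 * Real.exp (2 * t₀) / ℓ := by positivity
  refine ⟨L, by linarith, ?_⟩
  intro m T α f g hR hLT hα hP hen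
  have hb0 : 0 < b := by linarith
  have ht₀T : t₀ ≤ T := by linarith
  have hT := hR.T_pos
  have hsub : ∀ r ∈ Icc 0 t₀, r ∈ Icc 0 T := fun r hr => ⟨hr.1, hr.2.trans ht₀T⟩
  have hle1 := hP.le_one hR hb0
  have hcoef : ∀ r ∈ Icc 0 t₀, |coef b m α r (f r)| ≤ B * (1 + t₀) ^ 2 := fun r hr =>
    (abs_coef_le hR hb.le hα (hsub r hr) (hP.nonneg r (hsub r hr)) (hle1 r (hsub r hr))).trans
      (mul_le_mul_of_nonneg_left (pow_le_pow_left₀ (by linarith [hr.1]) (by linarith [hr.2]) 2)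
        hB0.le)
  -- the maximum is bounded below
  obtain ⟨s, hs, hmax⟩ := isCompact_Icc.exists_isMaxOn ⟨0, ⟨le_rfl, ht₀0.le⟩⟩
    (hP.continuousOn_f.mono hsub)
  have hmax' : ∀ t ∈ Icc 0 t₀, f t ≤ f s := fun t ht => hmax ht
  have hs0 := hP.nonneg s (hsub s hs)
  have hs1 := hle1 s (hsub s hs)
  have hup : ∀ t ∈ Icc 0 T, f t ≤ f s * Real.exp (2 * (1 + t₀)) * Real.exp (-2 * t) := by
    intro t ht
    rcases le_total t t₀ with h | h
    · refine (hmax' t ⟨ht.1, h⟩).trans ?_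
      rw [mul_assoc, ← Real.exp_add]
      exact le_mul_of_one_le_right hs0 (Real.one_le_exp (by linarith))
    · refine (hP.decay_tail hR hb.le hα (s := t₀) le_rfl h ht.2).trans ?_
      rw [← Real.exp_add, mul_assoc, ← Real.exp_add, mul_comm]
      refine mul_le_mul (hmax' t₀ ⟨ht₀0.le, le_rfl⟩) (Real.exp_le_exp.2 (by linarith))
        (Real.exp_pos _).le hs0
  have hM : c ≤ f s * E := by
    have h1 := hP.enr_eq hR
    have h2 : ∫ t in (0 : ℝ)..T, wt m t / (2 * b) * f t ^ 4 ≤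
        ∫ t in (0 : ℝ)..T, f s * E * Real.exp (-8 * t) := by
      apply intervalIntegral.integral_mono_on hT.le
      · apply ContinuousOn.intervalIntegrable
        rw [uIcc_of_le hT.le]
        exact ((continuous_wt m).div_const _).continuousOn.mul (hP.continuousOn_f.pow 4)
      · exact (by fun_prop : Continuous fun t => f s * E * Real.exp (-8 * t)).intervalIntegrable _ _
      · intro t ht
        have h3 : f t ^ 4 ≤ f s ^ 4 * E * Real.exp (-8 * t) := by
          have h4 := pow_le_pow_left₀ (hP.nonneg t ht) (hup t ht) 4
          refine h4.trans_eq ?_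
          rw [mul_pow, mul_pow, ← Real.exp_nat_mul, ← Real.exp_nat_mul, hE]
          push_cast; ring_nf
        have h4 : wt m t / (2 * b) ≤ 1 := by
          rw [div_le_one (by positivity)]; linarith [hR.wt_le ht]
        have h5 : f s ^ 4 ≤ f s := by
          have := pow_le_pow_of_le_one hs0 hs1 (show 1 ≤ 4 by norm_num); simpa using this
        calc wt m t / (2 * b) * f t ^ 4 ≤ 1 * f t ^ 4 :=
              mul_le_mul_of_nonneg_right h4 (by positivity)
          _ ≤ f s ^ 4 * E * Real.exp (-8 * t) := by rw [one_mul]; exact h3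
          _ ≤ f s * E * Real.exp (-8 * t) := by gcongr
    rw [intervalIntegral.integral_const_mul] at h2
    have h3 := integral_exp_neg_le (c := 8) (T := T) (by norm_num)
    have h4 : f s * E * ∫ t in (0 : ℝ)..T, Real.exp (-8 * t) ≤ f s * E * (1 / 8) :=
      mul_le_mul_of_nonneg_left h3 (by positivity)
    have h5 : 0 ≤ f s * E := by positivity
    rw [h1] at hen
    linarith
  -- the minimum over `[0, t₀]` is bounded below
  obtain ⟨r, hr, hmin⟩ := isCompact_Icc.exists_isMinOn ⟨0, ⟨le_rfl, ht₀0.le⟩⟩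
    (hP.continuousOn_f.mono hsub)
  have hmin' : ∀ t ∈ Icc 0 t₀, f r ≤ f t := fun t ht => hmin ht
  have hr0 := hP.nonneg r (hsub r hr)
  -- At the minimum over `[0, t₀]` the flux vanishes, except possibly at `r = t₀`, where the tail
  -- estimate replaces `g = 0`.
  have hgr : |g r| ≤ C₅ * f r := by
    rcases eq_or_lt_of_le hr.1 with h0 | h0
    · have hr00 : r = 0 := h0.symm
      rw [hr00] at hr0 ⊢
      rw [hP.g0, abs_zero]; exact mul_nonneg hC₅0.le hr0
    rcases eq_or_lt_of_le hr.2 with h1 | h1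
    · have := hP.abs_g_le_tail hR hb.le hα (s := t₀) le_rfl ht₀T
      rw [h1]; exact this
    · have : g r = 0 := by
        refine hP.g_eq_zero_of_isLocalExtr hR (hsub r hr) (Or.inl ?_)
        filter_upwards [Icc_mem_nhds h0 h1] with t ht using hmin' t ht
      rw [this, abs_zero]; positivity
  have hlow : ℓ ≤ f r := by
    have h1 := gronwall_two_sided (n := fun t => f t ^ 2 + g t ^ 2) (a := 0) (b := t₀)
      (Γ := 2 + B * (1 + t₀) ^ 2)
      (fun t ht => hP.hasDerivAt_sq_add_sq (hsub t ht))
      (fun t ht => abs_deriv_sq_add_sq_le hR (hsub t ht) (hcoef t ht)) (by positivity)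
      (fun t _ => by positivity) hs hr
    have h2 : g r ^ 2 ≤ C₅ ^ 2 * f r ^ 2 := by
      rw [← sq_abs, ← mul_pow]; exact pow_le_pow_left₀ (abs_nonneg _) hgr 2
    have h3 : f s ^ 2 ≤ K * f r ^ 2 := by
      have h4 : f r ^ 2 + g r ^ 2 ≤ (1 + C₅ ^ 2) * f r ^ 2 := by linarith
      have h5 := h1.trans (mul_le_mul_of_nonneg_left h4 (Real.exp_pos _).le)
      rw [hK, mul_assoc]
      exact le_trans (le_add_of_nonneg_right (sq_nonneg (g s))) h5
    have h4 : f s ≤ K * f r := by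
      have h5 : f s ^ 2 ≤ (K * f r) ^ 2 := by
        rw [mul_pow]
        exact h3.trans (mul_le_mul_of_nonneg_right (by nlinarith only [hK1]) (sq_nonneg (f r)))
      exact (pow_le_pow_iff_left₀ hs0 (by positivity) (by norm_num)).1 h5
    rw [hℓ, div_le_iff₀ (by positivity)]
    calc c ≤ f s * E := hM
      _ ≤ K * f r * E := by gcongr
      _ = f r * (E * K) := by ring
  have hlow' : ∀ t ∈ Icc 0 t₀, ℓ ≤ f t := fun t ht => hlow.trans (hmin' t ht)
  have hdiv : ∀ t ∈ Icc 0 t₀, ∀ x : ℝ, 0 ≤ x → x ≤ x / ℓ * f t := by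
    intro t ht x hx
    rw [div_mul_eq_mul_div, le_div_iff₀ hℓ0]
    exact mul_le_mul_of_nonneg_left (hlow' t ht) hx
  have hpos : ∀ t ∈ Icc 0 T, 0 < f t :=
    hP.pos hR ⟨0, hR.zero_mem, (hℓ0.trans_le (hlow' 0 ⟨le_rfl, ht₀0.le⟩)).ne'⟩
  refine ⟨by linarith, hpos, hle1, ?_, ?_, ?_, ?_⟩
  · intro s t hs0 hst htT
    have hfs := hpos s ⟨hs0, hst.trans htT⟩
    rcases le_total t₀ s with h1 | h1
    · refine (hP.decay_tail hR hb.le hα h1 hst htT).trans ?_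
      gcongr; linarith
    · have hs' : s ∈ Icc 0 t₀ := ⟨hs0, h1⟩
      rcases le_total t t₀ with h2 | h2
      · have h3 : f t ≤ Real.exp (2 * t₀) / ℓ * Real.exp (-2 * (t - s)) * f s := by
          have h4 := hdiv s hs' (Real.exp (2 * t₀) * Real.exp (-2 * (t - s))) (by positivity)
          have h5 : 1 ≤ Real.exp (2 * t₀) * Real.exp (-2 * (t - s)) := by
            rw [← Real.exp_add]; exact Real.one_le_exp (by linarith)
          refine (hle1 t ⟨hs0.trans hst, htT⟩).trans (h5.trans (h4.trans_eq ?_))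
          ring
        refine h3.trans ?_
        gcongr; linarith
      · have h3 : f t ≤ Real.exp 2 * Real.exp (2 * t₀) / ℓ * Real.exp (-2 * (t - s)) * f s := by
          have h4 := hdiv s hs' (Real.exp 2 * Real.exp (2 * t₀) * Real.exp (-2 * (t - s)))
            (by positivity)
          have h5 := hP.decay_tail hR hb.le hα (s := t₀) le_rfl h2 htT
          have h6 : Real.exp 2 * Real.exp (-2 * (t - t₀)) * f t₀ ≤
              Real.exp 2 * Real.exp (2 * t₀) * Real.exp (-2 * (t - s)) := by
            have h7 : Real.exp (-2 * (t - t₀)) * f t₀ ≤ Real.exp (-2 * (t - t₀)) :=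
              mul_le_of_le_one_right (Real.exp_pos _).le (hle1 t₀ ⟨ht₀0.le, ht₀T⟩)
            have h8 : Real.exp (-2 * (t - t₀)) ≤ Real.exp (2 * t₀) * Real.exp (-2 * (t - s)) := by
              rw [← Real.exp_add]; exact Real.exp_le_exp.2 (by linarith)
            rw [mul_assoc, mul_assoc]
            exact mul_le_mul_of_nonneg_left (h7.trans h8) (Real.exp_pos _).le
          refine h5.trans (h6.trans (h4.trans_eq ?_))
          ring
        refine h3.trans ?_
        gcongr; linarith
  · intro t ht
    have hft := hpos t ht
    have ht0 := ht.1
    rcases le_total t₀ t with h1 | h1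
    · refine (hP.abs_g_le_tail hR hb.le hα h1 ht.2).trans ?_
      rw [← hB]
      gcongr; linarith
    · have h2 := abs_sub_le_of_abs_deriv_le (F := g) (a := 0) (b := t₀) (C := B * (1 + t₀) ^ 2)
        (fun r hr => hP.hg r (hsub r hr))
        (fun r hr => by
          rw [abs_mul, abs_of_nonneg (hP.nonneg r (hsub r hr))]
          have := mul_le_mul (hcoef r hr) (hle1 r (hsub r hr)) (hP.nonneg r (hsub r hr))
            (by positivity)
          linarith) (s := 0) (t := t) le_rfl ht0 h1
      rw [hP.g0, sub_zero, sub_zero] at h2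
      have h3 : B * (1 + t₀) ^ 2 * t ≤ B * (1 + t₀) ^ 2 * t₀ := by gcongr
      have h4 := hdiv t ⟨ht0, h1⟩ (B * (1 + t₀) ^ 2 * t₀) (by positivity)
      refine h2.trans (h3.trans (h4.trans ?_))
      gcongr
      have : L ≤ L * (1 + t) ^ 2 := le_mul_of_one_le_right (by linarith) (by nlinarith)
      linarith
  · intro t ht
    refine le_trans ?_ (hlow' t ⟨ht.1, ht.2.trans (by linarith)⟩)
    rw [div_le_iff₀ (by linarith)]
    have : ℓ * (1 / ℓ) = 1 := by field_simp
    nlinarith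
  · intro t ht hLt
    exact hP.g_nonpos_tail hR hb.le hα (by linarith) ht.2

end Profile
end SurfaceSC

/-! ### Regularity: minimizers over `H¹` are profiles. -/

namespace SurfaceSC

theorem enr_congr {b m α T : ℝ} (hT : 0 ≤ T) {f f₁ d d₁ : ℝ → ℝ}
    (hf : ∀ t ∈ Icc 0 T, f t = f₁ t) (hd : ∀ᵐ t, t ∈ Icc 0 T → d t = d₁ t) :
    enr b m α T f d = enr b m α T f₁ d₁ := by
  unfold enr
  apply intervalIntegral.integral_congr_ae
  filter_upwards [hd] with t ht ht'
  rw [uIoc_of_le hT] at ht'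
  have h := Ioc_subset_Icc_self ht'
  simp only [hf t h, ht h]

theorem energy1D_eq_enr {b c₀ ε k α : ℝ} (hR : Regime (ε * k) (tEnd c₀ ε)) (f : ℝ → ℝ) :
    energy1D b c₀ ε k α f = enr b (ε * k) α (tEnd c₀ ε) f (deriv f) := by
  unfold energy1D enr
  apply intervalIntegral.integral_congr
  intro t ht
  rw [uIcc_of_le hR.T_pos.le] at ht
  have hw := (hR.wt_pos ht).ne'
  simp only [potential, dens]
  unfold wt at *
  unfold ph
  rcases eq_or_ne b 0 with rfl | hb
  · field_simp
  field_simp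

namespace MemH1
variable {T : ℝ} {f h : ℝ → ℝ}

theorem continuousOn (hf : MemH1 T f) (hT : 0 ≤ T) : ContinuousOn f (Icc 0 T) := by
  have := hf.1.continuousOn
  rwa [uIcc_of_le hT] at this

theorem deriv_add_smul (hf : MemH1 T f) (hh : MemH1 T h) (hT : 0 ≤ T) (s : ℝ) :
    ∀ᵐ t, t ∈ Icc 0 T → deriv (fun t => f t + s * h t) t = deriv f t + s * deriv h t := by
  have h1 := hf.1.ae_differentiableAt
  have h2 := hh.1.ae_differentiableAt
  rw [uIcc_of_le hT] at h1 h2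
  filter_upwards [h1, h2] with t ht1 ht2 ht
  exact ((ht1 ht).hasDerivAt.add ((ht2 ht).hasDerivAt.const_mul s)).deriv

theorem add_smul (hf : MemH1 T f) (hh : MemH1 T h) (hT : 0 ≤ T) (s : ℝ) :
    MemH1 T (fun t => f t + s * h t) := by
  refine ⟨hf.1.add (hh.1.const_mul s), ?_⟩
  refine (hf.2.add (hh.2.const_mul s)).ae_eq ?_
  rw [Filter.EventuallyEq, ae_restrict_iff' measurableSet_Icc]
  filter_upwards [deriv_add_smul hf hh hT s] with t ht ht'
  simp [ht ht']

theorem intervalIntegrable_deriv_mul_deriv (hf : MemH1 T f) (hh : MemH1 T h) (hT : 0 ≤ T) :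
    IntervalIntegrable (fun t => deriv f t * deriv h t) volume 0 T := by
  rw [intervalIntegrable_iff_integrableOn_Icc_of_le hT]
  exact hf.2.integrable_mul hh.2

theorem const (T c : ℝ) : MemH1 T (fun _ => c) := by
  refine ⟨(contDiff_const (c := c)).contDiffOn.absolutelyContinuousOnInterval, ?_⟩
  have : deriv (fun _ : ℝ => c) = 0 := by ext; simp
  rw [this]; exact MemLp.zero

theorem of_contDiff (hT : 0 ≤ T) (hf : ∀ t ∈ Icc 0 T, HasDerivAt f (h t) t)
    (hh : ContinuousOn h (Icc 0 T)) : MemH1 T f := by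
  have hae : ∀ t ∈ Icc 0 T, deriv f t = h t := fun t ht => (hf t ht).deriv
  obtain ⟨C, hC⟩ := isCompact_Icc.exists_bound_of_continuousOn hh
  constructor
  · have : LipschitzOnWith (Real.toNNReal C) f (uIcc 0 T) := by
      rw [uIcc_of_le hT]
      refine (convex_Icc 0 T).lipschitzOnWith_of_nnnorm_hasDerivWithin_le
        (fun t ht => (hf t ht).hasDerivWithinAt) fun t ht => ?_
      rw [← NNReal.coe_le_coe, coe_nnnorm]
      exact (hC t ht).trans (Real.le_coe_toNNReal C)
    exact this.absolutelyContinuousOnInterval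
  · have h1 : MemLp h 2 (volume.restrict (Icc 0 T)) := by
      refine MemLp.of_bound (hh.aestronglyMeasurable measurableSet_Icc) C ?_
      rw [ae_restrict_iff' measurableSet_Icc]
      exact Filter.Eventually.of_forall hC
    refine h1.ae_eq ?_
    rw [Filter.EventuallyEq, ae_restrict_iff' measurableSet_Icc]
    exact Filter.Eventually.of_forall fun t ht => (hae t ht).symm

end MemH1

theorem linear_coeff_eq_zero {c₁ c₂ c₃ c₄ : ℝ}
    (h : ∀ s : ℝ, 0 ≤ s * c₁ + s ^ 2 * c₂ + s ^ 3 * c₃ + s ^ 4 * c₄) : c₁ = 0 := by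
  have hd : HasDerivAt (fun s : ℝ => s * c₁ + s ^ 2 * c₂ + s ^ 3 * c₃ + s ^ 4 * c₄) c₁ 0 := by
    have h1 := ((hasDerivAt_id (0 : ℝ)).mul_const c₁).add
      (((hasDerivAt_pow 2 (0 : ℝ)).mul_const c₂).add
      (((hasDerivAt_pow 3 (0 : ℝ)).mul_const c₃).add ((hasDerivAt_pow 4 (0 : ℝ)).mul_const c₄)))
    convert! h1 using 1
    · ext s; simp; ring
    · simp
  have hmin : IsLocalMin (fun s : ℝ => s * c₁ + s ^ 2 * c₂ + s ^ 3 * c₃ + s ^ 4 * c₄) 0 := by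
    refine Filter.Eventually.of_forall fun s => ?_
    simpa using h s
  exact hmin.hasDerivAt_eq_zero hd

theorem continuousOn_ph_sq_div {m α T : ℝ} (hR : Regime m T) :
    ContinuousOn (fun t => ph m α t ^ 2 / wt m t) (Icc 0 T) :=
  ContinuousOn.div ((continuous_ph m α).pow 2).continuousOn (continuous_wt m).continuousOn
    fun _ ht => (hR.wt_pos ht).ne'

/-- Weak form of the Euler–Lagrange equation. -/
theorem weak_euler_lagrange {b m α T : ℝ} (hR : Regime m T) {f h : ℝ → ℝ}
    (hf : MemH1 T f)
    (hmin : ∀ h, MemH1 T h → enr b m α T f (deriv f) ≤ enr b m α T h (deriv h))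
    (hh : MemH1 T h) :
    ∫ t in (0 : ℝ)..T, (wt m t * (deriv f t * deriv h t) + coef b m α t (f t) * f t * h t) = 0 := by
  have hT := hR.T_pos.le
  have cw : ContinuousOn (fun t => wt m t) (uIcc 0 T) := (continuous_wt m).continuousOn
  have cf : ContinuousOn f (uIcc 0 T) := hf.1.continuousOn
  have ch : ContinuousOn h (uIcc 0 T) := hh.1.continuousOn
  have cp : ContinuousOn (fun t => ph m α t ^ 2 / wt m t) (uIcc 0 T) := by
    rw [uIcc_of_le hT]; exact continuousOn_ph_sq_div hR
  have i_ff : IntervalIntegrable (fun t => wt m t * (deriv f t * deriv f t)) volume 0 T :=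
    (hf.intervalIntegrable_deriv_mul_deriv hf hT).continuousOn_mul cw
  have i_fh : IntervalIntegrable (fun t => wt m t * (deriv f t * deriv h t)) volume 0 T :=
    (hf.intervalIntegrable_deriv_mul_deriv hh hT).continuousOn_mul cw
  have i_hh : IntervalIntegrable (fun t => wt m t * (deriv h t * deriv h t)) volume 0 T :=
    (hh.intervalIntegrable_deriv_mul_deriv hh hT).continuousOn_mul cw
  -- The density of `f + s h` is a quartic polynomial in `s` with coefficients `p0`, `2 p1`, `p2`,
  -- `p3`, `p4`; minimality at `s = 0` kills the integral of the linear one.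
  set p0 : ℝ → ℝ := fun t => wt m t * (deriv f t * deriv f t) +
    (ph m α t ^ 2 / wt m t * f t ^ 2 - wt m t / (2 * b) * (2 * f t ^ 2 - f t ^ 4)) with hp0
  set p1 : ℝ → ℝ := fun t => wt m t * (deriv f t * deriv h t) + coef b m α t (f t) * f t * h t
    with hp1
  set p2 : ℝ → ℝ := fun t => wt m t * (deriv h t * deriv h t) +
    (ph m α t ^ 2 / wt m t * h t ^ 2 - wt m t / (2 * b) * (2 * h t ^ 2 - 6 * f t ^ 2 * h t ^ 2))
    with hp2
  set p3 : ℝ → ℝ := fun t => wt m t / (2 * b) * (4 * f t * h t ^ 3) with hp3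
  set p4 : ℝ → ℝ := fun t => wt m t / (2 * b) * h t ^ 4 with hp4
  have i0 : IntervalIntegrable p0 volume 0 T := by
    refine i_ff.add (ContinuousOn.intervalIntegrable ?_)
    fun_prop
  have i1 : IntervalIntegrable p1 volume 0 T := by
    refine i_fh.add (ContinuousOn.intervalIntegrable ?_)
    unfold coef
    fun_prop
  have i2 : IntervalIntegrable p2 volume 0 T := by
    refine i_hh.add (ContinuousOn.intervalIntegrable ?_)
    fun_prop
  have i3 : IntervalIntegrable p3 volume 0 T := by
    refine (ContinuousOn.intervalIntegrable ?_)
    fun_prop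
  have i4 : IntervalIntegrable p4 volume 0 T := by
    refine (ContinuousOn.intervalIntegrable ?_)
    fun_prop
  have e0 : enr b m α T f (deriv f) = ∫ t in (0 : ℝ)..T, p0 t := by
    unfold enr
    congr 1; ext t; simp only [dens, hp0]; ring
  have es : ∀ s : ℝ, enr b m α T (fun t => f t + s * h t) (deriv fun t => f t + s * h t) =
      ∫ t in (0 : ℝ)..T, (p0 t + (s * (2 * p1 t) + (s ^ 2 * p2 t + (s ^ 3 * p3 t + s ^ 4 * p4 t)))) := by
    intro s
    rw [enr_congr hT (fun t _ => rfl) (hf.deriv_add_smul hh hT s)]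
    unfold enr
    congr 1; ext t; simp only [dens, hp0, hp1, hp2, hp3, hp4, coef]
    rcases eq_or_ne b 0 with rfl | hb
    · simp; ring
    field_simp
    ring
  have hlin : 2 * (∫ t in (0 : ℝ)..T, p1 t) = 0 := by
    apply linear_coeff_eq_zero (c₂ := ∫ t in (0 : ℝ)..T, p2 t) (c₃ := ∫ t in (0 : ℝ)..T, p3 t)
      (c₄ := ∫ t in (0 : ℝ)..T, p4 t)
    intro s
    have h1 := hmin _ (hf.add_smul hh hT s)
    rw [es, e0, intervalIntegral.integral_add i0
      (((i1.const_mul 2).const_mul s).add ((i2.const_mul _).add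
        ((i3.const_mul _).add (i4.const_mul _)))),
      intervalIntegral.integral_add ((i1.const_mul 2).const_mul s) ((i2.const_mul _).add
        ((i3.const_mul _).add (i4.const_mul _))),
      intervalIntegral.integral_add (i2.const_mul _) ((i3.const_mul _).add (i4.const_mul _)),
      intervalIntegral.integral_add (i3.const_mul _) (i4.const_mul _)] at h1
    simp only [intervalIntegral.integral_const_mul] at h1
    linarith
  linarith

/-- Minimizers are classical solutions of the Neumann problem. -/
theorem exists_profile {b m α T : ℝ} (hR : Regime m T) {f : ℝ → ℝ}
    (hf : MemH1 T f)
    (hmin : ∀ h, MemH1 T h → enr b m α T f (deriv f) ≤ enr b m α T h (deriv h))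
    (hpos : ∀ t ∈ Icc 0 T, 0 ≤ f t) :
    ∃ F g : ℝ → ℝ, Profile b m α T F g ∧ (∀ t ∈ Icc 0 T, f t = F t) ∧
      (∀ᵐ t, t ∈ Icc 0 T → deriv f t = g t / wt m t) := by
  have hT := hR.T_pos.le
  -- Composition with the projection onto `[0, T]` extends continuous functions to the line, so that
  -- primitives have two-sided derivatives at the end points, as `Profile` demands.
  set P : ℝ → ℝ := fun t => max 0 (min T t) with hPdef
  have hPc : Continuous P := by fun_prop
  have hPm : ∀ t, P t ∈ Icc 0 T := fun t => ⟨le_max_left _ _, max_le hT (min_le_left _ _)⟩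
  have hPe : ∀ t ∈ Icc 0 T, P t = t := fun t ht => by
    simp only [hPdef]; rw [min_eq_right ht.2, max_eq_right ht.1]
  have hcf := hf.continuousOn hT
  set q₀ : ℝ → ℝ := fun t => coef b m α t (f t) * f t with hq₀
  have hcq₀ : ContinuousOn q₀ (Icc 0 T) := by
    have cp := continuousOn_ph_sq_div (α := α) hR
    have cw : ContinuousOn (fun t => wt m t) (Icc 0 T) := (continuous_wt m).continuousOn
    simp only [hq₀, coef]
    fun_prop
  set q : ℝ → ℝ := fun t => q₀ (P t) with hq
  have hcq : Continuous q := hcq₀.comp_continuous hPc hPm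
  set g : ℝ → ℝ := fun t => ∫ s in (0 : ℝ)..t, q s with hg
  have hg' : ∀ t, HasDerivAt g (q t) t := fun t =>
    intervalIntegral.integral_hasDerivAt_right (hcq.intervalIntegrable _ _)
      hcq.aestronglyMeasurable.stronglyMeasurableAtFilter hcq.continuousAt
  have hgc : Continuous g := continuous_iff_continuousAt.2 fun t => (hg' t).continuousAt
  have hg0 : g 0 = 0 := by simp [hg]
  have hqq : ∀ t ∈ Icc 0 T, q t = coef b m α t (f t) * f t := fun t ht => by
    simp only [hq, hq₀, hPe t ht]
  -- Constant test functions yield the Neumann condition at `T`.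
  have hgT : g T = 0 := by
    have h1 := weak_euler_lagrange hR hf hmin (MemH1.const T 1)
    rw [← h1]
    apply intervalIntegral.integral_congr
    intro t ht
    rw [uIcc_of_le hT] at ht
    simp [hqq t ht]
  -- the test function whose derivative is `w f' - g`
  set e : ℝ → ℝ := fun t => wt m t * deriv f t - g t with he
  have heL : MemLp e 2 (volume.restrict (Icc 0 T)) := by
    apply MemLp.sub
    · refine hf.2.of_le_mul (c := 11 / 10) ?_ ?_
      · exact (continuous_wt m).aestronglyMeasurable.mul hf.2.1
      · rw [ae_restrict_iff' measurableSet_Icc]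
        refine Filter.Eventually.of_forall fun t ht => ?_
        rw [norm_mul, Real.norm_eq_abs, abs_of_pos (hR.wt_pos ht)]
        exact mul_le_mul_of_nonneg_right (hR.wt_le ht) (norm_nonneg _)
    · obtain ⟨C, hC⟩ := isCompact_Icc.exists_bound_of_continuousOn (hgc.continuousOn (s := Icc 0 T))
      refine MemLp.of_bound hgc.aestronglyMeasurable C ?_
      rw [ae_restrict_iff' measurableSet_Icc]
      exact Filter.Eventually.of_forall hC
  have hei : IntervalIntegrable e volume 0 T := by
    rw [intervalIntegrable_iff_integrableOn_Icc_of_le hT]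
    exact heL.integrable (by norm_num)
  set h : ℝ → ℝ := fun t => ∫ s in (0 : ℝ)..t, e s with hh
  have hh0 : h 0 = 0 := by simp [hh]
  have hac : AbsolutelyContinuousOnInterval h 0 T :=
    hei.absolutelyContinuousOnInterval_intervalIntegral left_mem_uIcc
  have hdh : ∀ᵐ t, t ∈ Icc 0 T → deriv h t = e t := by
    have := hei.ae_hasDerivAt_integral
    rw [uIcc_of_le hT] at this
    filter_upwards [this] with t ht ht'
    exact (ht ht' 0 ⟨le_rfl, hT⟩).deriv
  have hH1 : MemH1 T h := by
    refine ⟨hac, heL.ae_eq ?_⟩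
    rw [Filter.EventuallyEq, ae_restrict_iff' measurableSet_Icc]
    filter_upwards [hdh] with t ht ht' using (ht ht').symm
  have hweak := weak_euler_lagrange hR hf hmin hH1
  have hgac : AbsolutelyContinuousOnInterval g 0 T :=
    (MemH1.of_contDiff hT (fun t _ => hg' t) hcq.continuousOn).1
  have hparts := hgac.integral_mul_deriv_eq_deriv_mul hac
  rw [hgT, hg0, zero_mul, zero_mul, sub_zero, zero_sub] at hparts
  have hch := hH1.continuousOn hT
  have i1 : IntervalIntegrable (fun t => wt m t * (deriv f t * deriv h t)) volume 0 T :=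
    (hf.intervalIntegrable_deriv_mul_deriv hH1 hT).continuousOn_mul (continuous_wt m).continuousOn
  have i2 : IntervalIntegrable (fun t => coef b m α t (f t) * f t * h t) volume 0 T := by
    apply ContinuousOn.intervalIntegrable
    rw [uIcc_of_le hT]; exact hcq₀.mul hch
  have i3 : IntervalIntegrable (fun t => g t * deriv h t) volume 0 T := by
    refine IntervalIntegrable.continuousOn_mul ?_ hgc.continuousOn
    rw [intervalIntegrable_iff_integrableOn_Icc_of_le hT]
    exact hH1.2.integrable (by norm_num)
  -- The weak equation with test function `h`, after `g` has been integrated by parts against `h'`,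
  -- says that `w f' - g` is orthogonal to `h' = e = w f' - g`.
  have hzero : ∫ t in (0 : ℝ)..T, e t ^ 2 = 0 := by
    have h1 : ∫ t in (0 : ℝ)..T, deriv g t * h t =
        ∫ t in (0 : ℝ)..T, coef b m α t (f t) * f t * h t := by
      apply intervalIntegral.integral_congr
      intro t ht
      rw [uIcc_of_le hT] at ht
      simp only [(hg' t).deriv, hqq t ht]
    rw [intervalIntegral.integral_add i1 i2, ← h1] at hweak
    have h2 : ∫ t in (0 : ℝ)..T, e t ^ 2 =
        ∫ t in (0 : ℝ)..T, (wt m t * (deriv f t * deriv h t) - g t * deriv h t) := by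
      apply intervalIntegral.integral_congr_ae
      filter_upwards [hdh] with t ht ht'
      rw [uIoc_of_le hT] at ht'
      rw [ht (Ioc_subset_Icc_self ht')]; simp only [he]; ring
    rw [h2, intervalIntegral.integral_sub i1 i3]
    linarith
  have hae : ∀ᵐ t, t ∈ Icc 0 T → e t = 0 := by
    rw [intervalIntegral.integral_of_le hT, ← integral_Icc_eq_integral_Ioc,
      integral_eq_zero_iff_of_nonneg (fun t => sq_nonneg _) heL.integrable_sq,
      Filter.EventuallyEq, ae_restrict_iff' measurableSet_Icc] at hzero
    filter_upwards [hzero] with t ht ht'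
    simpa using ht ht'
  have hdf : ∀ᵐ t, t ∈ Icc 0 T → deriv f t = g t / wt m t := by
    filter_upwards [hae] with t ht ht'
    have := ht ht'
    rw [eq_div_iff (hR.wt_pos ht').ne']
    simp only [he] at this
    linarith
  set r : ℝ → ℝ := fun t => g t / wt m (P t) with hr
  have hrc : Continuous r :=
    hgc.div ((continuous_wt m).comp hPc) fun t => (hR.wt_pos (hPm t)).ne'
  -- Outside `[0, T]` the function `f` is arbitrary, so it need not be differentiable at the end
  -- points; `F` agrees with it on the interval and is.
  set F : ℝ → ℝ := fun t => f 0 + ∫ s in (0 : ℝ)..t, r s with hF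
  have hF' : ∀ t, HasDerivAt F (r t) t := fun t =>
    (intervalIntegral.integral_hasDerivAt_right (hrc.intervalIntegrable _ _)
      hrc.aestronglyMeasurable.stronglyMeasurableAtFilter hrc.continuousAt).const_add _
  have hfF : ∀ t ∈ Icc 0 T, f t = F t := by
    intro t ht
    have h1 : AbsolutelyContinuousOnInterval f 0 t := hf.1.mono (by
      rw [uIcc_of_le hT, uIcc_of_le ht.1]; exact Icc_subset_Icc_right ht.2)
    have h2 := h1.integral_deriv_eq_sub
    have h3 : ∫ s in (0 : ℝ)..t, deriv f s = ∫ s in (0 : ℝ)..t, r s := by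
      apply intervalIntegral.integral_congr_ae
      filter_upwards [hdf] with s hs hs'
      rw [uIoc_of_le ht.1] at hs'
      have hs'' : s ∈ Icc 0 T := ⟨hs'.1.le, hs'.2.trans ht.2⟩
      rw [hs hs'']; simp only [hr, hPe s hs'']
    simp only [hF]
    linarith
  refine ⟨F, g, ⟨?_, ?_, hg0, hgT, ?_⟩, hfF, hdf⟩
  · intro t ht
    have := hF' t
    simp only [hr, hPe t ht] at this
    exact this
  · intro t ht
    rw [← hfF t ht, ← hqq t ht]; exact hg' t
  · intro t ht
    rw [← hfF t ht]; exact hpos t ht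

end SurfaceSC

namespace SurfaceSC

/-! ### Localization of the phase -/

/-- The multiplier used to bound the energy from below when the phase is far from both ends. -/
noncomputable def multiplier (θ R x : ℝ) : ℝ := θ * x * (R ^ 2 - x ^ 2) / (R ^ 2 + x ^ 2)

theorem hasDerivAt_multiplier {θ R : ℝ} (hR : 0 < R) (x : ℝ) :
    HasDerivAt (multiplier θ R)
      (θ * (R ^ 4 - 4 * R ^ 2 * x ^ 2 - x ^ 4) / (R ^ 2 + x ^ 2) ^ 2) x := by
  unfold multiplier
  have h0 : R ^ 2 + x ^ 2 ≠ 0 := by positivity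
  have h1 := (((hasDerivAt_id x).const_mul θ).mul ((hasDerivAt_pow 2 x).const_sub (R ^ 2))).div
    ((hasDerivAt_pow 2 x).const_add (R ^ 2)) h0
  convert! h1 using 1
  simp
  ring

theorem multiplier_sq_le {θ R : ℝ} (hR : 0 < R) (x : ℝ) :
    multiplier θ R x ^ 2 ≤ θ ^ 2 * x ^ 2 := by
  have h0 : 0 < R ^ 2 + x ^ 2 := by positivity
  unfold multiplier
  rw [div_pow, div_le_iff₀ (by positivity), mul_pow, mul_pow]
  apply mul_le_mul_of_nonneg_left _ (by positivity)
  nlinarith [mul_nonneg (sq_nonneg R) (sq_nonneg x)]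

/-- This is the Riccati form of `-∂² + x² ≥ θ` on the line. The multiplier `θ x` would do, but its
sign at infinity is wrong for the boundary terms. Bending it beyond `R` costs `6 θ x² / R²` in the
derivative, paid for by `x² - θ² x²`; only half of that gap is used, which leaves room for the
weight. -/
theorem le_deriv_multiplier_add {θ R x : ℝ} (hR : 0 < R) (hθ : 0 < θ)
    (h : 12 * θ ≤ (1 - θ ^ 2) * R ^ 2) :
    θ ≤ θ * (R ^ 4 - 4 * R ^ 2 * x ^ 2 - x ^ 4) / (R ^ 2 + x ^ 2) ^ 2 +
      (x ^ 2 - multiplier θ R x ^ 2) / 2 := by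
  have h1 := multiplier_sq_le (θ := θ) hR x
  have h0 : 0 < R ^ 2 + x ^ 2 := by positivity
  have h2 : θ * (1 - 6 * x ^ 2 / R ^ 2) ≤
      θ * (R ^ 4 - 4 * R ^ 2 * x ^ 2 - x ^ 4) / (R ^ 2 + x ^ 2) ^ 2 := by
    rw [mul_div_assoc θ (R ^ 4 - 4 * R ^ 2 * x ^ 2 - x ^ 4)]
    apply mul_le_mul_of_nonneg_left _ hθ.le
    rw [le_div_iff₀ (by positivity)]
    have : (1 - 6 * x ^ 2 / R ^ 2) * (R ^ 2 + x ^ 2) ^ 2 =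
        (R ^ 2 + x ^ 2) ^ 2 - 6 * x ^ 2 * (R ^ 2 + x ^ 2) - 6 * x ^ 4 * (R ^ 2 + x ^ 2) / R ^ 2 := by
      field_simp; ring
    rw [this]
    have h3 : 0 ≤ 6 * x ^ 4 * (R ^ 2 + x ^ 2) / R ^ 2 := by positivity
    nlinarith [mul_nonneg (sq_nonneg R) (sq_nonneg x), sq_nonneg (x ^ 2)]
  have h3 : θ * (6 * x ^ 2 / R ^ 2) ≤ (1 - θ ^ 2) * x ^ 2 / 2 := by
    rw [← mul_div_assoc, div_le_iff₀ (by positivity)]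
    nlinarith [mul_le_mul_of_nonneg_right h (sq_nonneg x)]
  nlinarith

theorem continuousOn_dens {b m α T : ℝ} (hR : Regime m T) {f d : ℝ → ℝ}
    (hf : ContinuousOn f (Icc 0 T)) (hd : ContinuousOn d (Icc 0 T)) :
    ContinuousOn (fun t => dens b m α t (f t) (d t)) (Icc 0 T) := by
  have cp := continuousOn_ph_sq_div (α := α) hR
  have cw : ContinuousOn (fun t => wt m t) (Icc 0 T) := (continuous_wt m).continuousOn
  simp only [dens]
  fun_prop

theorem ph_mono {m α T s t : ℝ} (hR : Regime m T) (hs : 0 ≤ s) (hst : s ≤ t) (ht : t ≤ T) :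
    ph m α s ≤ ph m α t :=
  le_of_hasDerivAt_nonneg (a := 0) (b := T) (fun t _ => hasDerivAt_ph m α t)
    (fun _ ht => (hR.wt_pos ht).le) hs hst ht

theorem Profile.enr_nonneg_of_le_abs_ph {b m α T R : ℝ} {f g : ℝ → ℝ} (hb : 1 < b)
    (hReg : Regime m T) (hR2 : 2 ≤ R) (h : ∀ t ∈ Icc 0 T, R ≤ |ph m α t|) :
    0 ≤ enr b m α T f (fun t => g t / wt m t) := by
  apply intervalIntegral.integral_nonneg hReg.T_pos.le
  intro t ht
  have hw := hReg.wt_pos ht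
  have h1 : wt m t / b ≤ ph m α t ^ 2 / wt m t := by
    rw [div_le_div_iff₀ (by linarith) hw]
    have h2 : R ^ 2 ≤ ph m α t ^ 2 := by
      rw [← sq_abs (ph m α t)]; exact pow_le_pow_left₀ (by linarith) (h t ht) 2
    have h3 := hReg.wt_le ht
    nlinarith
  have h2 : dens b m α t (f t) (g t / wt m t) = wt m t * (g t / wt m t) ^ 2 +
      (ph m α t ^ 2 / wt m t - wt m t / b) * f t ^ 2 + wt m t / (2 * b) * f t ^ 4 := by
    unfold dens; field_simp; ring
  rw [h2]
  have h3 := mul_nonneg (sub_nonneg.2 h1) (sq_nonneg (f t))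
  have h4 : 0 ≤ wt m t / (2 * b) * f t ^ 4 := by positivity
  have h5 : 0 ≤ wt m t * (g t / wt m t) ^ 2 := by positivity
  linarith

/-- Adding `(y f²)'` to the density, with `y` the multiplier along the phase, completes a square and
leaves nonnegative terms. Because the multiplier changes sign at `±R`, `y(0) ≥ 0 ≥ y(T)`, and both
boundary terms have the favourable sign. -/
theorem Profile.enr_nonneg_of_bulk {b m α T R : ℝ} {f g : ℝ → ℝ} (hb : 1 < b)
    (hReg : Regime m T) (hR0 : 0 < R) (hR : 12 * (1 / b) ≤ (1 - (1 / b) ^ 2) * R ^ 2)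
    (hP : Profile b m α T f g) (h1 : α ≤ -R) (h2 : R ≤ ph m α T) :
    0 ≤ enr b m α T f (fun t => g t / wt m t) := by
  have hT := hReg.T_pos.le
  have hb0 : 0 < 1 / b := by positivity
  set y : ℝ → ℝ := fun t => multiplier (1 / b) R (ph m α t) with hy
  set M : ℝ → ℝ := fun x => 1 / b * (R ^ 4 - 4 * R ^ 2 * x ^ 2 - x ^ 4) / (R ^ 2 + x ^ 2) ^ 2 with hM
  have hy' : ∀ t, HasDerivAt y (M (ph m α t) * wt m t) t := fun t =>
    (hasDerivAt_multiplier hR0 _).comp t (hasDerivAt_ph m α t)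
  have hyc : Continuous y := continuous_iff_continuousAt.2 fun t => (hy' t).continuousAt
  have hMc : Continuous M := by
    simp only [hM]
    refine Continuous.div (by fun_prop) (by fun_prop) fun x => by positivity
  have hYd : ∀ t ∈ Icc 0 T, HasDerivAt (fun t => y t * f t ^ 2)
      (M (ph m α t) * wt m t * f t ^ 2 + y t * (2 * f t * (g t / wt m t))) t := fun t ht => by
    have := (hy' t).mul ((hP.hf t ht).pow 2)
    convert! this using 1
    simp
  have cf := hP.continuousOn_f
  have cd := hP.continuousOn_deriv hReg
  have cph := continuous_ph m α
  have cwt := continuous_wt m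
  have hcont : ContinuousOn (fun t => M (ph m α t) * wt m t * f t ^ 2 +
      y t * (2 * f t * (g t / wt m t))) (Icc 0 T) := by
    apply ContinuousOn.add
    · exact ((hMc.comp cph).mul cwt).continuousOn.mul (cf.pow 2)
    · exact hyc.continuousOn.mul ((continuousOn_const.mul cf).mul cd)
  have hint := integral_eq_sub_of_hasDerivAt_Icc hT hYd hcont
  have hle : ∫ t in (0 : ℝ)..T, -(M (ph m α t) * wt m t * f t ^ 2 +
      y t * (2 * f t * (g t / wt m t))) ≤ enr b m α T f (fun t => g t / wt m t) := by
    apply intervalIntegral.integral_mono_on hT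
    · rw [← uIcc_of_le hT] at hcont; exact hcont.neg.intervalIntegrable
    · have := continuousOn_dens (b := b) (α := α) hReg cf cd
      rw [← uIcc_of_le hT] at this; exact this.intervalIntegrable
    · intro t ht
      have hw := hReg.wt_pos ht
      have h3 := le_deriv_multiplier_add (x := ph m α t) hR0 hb0 hR
      have h4 := multiplier_sq_le (θ := 1 / b) hR0 (ph m α t)
      have h5 : dens b m α t (f t) (g t / wt m t) + (M (ph m α t) * wt m t * f t ^ 2 +
          y t * (2 * f t * (g t / wt m t))) = wt m t * (g t / wt m t + y t / wt m t * f t) ^ 2 +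
          (M (ph m α t) * wt m t + (ph m α t ^ 2 - y t ^ 2) / wt m t - wt m t / b) * f t ^ 2 +
          wt m t / (2 * b) * f t ^ 4 := by
        unfold dens; field_simp; ring
      have hb1 : (1 / b) ^ 2 ≤ 1 := by
        rw [div_pow, one_pow, div_le_one (by positivity)]; nlinarith
      have h6 : 0 ≤ ph m α t ^ 2 - y t ^ 2 := by
        have h7 : (1 / b) ^ 2 * ph m α t ^ 2 ≤ 1 * ph m α t ^ 2 :=
          mul_le_mul_of_nonneg_right hb1 (sq_nonneg _)
        simp only [hy]; linarith
      have h7 : wt m t * ((ph m α t ^ 2 - y t ^ 2) / 2) ≤ (ph m α t ^ 2 - y t ^ 2) / wt m t := by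
        rw [le_div_iff₀ hw]
        have : wt m t ^ 2 ≤ 2 := by nlinarith [hReg.wt_le ht]
        nlinarith
      have h8 : 0 ≤ M (ph m α t) * wt m t + (ph m α t ^ 2 - y t ^ 2) / wt m t - wt m t / b := by
        have h9 := mul_le_mul_of_nonneg_right h3 hw.le
        have h10 : wt m t / b = 1 / b * wt m t := by ring
        rw [h10]
        simp only [hM, hy] at *
        linarith
      have h9 := mul_nonneg h8 (sq_nonneg (f t))
      have h10 : 0 ≤ wt m t / (2 * b) * f t ^ 4 := by positivity
      have h11 : 0 ≤ wt m t * (g t / wt m t + y t / wt m t * f t) ^ 2 := by positivity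
      linarith
  rw [intervalIntegral.integral_neg, hint] at hle
  have hyT : y T ≤ 0 := by
    simp only [hy, multiplier]
    apply div_nonpos_of_nonpos_of_nonneg _ (by positivity)
    have : 0 ≤ ph m α T := by linarith
    exact mul_nonpos_of_nonneg_of_nonpos (by positivity) (by nlinarith)
  have hy0 : 0 ≤ y 0 := by
    have : ph m α 0 = α := by simp [ph]
    simp only [hy, multiplier, this]
    apply div_nonneg _ (by positivity)
    exact mul_nonneg_of_nonpos_of_nonpos
      (mul_nonpos_of_nonneg_of_nonpos hb0.le (by linarith)) (by nlinarith)
  nlinarith [sq_nonneg (f T), sq_nonneg (f 0)]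

/-- A profile of negative energy lives near one of the two end points. -/
theorem exists_localization {b : ℝ} (hb : 1 < b) :
    ∃ R : ℝ, 2 ≤ R ∧ ∀ (m T α : ℝ) (f g : ℝ → ℝ), Regime m T → Profile b m α T f g →
      enr b m α T f (fun t => g t / wt m t) < 0 → |α| < R ∨ |ph m α T| < R := by
  have hb1 : 1 / b < 1 := by rw [div_lt_one (by linarith)]; exact hb
  have hb0 : 0 < 1 / b := by positivity
  have hθ : 0 < 1 - (1 / b) ^ 2 := by nlinarith
  set Q := 12 * (1 / b) / (1 - (1 / b) ^ 2) with hQ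
  have hQ0 : 0 < Q := by positivity
  refine ⟨2 + Q, by linarith, ?_⟩
  intro m T α f g hReg hP hneg
  by_contra! hcon
  obtain ⟨h1, h2⟩ := hcon
  have hα : ph m α 0 = α := by simp [ph]
  have hmono : ∀ t ∈ Icc 0 T, α ≤ ph m α t ∧ ph m α t ≤ ph m α T := fun t ht =>
    ⟨hα.symm.le.trans (ph_mono hReg le_rfl ht.1 ht.2), ph_mono hReg ht.1 ht.2 le_rfl⟩
  refine absurd hneg (not_lt.2 ?_)
  rcases le_abs.1 h1 with h3 | h3
  · refine Profile.enr_nonneg_of_le_abs_ph hb hReg (R := 2 + Q) (by linarith) fun t ht => ?_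
    exact (h3.trans (hmono t ht).1).trans (le_abs_self _)
  rcases le_abs.1 h2 with h4 | h4
  · refine Profile.enr_nonneg_of_bulk hb hReg (R := 2 + Q) (by linarith) ?_ hP (by linarith) h4
    have : Q * (1 - (1 / b) ^ 2) = 12 * (1 / b) := div_mul_cancel₀ _ hθ.ne'
    have : Q ≤ (2 + Q) ^ 2 := by nlinarith
    nlinarith
  · refine Profile.enr_nonneg_of_le_abs_ph hb hReg (R := 2 + Q) (by linarith) fun t ht => ?_
    have := (hmono t ht).2
    exact le_trans (by linarith) (neg_le_abs _)

/-! ### Dependence of the energy on the curvature -/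

set_option maxHeartbeats 1000000 in
theorem abs_dens_sub_le {b m m' α T A t y d : ℝ} (hR : Regime m T) (hR' : Regime m' T)
    (hb : 1 ≤ b) (hα : |α| ≤ A) (ht : t ∈ Icc 0 T) (hy0 : 0 ≤ y) (hy : y ≤ 1) :
    dens b m α t y d - dens b m' α t y d ≤
      |m - m'| * ((3 * (A + 1) ^ 2 + 2) * (1 + t) ^ 3 * (d ^ 2 + y ^ 2)) := by
  have hA : 0 ≤ A := (abs_nonneg _).trans hα
  have ht0 := ht.1
  have hw := hR.wt_pos ht
  have hw' := hR'.wt_pos ht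
  have hwg := hR.wt_ge ht
  have hwg' := hR'.wt_ge ht
  have hwl := hR.wt_le ht
  have hN := hR.abs_ph_le ht hα
  have hN' := hR'.abs_ph_le ht hα
  set Δ := |m - m'| with hΔ
  have hΔ0 : 0 ≤ Δ := abs_nonneg _
  have e1 : |wt m t - wt m' t| ≤ Δ * t := by
    have : wt m t - wt m' t = -((m - m') * t) := by unfold wt; ring
    rw [this, abs_neg, abs_mul, abs_of_nonneg ht0]
  have e2 : |ph m α t - ph m' α t| ≤ Δ * t ^ 2 / 2 := by
    have : ph m α t - ph m' α t = -((m - m') * (t ^ 2 / 2)) := by unfold ph; ring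
    rw [this, abs_neg, abs_mul, abs_of_nonneg (by positivity : 0 ≤ t ^ 2 / 2)]
    linarith
  set S := (A + 1) * (1 + t) with hS
  have hS1 : 1 ≤ S := by nlinarith
  have hNS : |ph m α t| ≤ S := by nlinarith
  have hNS' : |ph m' α t| ≤ S := by nlinarith
  have e3 : ph m α t ^ 2 / wt m t - ph m' α t ^ 2 / wt m' t ≤
      Δ * (3 * (A + 1) ^ 2 * (1 + t) ^ 3) := by
    rw [div_sub_div _ _ hw.ne' hw'.ne', div_le_iff₀ (by positivity)]
    have f1 : |(ph m α t - ph m' α t) * (ph m α t + ph m' α t)| ≤ Δ * t ^ 2 / 2 * (2 * S) := by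
      rw [abs_mul]
      refine mul_le_mul e2 ((abs_add_le _ _).trans (by linarith)) (abs_nonneg _) (by positivity)
    have f2 : |ph m α t ^ 2 * (wt m' t - wt m t)| ≤ S ^ 2 * (Δ * t) := by
      rw [abs_mul, abs_sub_comm]
      refine mul_le_mul ?_ e1 (abs_nonneg _) (by positivity)
      rw [abs_pow]
      exact pow_le_pow_left₀ (abs_nonneg _) hNS 2
    have f3 : |wt m t * ((ph m α t - ph m' α t) * (ph m α t + ph m' α t))| ≤
        11 / 10 * (Δ * t ^ 2 / 2 * (2 * S)) := by
      rw [abs_mul, abs_of_pos hw]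
      exact mul_le_mul hwl f1 (abs_nonneg _) (by norm_num)
    have f4 : ph m α t ^ 2 * wt m' t - wt m t * ph m' α t ^ 2 =
        ph m α t ^ 2 * (wt m' t - wt m t) +
          wt m t * ((ph m α t - ph m' α t) * (ph m α t + ph m' α t)) := by ring
    rw [f4]
    have f5 := (abs_le.1 f2).2
    have f6 := (abs_le.1 f3).2
    have f7 : 81 / 100 ≤ wt m t * wt m' t := by nlinarith
    have f8 : S ^ 2 * (Δ * t) ≤ Δ * ((A + 1) ^ 2 * (1 + t) ^ 3) := by
      have : Δ * ((A + 1) ^ 2 * (1 + t) ^ 3) = S ^ 2 * (Δ * (1 + t)) := by rw [hS]; ring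
      rw [this]; gcongr; linarith
    have f9 : Δ * t ^ 2 / 2 * (2 * S) ≤ Δ * ((A + 1) ^ 2 * (1 + t) ^ 3) := by
      have g1 : Δ * t ^ 2 / 2 * (2 * S) = Δ * ((A + 1) * (t ^ 2 * (1 + t))) := by rw [hS]; ring
      rw [g1]
      apply mul_le_mul_of_nonneg_left _ hΔ0
      have g2 : t ^ 2 * (1 + t) ≤ (1 + t) ^ 3 := by nlinarith
      have g3 : A + 1 ≤ (A + 1) ^ 2 := by nlinarith
      exact mul_le_mul g3 g2 (by positivity) (by positivity)
    have f10 : 0 ≤ Δ * ((A + 1) ^ 2 * (1 + t) ^ 3) := by positivity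
    have f11 := mul_le_mul_of_nonneg_left f7 f10
    linarith
  have e4 : (wt m t - wt m' t) * d ^ 2 ≤ Δ * t * d ^ 2 :=
    mul_le_mul_of_nonneg_right ((le_abs_self _).trans e1) (sq_nonneg d)
  have e5 : -((wt m t - wt m' t) * ((2 * y ^ 2 - y ^ 4) / (2 * b))) ≤ Δ * t * y ^ 2 := by
    have g0 : 0 ≤ 2 * y ^ 2 - y ^ 4 := by
      have : y ^ 2 ≤ 1 := by nlinarith
      nlinarith [sq_nonneg y]
    have g1 : (2 * y ^ 2 - y ^ 4) / (2 * b) ≤ y ^ 2 := by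
      rw [div_le_iff₀ (by positivity)]
      nlinarith [sq_nonneg y, sq_nonneg (y ^ 2)]
    have g2 : 0 ≤ (2 * y ^ 2 - y ^ 4) / (2 * b) := by positivity
    have g3 : -(wt m t - wt m' t) ≤ Δ * t := (neg_le_abs _).trans e1
    have g4 : 0 ≤ Δ * t := by positivity
    rw [← neg_mul]
    exact (mul_le_mul_of_nonneg_right g3 g2).trans (mul_le_mul_of_nonneg_left g1 g4)
  have e6 : (ph m α t ^ 2 / wt m t - ph m' α t ^ 2 / wt m' t) * y ^ 2 ≤
      Δ * (3 * (A + 1) ^ 2 * (1 + t) ^ 3) * y ^ 2 := mul_le_mul_of_nonneg_right e3 (sq_nonneg y)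
  have e7 : dens b m α t y d - dens b m' α t y d = (wt m t - wt m' t) * d ^ 2 +
      (ph m α t ^ 2 / wt m t - ph m' α t ^ 2 / wt m' t) * y ^ 2 +
      -((wt m t - wt m' t) * ((2 * y ^ 2 - y ^ 4) / (2 * b))) := by
    unfold dens; ring
  rw [e7]
  have e8 : Δ * t * (d ^ 2 + y ^ 2) ≤ Δ * (2 * (1 + t) ^ 3 * (d ^ 2 + y ^ 2)) := by
    have : t ≤ 2 * (1 + t) ^ 3 := by nlinarith [pow_pos (by linarith : 0 < 1 + t) 2]
    rw [mul_assoc]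
    gcongr
  have e9 : Δ * (3 * (A + 1) ^ 2 * (1 + t) ^ 3) * y ^ 2 ≤
      Δ * (3 * (A + 1) ^ 2 * (1 + t) ^ 3) * (d ^ 2 + y ^ 2) := by
    gcongr; nlinarith [sq_nonneg d]
  linarith

theorem one_add_cube_le_exp {x : ℝ} (hx : 0 ≤ x) : (1 + x) ^ 3 ≤ 27 * Real.exp x := by
  have h := Real.add_one_le_exp (x / 3)
  have h1 : Real.exp x = Real.exp (x / 3) ^ 3 := by rw [← Real.exp_nat_mul]; ring_nf
  rw [h1]
  have : (1 + x) ≤ 3 * Real.exp (x / 3) := by linarith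
  calc (1 + x) ^ 3 ≤ (3 * Real.exp (x / 3)) ^ 3 := pow_le_pow_left₀ (by linarith) this 3
    _ = _ := by ring

/-- Exponential decay absorbs the cubic factor in the change of the density, so the Lipschitz
constant in the curvature does not grow with `T`. -/
theorem enr_le_enr_add {b m m' α T A C : ℝ} (hR : Regime m T) (hR' : Regime m' T)
    (hb : 1 ≤ b) (hα : |α| ≤ A) {f d : ℝ → ℝ}
    (cf : ContinuousOn f (Icc 0 T)) (cd : ContinuousOn d (Icc 0 T))
    (hf0 : ∀ t ∈ Icc 0 T, 0 ≤ f t) (hf1 : ∀ t ∈ Icc 0 T, f t ≤ 1)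
    (hf : ∀ t ∈ Icc 0 T, |f t| ≤ C * Real.exp (-t)) (hd : ∀ t ∈ Icc 0 T, |d t| ≤ C * Real.exp (-t)) :
    enr b m α T f d ≤ enr b m' α T f d + 54 * C ^ 2 * (3 * (A + 1) ^ 2 + 2) * |m - m'| := by
  have hT := hR.T_pos.le
  have i1 := continuousOn_dens (b := b) (α := α) hR cf cd
  have i2 := continuousOn_dens (b := b) (α := α) hR' cf cd
  rw [← uIcc_of_le hT] at i1 i2
  set K := |m - m'| * ((3 * (A + 1) ^ 2 + 2) * (54 * C ^ 2)) with hK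
  have hK0 : 0 ≤ K := by positivity
  have h1 : enr b m α T f d - enr b m' α T f d ≤ ∫ t in (0 : ℝ)..T, K * Real.exp (-1 * t) := by
    unfold enr
    rw [← intervalIntegral.integral_sub i1.intervalIntegrable i2.intervalIntegrable]
    apply intervalIntegral.integral_mono_on hT
    · exact (i1.sub i2).intervalIntegrable
    · exact (by fun_prop : Continuous fun t => K * Real.exp (-1 * t)).intervalIntegrable _ _
    · intro t ht
      refine (abs_dens_sub_le hR hR' hb hα ht (hf0 t ht) (hf1 t ht)).trans ?_
      rw [hK, mul_assoc, mul_assoc]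
      refine mul_le_mul_of_nonneg_left ?_ (abs_nonneg _)
      rw [mul_assoc]
      refine mul_le_mul_of_nonneg_left ?_ (by positivity)
      have h2 : d t ^ 2 ≤ C ^ 2 * Real.exp (-t) ^ 2 := by
        rw [← sq_abs (d t), ← mul_pow]; exact pow_le_pow_left₀ (abs_nonneg _) (hd t ht) 2
      have h3 : f t ^ 2 ≤ C ^ 2 * Real.exp (-t) ^ 2 := by
        rw [← sq_abs (f t), ← mul_pow]; exact pow_le_pow_left₀ (abs_nonneg _) (hf t ht) 2
      have h4 := one_add_cube_le_exp ht.1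
      have h5 : Real.exp t * Real.exp (-t) ^ 2 = Real.exp (-1 * t) := by
        rw [← Real.exp_nat_mul, ← Real.exp_add]; ring_nf
      calc (1 + t) ^ 3 * (d t ^ 2 + f t ^ 2)
          ≤ (27 * Real.exp t) * (2 * (C ^ 2 * Real.exp (-t) ^ 2)) :=
            mul_le_mul h4 (by linarith) (by positivity) (by positivity)
        _ = 54 * C ^ 2 * (Real.exp t * Real.exp (-t) ^ 2) := by ring
        _ = 54 * C ^ 2 * Real.exp (-1 * t) := by rw [h5]
  rw [intervalIntegral.integral_const_mul] at h1
  have h2 := integral_exp_neg_le (c := 1) (T := T) one_pos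
  have h3 : K * ∫ t in (0 : ℝ)..T, Real.exp (-1 * t) ≤ K * (1 / 1) :=
    mul_le_mul_of_nonneg_left h2 hK0
  rw [hK] at h1 h3
  linarith

theorem Tame.le_exp {m T L : ℝ} {f g : ℝ → ℝ} (hR : Regime m T) (h : Tame T L f g) :
    (∀ t ∈ Icc 0 T, |f t| ≤ 5 * L ^ 2 * Real.exp (-t)) ∧
    (∀ t ∈ Icc 0 T, |g t / wt m t| ≤ 5 * L ^ 2 * Real.exp (-t)) := by
  have hL := h.one_le
  have h0 : ∀ t ∈ Icc 0 T, f t ≤ L * Real.exp (-2 * t) := fun t ht => by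
    have h1 := h.decay 0 t le_rfl ht.1 ht.2
    rw [sub_zero] at h1
    exact h1.trans (mul_le_of_le_one_right (by positivity) (h.le_one 0 hR.zero_mem))
  have he : ∀ t : ℝ, Real.exp (-2 * t) = Real.exp (-t) * Real.exp (-t) := fun t => by
    rw [← Real.exp_add]; ring_nf
  constructor
  · intro t ht
    rw [abs_of_pos (h.pos t ht)]
    refine (h0 t ht).trans ?_
    have h1 : Real.exp (-2 * t) ≤ Real.exp (-t) := Real.exp_le_exp.2 (by linarith [ht.1])
    have h2 : L ≤ 5 * L ^ 2 := by nlinarith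
    exact mul_le_mul h2 h1 (Real.exp_pos _).le (by positivity)
  · intro t ht
    have hw := hR.wt_pos ht
    rw [abs_div, abs_of_pos hw, div_le_iff₀ hw]
    have ht0 := ht.1
    have h1 := h.abs_g_le t ht
    have h2 := one_add_sq_le_exp ht0
    have h3 : L * (1 + t) ^ 2 * f t ≤ L * (4 * Real.exp t) * (L * Real.exp (-2 * t)) :=
      mul_le_mul (mul_le_mul_of_nonneg_left h2 (by linarith)) (h0 t ht) (h.pos t ht).le
        (by positivity)
    have h4 : L * (4 * Real.exp t) * (L * Real.exp (-2 * t)) = 4 * L ^ 2 * Real.exp (-t) := by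
      have : Real.exp t * Real.exp (-2 * t) = Real.exp (-t) := by rw [← Real.exp_add]; ring_nf
      rw [← this]; ring
    have h5 : 0 < L ^ 2 * Real.exp (-t) := by positivity
    nlinarith [hR.wt_ge ht]

/-! ### Reflection -/

/-- The reflected weight `w(T - s)` divided by `w(T)` is again affine with value `1` at `0`, which
dictates the new curvature; the phase and the flux change sign. -/
theorem Profile.reflect {b m α T : ℝ} {f g : ℝ → ℝ} (hR : Regime m T) (hP : Profile b m α T f g) :
    Profile b (-m / wt m T) (-ph m α T / wt m T) T (fun s => f (T - s))
      (fun s => -g (T - s) / wt m T) := by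
  have hmem : ∀ s ∈ Icc 0 T, T - s ∈ Icc 0 T := fun s hs => ⟨by linarith [hs.2], by linarith [hs.1]⟩
  have hwT := (hR.wt_pos hR.right_mem).ne'
  have ew : ∀ s, wt (-m / wt m T) s = wt m (T - s) / wt m T := fun s => by
    rw [eq_div_iff hwT]
    have : wt (-m / wt m T) s * wt m T = wt m T + m * s := by
      rw [wt]; field_simp
      ring
    rw [this]; unfold wt; ring
  have ep : ∀ s, ph (-m / wt m T) (-ph m α T / wt m T) s = -ph m α (T - s) / wt m T := fun s => by
    rw [eq_div_iff hwT]
    have : ph (-m / wt m T) (-ph m α T / wt m T) s * wt m T =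
        s * wt m T - ph m α T + m * s ^ 2 / 2 := by
      rw [ph]; field_simp
      ring
    rw [this]; unfold wt ph; ring
  refine ⟨?_, ?_, ?_, ?_, ?_⟩
  · intro s hs
    have h1 := (hP.hf _ (hmem s hs)).comp s ((hasDerivAt_id s).const_sub T)
    have hw := (hR.wt_pos (hmem s hs)).ne'
    convert! h1 using 1
    rw [ew]; field_simp
  · intro s hs
    have h1 := (((hP.hg _ (hmem s hs)).comp s ((hasDerivAt_id s).const_sub T)).neg).div_const (wt m T)
    have hw := (hR.wt_pos (hmem s hs)).ne'
    convert! h1 using 1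
    simp only [coef]
    rw [ew, ep]
    rcases eq_or_ne b 0 with rfl | hb
    · field_simp
    field_simp
  · simp [hP.gT]
  · simp [hP.g0]
  · exact fun s hs => hP.nonneg _ (hmem s hs)

/-- By the energy identity both sides are integrals of the weight times `f⁴`, so only the weight has
to be transformed. -/
theorem Profile.enr_reflect {b m α T : ℝ} {f g : ℝ → ℝ} (hR : Regime m T)
    (hR' : Regime (-m / wt m T) T) (hP : Profile b m α T f g) :
    enr b m α T f (fun t => g t / wt m t) = wt m T *
      enr b (-m / wt m T) (-ph m α T / wt m T) T (fun s => f (T - s))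
        (fun s => (-g (T - s) / wt m T) / wt (-m / wt m T) s) := by
  have hwT := (hR.wt_pos hR.right_mem).ne'
  have ew : ∀ s, wt m T * wt (-m / wt m T) s = wt m (T - s) := fun s => by
    have : wt m T * wt (-m / wt m T) s = wt m T + m * s := by
      rw [wt.eq_1 (-m / wt m T)]; field_simp
      ring
    rw [this]; unfold wt; ring
  rw [hP.enr_eq hR, (hP.reflect hR).enr_eq hR', mul_neg, ← intervalIntegral.integral_const_mul]
  congr 1
  have h1 := intervalIntegral.integral_comp_sub_left (a := 0) (b := T)
    (fun t => wt m t / (2 * b) * f t ^ 4) T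
  rw [sub_self, sub_zero] at h1
  rw [← h1]
  congr 1; ext s
  rw [← ew]; ring

end SurfaceSC

namespace SurfaceSC

/-! ### A trial state of negative energy -/

theorem oscEnergy_nonneg (α : ℝ) : 0 ≤ oscEnergy α := by
  apply Real.sInf_nonneg
  rintro E ⟨u, _, _, rfl⟩
  exact integral_nonneg fun t => by positivity

theorem exists_oscDomain_lt {b : ℝ} (hb1 : 1 < b) (hb2 : b < Theta0⁻¹) :
    ∃ (α : ℝ) (u : ℝ → ℝ), OscDomain α u ∧ (∫ t in Ioi 0, u t ^ 2) = 1 ∧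
      ∫ t in Ioi 0, (deriv u t ^ 2 + (t + α) ^ 2 * u t ^ 2) < 1 / b := by
  have hΘ : 0 < Theta0 := by
    by_contra! h
    have := inv_nonpos.2 h
    linarith
  have hΘb : Theta0 < 1 / b := by
    rw [lt_div_iff₀ (by linarith)]
    calc Theta0 * b < Theta0 * Theta0⁻¹ := mul_lt_mul_of_pos_left hb2 hΘ
      _ = 1 := mul_inv_cancel₀ hΘ.ne'
  obtain ⟨α, hα⟩ := exists_lt_of_ciInf_lt hΘb
  have hα0 : 0 < oscEnergy α :=
    hΘ.trans_le (ciInf_le ⟨0, by rintro _ ⟨β, rfl⟩; exact oscEnergy_nonneg β⟩ α)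
  -- The infimum of the empty set is `0` by convention, so positivity of the energy shows that
  -- admissible functions exist.
  have hne : {E : ℝ | ∃ u : ℝ → ℝ, OscDomain α u ∧ (∫ t in Ioi 0, u t ^ 2) = 1 ∧
      E = ∫ t in Ioi 0, (deriv u t ^ 2 + (t + α) ^ 2 * u t ^ 2)}.Nonempty := by
    by_contra! h
    unfold oscEnergy at hα0
    rw [h, Real.sInf_empty] at hα0
    exact lt_irrefl _ hα0
  obtain ⟨E, ⟨u, hu, hu1, rfl⟩, hE⟩ := exists_lt_of_csInf_lt hne hα
  exact ⟨α, u, hu, hu1, hE⟩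

namespace OscDomain
variable {α : ℝ} {u : ℝ → ℝ}

theorem memH1 (hu : OscDomain α u) {T : ℝ} (hT : 0 < T) : MemH1 T u := by
  refine ⟨hu.1 T hT, ?_⟩
  have h : volume.restrict (Icc (0 : ℝ) T) = volume.restrict (Ioc 0 T) :=
    (Measure.restrict_congr_set Ioc_ae_eq_Icc).symm
  rw [h]
  exact hu.2.2.1.mono_measure (Measure.restrict_mono Ioc_subset_Ioi_self le_rfl)

theorem integrable_sq (hu : OscDomain α u) : IntegrableOn (fun t => u t ^ 2) (Ioi 0) :=
  hu.2.1.integrable_sq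

theorem integrable_deriv_sq (hu : OscDomain α u) : IntegrableOn (fun t => deriv u t ^ 2) (Ioi 0) :=
  hu.2.2.1.integrable_sq

theorem integrable_pot (hu : OscDomain α u) :
    IntegrableOn (fun t => (t + α) ^ 2 * u t ^ 2) (Ioi 0) := by
  have := hu.2.2.2.integrable_sq
  simp only [mul_pow] at this
  exact this

theorem intervalIntegral_le {p : ℝ → ℝ} (hp : IntegrableOn p (Ioi 0)) (h0 : ∀ t, 0 ≤ p t)
    {s t : ℝ} (hs : 0 ≤ s) (hst : s ≤ t) : ∫ r in s..t, p r ≤ ∫ r in Ioi 0, p r := by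
  rw [intervalIntegral.integral_of_le hst]
  exact setIntegral_mono_set hp (Filter.Eventually.of_forall h0)
    (Filter.Eventually.of_forall fun r hr => hs.trans_lt hr.1)

theorem intervalIntegrable {p : ℝ → ℝ} (hp : IntegrableOn p (Ioi 0))
    {s t : ℝ} (hs : 0 ≤ s) (hst : s ≤ t) : IntervalIntegrable p volume s t := by
  rw [intervalIntegrable_iff_integrableOn_Ioc_of_le hst]
  exact hp.mono_set fun r hr => hs.trans_lt hr.1

/-- The increments of `u²` are integrals of `2 u u'`, bounded by the `H¹` norm squared, and
normalization forces `u² ≤ 2` somewhere in `[0, 1]`. -/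
theorem exists_sq_le (hu : OscDomain α u) (h1 : (∫ t in Ioi 0, u t ^ 2) = 1) :
    ∃ M : ℝ, 1 ≤ M ∧ ∀ t, 0 ≤ t → u t ^ 2 ≤ M := by
  set J := ∫ t in Ioi 0, (u t ^ 2 + deriv u t ^ 2) with hJ
  have hint := hu.integrable_sq.add hu.integrable_deriv_sq
  have hJ0 : 0 ≤ J := integral_nonneg fun t => by positivity
  have hinc : ∀ s t, 0 ≤ s → s ≤ t → |u t ^ 2 - u s ^ 2| ≤ J := by
    intro s t hs hst
    have hac : AbsolutelyContinuousOnInterval u s t := by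
      refine (hu.1 (t + 1) (by linarith)).mono ?_
      rw [uIcc_of_le hst, uIcc_of_le (by linarith)]
      exact Icc_subset_Icc hs (by linarith)
    have h2 := hac.integral_deriv_mul_eq_sub hac
    have h3 : u t ^ 2 - u s ^ 2 = ∫ x in s..t, deriv u x * u x + u x * deriv u x := by
      rw [h2]; ring
    rw [h3, ← Real.norm_eq_abs]
    refine (intervalIntegral.norm_integral_le_of_norm_le hst
      (Filter.Eventually.of_forall fun x _ => ?_) (intervalIntegrable hint hs hst)).trans
      (intervalIntegral_le hint (fun t => by simp only [Pi.add_apply]; positivity) hs hst)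
    rw [Real.norm_eq_abs, abs_le, Pi.add_apply]
    constructor <;> nlinarith [sq_nonneg (u x + deriv u x), sq_nonneg (u x - deriv u x)]
  have hs : ∃ s ∈ Icc (0 : ℝ) 1, u s ^ 2 ≤ 2 := by
    by_contra! h
    have h2 : ∫ t in (0 : ℝ)..1, (2 : ℝ) ≤ ∫ t in (0 : ℝ)..1, u t ^ 2 :=
      intervalIntegral.integral_mono_on zero_le_one (by simp)
        (intervalIntegrable hu.integrable_sq le_rfl zero_le_one) fun t ht => (h t ht).le
    have h3 := intervalIntegral_le hu.integrable_sq (fun t => by positivity) le_rfl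
      (zero_le_one (α := ℝ))
    simp at h2
    linarith
  obtain ⟨s, hs, hs2⟩ := hs
  refine ⟨2 + J, by linarith, fun t ht => ?_⟩
  rcases le_total s t with h | h
  · have := (abs_le.1 (hinc s t hs.1 h)).2; linarith
  · have := (abs_le.1 (hinc t s ht h)).1; linarith

end OscDomain

/-- For `|m| T² ≤ η` the weight is within `η` of `1` and the phase within `η / 2` of `t + α`. Every
error relative to the oscillator thus carries a factor `η`, to be absorbed by the gap between `1 /
b` and the energy of the trial function. -/
theorem dens_trial_le {b m α T η t y d M : ℝ} (hR : Regime m T) (hb : 1 ≤ b)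
    (hη0 : 0 < η) (hη : η ≤ 1 / 10) (hm : |m| * T ^ 2 ≤ η) (ht : t ∈ Icc 0 T) (hM : y ^ 2 ≤ M) (s : ℝ) :
    dens b m α t (s * y) (s * d) ≤ s ^ 2 * ((1 + 4 * η) * (d ^ 2 + (t + α) ^ 2 * y ^ 2) +
      3 * η * y ^ 2 - 1 / b * y ^ 2) + s ^ 4 * (M * y ^ 2) := by
  have hw := hR.wt_pos ht
  have hb0 : 0 < b := by linarith
  have ht0 := ht.1
  have h1 := hR.one_le
  have hm0 := abs_nonneg m
  have hmt : |m * t| ≤ η := by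
    rw [abs_mul, abs_of_nonneg ht0]
    have : t ≤ T ^ 2 := by nlinarith [ht.2]
    nlinarith
  have hmt2 : |m * t ^ 2 / 2| ≤ η / 2 := by
    rw [abs_div, abs_mul, abs_of_nonneg (sq_nonneg t), abs_of_pos (by norm_num : (0:ℝ) < 2)]
    have : t ^ 2 ≤ T ^ 2 := pow_le_pow_left₀ ht0 ht.2 2
    nlinarith
  have hw1 : wt m t ≤ 1 + η := by have := (abs_le.1 hmt).1; unfold wt; linarith
  have hw2 : 1 - η ≤ wt m t := by have := (abs_le.1 hmt).2; unfold wt; linarith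
  have hph : ph m α t ^ 2 ≤ (1 + η) * (t + α) ^ 2 + η := by
    set x := m * t ^ 2 / 2
    have e : ph m α t = (t + α) - x := rfl
    have hx2 : x ^ 2 ≤ (η / 2) ^ 2 := by
      rw [← sq_abs x]; exact pow_le_pow_left₀ (abs_nonneg _) hmt2 2
    have h2 : -(2 * (t + α) * x) ≤ η * (t + α) ^ 2 + x ^ 2 / η := by
      have h3 : 0 ≤ (η * (t + α) + x) ^ 2 / η := by positivity
      have h4 : (η * (t + α) + x) ^ 2 / η = η * (t + α) ^ 2 + 2 * (t + α) * x + x ^ 2 / η := by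
        field_simp; ring
      linarith
    have h5 : x ^ 2 / η ≤ η / 4 := by
      rw [div_le_iff₀ hη0]; nlinarith
    rw [e]
    nlinarith
  have hq : ph m α t ^ 2 / wt m t ≤ (1 + 4 * η) * (t + α) ^ 2 + 2 * η := by
    rw [div_le_iff₀ hw]
    have h2 : ((1 + 4 * η) * (t + α) ^ 2 + 2 * η) * (1 - η) ≤
        ((1 + 4 * η) * (t + α) ^ 2 + 2 * η) * wt m t := by gcongr
    have h3 : 0 ≤ (t + α) ^ 2 * (η * (2 - 4 * η)) :=
      mul_nonneg (sq_nonneg _) (mul_nonneg hη0.le (by linarith))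
    nlinarith
  have hlin : wt m t * d ^ 2 + ph m α t ^ 2 / wt m t * y ^ 2 - wt m t / b * y ^ 2 ≤
      (1 + 4 * η) * (d ^ 2 + (t + α) ^ 2 * y ^ 2) + 3 * η * y ^ 2 - 1 / b * y ^ 2 := by
    have h2 : wt m t * d ^ 2 ≤ (1 + 4 * η) * d ^ 2 :=
      mul_le_mul_of_nonneg_right (by linarith) (sq_nonneg d)
    have h3 := mul_le_mul_of_nonneg_right hq (sq_nonneg y)
    have h4 : (1 / b - η) * y ^ 2 ≤ wt m t / b * y ^ 2 := by
      apply mul_le_mul_of_nonneg_right _ (sq_nonneg y)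
      rw [le_div_iff₀ hb0]
      have : (1 / b - η) * b = 1 - η * b := by field_simp
      rw [this]; nlinarith
    nlinarith
  have hquart : wt m t / (2 * b) * y ^ 4 ≤ M * y ^ 2 := by
    have h2 : wt m t / (2 * b) ≤ 1 := by
      rw [div_le_one (by positivity)]; linarith
    have h3 : y ^ 4 ≤ M * y ^ 2 := by nlinarith [sq_nonneg y]
    nlinarith [pow_nonneg (sq_nonneg y) 2]
  have e : dens b m α t (s * y) (s * d) = s ^ 2 * (wt m t * d ^ 2 + ph m α t ^ 2 / wt m t * y ^ 2 -
      wt m t / b * y ^ 2) + s ^ 4 * (wt m t / (2 * b) * y ^ 4) := by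
    unfold dens; field_simp; ring
  rw [e]
  exact add_le_add (mul_le_mul_of_nonneg_left hlin (by positivity))
    (mul_le_mul_of_nonneg_left hquart (by positivity))

theorem exists_trial {b : ℝ} (hb1 : 1 < b) (hb2 : b < Theta0⁻¹) :
    ∃ α₀ c T₁ η : ℝ, 0 < c ∧ 0 < η ∧ ∀ m T : ℝ, Regime m T → T₁ ≤ T → |m| * T ^ 2 ≤ η →
      ∃ h : ℝ → ℝ, MemH1 T h ∧ enr b m α₀ T h (deriv h) ≤ -c := by
  obtain ⟨α, u, hu, hu1, hlt⟩ := exists_oscDomain_lt hb1 hb2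
  obtain ⟨M, hM1, hM⟩ := hu.exists_sq_le hu1
  set A := ∫ t in Ioi 0, (deriv u t ^ 2 + (t + α) ^ 2 * u t ^ 2) with hA
  have hA0 : 0 ≤ A := integral_nonneg fun t => by positivity
  have hb0 : 0 < b := by linarith
  have hb1' : 1 / b < 1 := by rw [div_lt_one hb0]; exact hb1
  set γ := 1 / b - A with hγ
  have hγ0 : 0 < γ := by linarith
  have hγ1 : γ ≤ 1 := by linarith
  have htend := intervalIntegral_tendsto_integral_Ioi (0 : ℝ) hu.integrable_sq Filter.tendsto_id
  rw [hu1] at htend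
  have hev := htend.eventually (lt_mem_nhds (show 1 - γ / 4 < 1 by linarith))
  obtain ⟨T₁, hT₁⟩ := Filter.eventually_atTop.1 hev
  -- The curvature costs at most `7 η = γ / 4` and the truncation at `T` another `γ / 4`, so half of
  -- the gap `γ` survives.
  set η := γ / 28 with hη
  have hη0 : 0 < η := by positivity
  refine ⟨α, γ ^ 2 / (16 * M), T₁, η, by positivity, hη0, ?_⟩
  intro m T hR hTT hm
  have hT := hR.T_pos
  have hH1 := hu.memH1 hT
  -- With this amplitude the quartic term takes at most half of the remaining quadratic gain `s² γ /
  -- 2`.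
  set s := Real.sqrt (γ / (4 * M)) with hs
  have hs2 : s ^ 2 = γ / (4 * M) := Real.sq_sqrt (by positivity)
  refine ⟨fun t => 0 + s * u t, (MemH1.const T 0).add_smul hH1 hT.le s, ?_⟩
  rw [enr_congr hT.le (f₁ := fun t => s * u t) (d₁ := fun t => s * deriv u t)
    (fun t _ => zero_add _) (by
      filter_upwards [(MemH1.const T 0).deriv_add_smul hH1 hT.le s] with t ht ht'
      rw [ht ht']; simp)]
  have iu := OscDomain.intervalIntegrable hu.integrable_sq le_rfl hT.le
  have id := OscDomain.intervalIntegrable hu.integrable_deriv_sq le_rfl hT.le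
  have ip := OscDomain.intervalIntegrable hu.integrable_pot le_rfl hT.le
  have hint : ∫ t in (0 : ℝ)..T, (s ^ 2 * ((1 + 4 * η) * (deriv u t ^ 2 + (t + α) ^ 2 * u t ^ 2) +
      3 * η * u t ^ 2 - 1 / b * u t ^ 2) + s ^ 4 * (M * u t ^ 2)) =
      s ^ 2 * ((1 + 4 * η) * (∫ t in (0 : ℝ)..T, (deriv u t ^ 2 + (t + α) ^ 2 * u t ^ 2)) +
        3 * η * (∫ t in (0 : ℝ)..T, u t ^ 2) - 1 / b * (∫ t in (0 : ℝ)..T, u t ^ 2)) +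
        s ^ 4 * (M * ∫ t in (0 : ℝ)..T, u t ^ 2) := by
    rw [intervalIntegral.integral_add
        (((((id.add ip).const_mul _).add (iu.const_mul _)).sub (iu.const_mul _)).const_mul _)
        ((iu.const_mul _).const_mul _),
      intervalIntegral.integral_const_mul, intervalIntegral.integral_const_mul,
      intervalIntegral.integral_const_mul,
      intervalIntegral.integral_sub (((id.add ip).const_mul _).add (iu.const_mul _))
        (iu.const_mul _),
      intervalIntegral.integral_add ((id.add ip).const_mul _) (iu.const_mul _),
      intervalIntegral.integral_const_mul, intervalIntegral.integral_const_mul,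
      intervalIntegral.integral_const_mul]
  have hle : enr b m α T (fun t => s * u t) (fun t => s * deriv u t) ≤
      ∫ t in (0 : ℝ)..T, (s ^ 2 * ((1 + 4 * η) * (deriv u t ^ 2 + (t + α) ^ 2 * u t ^ 2) +
      3 * η * u t ^ 2 - 1 / b * u t ^ 2) + s ^ 4 * (M * u t ^ 2)) := by
    apply intervalIntegral.integral_mono_on hT.le
    · have cw : ContinuousOn (fun t => wt m t) (uIcc 0 T) := (continuous_wt m).continuousOn
      have cu : ContinuousOn u (uIcc 0 T) := hH1.1.continuousOn
      have cp : ContinuousOn (fun t => ph m α t ^ 2 / wt m t) (uIcc 0 T) := by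
        rw [uIcc_of_le hT.le]; exact continuousOn_ph_sq_div hR
      have i1 : IntervalIntegrable (fun t => wt m t * deriv u t ^ 2) volume 0 T :=
        id.continuousOn_mul cw
      have i2 : IntervalIntegrable (fun t => ph m α t ^ 2 / wt m t * (s * u t) ^ 2 -
          wt m t / (2 * b) * (2 * (s * u t) ^ 2 - (s * u t) ^ 4)) volume 0 T :=
        ContinuousOn.intervalIntegrable (by fun_prop)
      refine ((i1.const_mul (s ^ 2)).add i2).congr fun t _ => ?_
      simp only [dens]; ring
    · exact (((((id.add ip).const_mul _).add (iu.const_mul _)).sub (iu.const_mul _)).const_mul _).add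
        ((iu.const_mul _).const_mul _)
    · intro t ht
      exact dens_trial_le hR hb1.le hη0 (by linarith) hm ht (hM t ht.1) s
  rw [hint] at hle
  have hU1 : ∫ t in (0 : ℝ)..T, u t ^ 2 ≤ 1 := by
    rw [← hu1]
    exact OscDomain.intervalIntegral_le hu.integrable_sq (fun t => by positivity) le_rfl hT.le
  have hU2 : 1 - γ / 4 < ∫ t in (0 : ℝ)..T, u t ^ 2 := hT₁ T hTT
  have hD : ∫ t in (0 : ℝ)..T, (deriv u t ^ 2 + (t + α) ^ 2 * u t ^ 2) ≤ A :=
    OscDomain.intervalIntegral_le (hu.integrable_deriv_sq.add hu.integrable_pot)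
      (fun t => by simp only [Pi.add_apply]; positivity) le_rfl hT.le
  set U := ∫ t in (0 : ℝ)..T, u t ^ 2
  set D := ∫ t in (0 : ℝ)..T, (deriv u t ^ 2 + (t + α) ^ 2 * u t ^ 2)
  have h1 : (1 + 4 * η) * D + 3 * η * U - 1 / b * U ≤ -(γ / 2) := by
    have g1 : (1 + 4 * η) * D ≤ (1 + 4 * η) * A := by gcongr
    have g2 : 3 * η * U ≤ 3 * η * 1 := by gcongr
    have g3 : 1 / b * (1 - γ / 4) ≤ 1 / b * U := by gcongr
    have g4 : 4 * η * A ≤ 4 * η * 1 := by gcongr; linarith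
    have g5 : 1 / b * (γ / 4) ≤ γ / 4 := by nlinarith
    rw [hη] at *
    linarith
  have h2 : s ^ 4 * (M * U) ≤ s ^ 2 * (γ / 4) := by
    have : s ^ 4 * (M * U) = s ^ 2 * (γ / 4 * U) := by
      have : s ^ 4 = s ^ 2 * s ^ 2 := by ring
      rw [this, hs2]; field_simp
    rw [this]
    gcongr
    nlinarith
  have h3 := mul_le_mul_of_nonneg_left h1 (sq_nonneg s)
  have h4 : s ^ 2 * -(γ / 2) + s ^ 2 * (γ / 4) = -(γ ^ 2 / (16 * M)) := by
    rw [hs2]; field_simp; ring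
  linarith

end SurfaceSC

/-! ### The primitive `F` given by the phase equation, and the approximate first integral. -/

namespace SurfaceSC

theorem exists_primitive {q : ℝ → ℝ} {T : ℝ} (hT : 0 ≤ T) (hq : ContinuousOn q (Icc 0 T)) :
    ∃ F : ℝ → ℝ, F 0 = 0 ∧ F T = (∫ t in (0 : ℝ)..T, q t) ∧
      ∀ t ∈ Icc 0 T, HasDerivAt F (q t) t := by
  set P : ℝ → ℝ := fun t => max 0 (min T t) with hPdef
  have hPc : Continuous P := by fun_prop
  have hPm : ∀ t, P t ∈ Icc 0 T := fun t => ⟨le_max_left _ _, max_le hT (min_le_left _ _)⟩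
  have hPe : ∀ t ∈ Icc 0 T, P t = t := fun t ht => by
    simp only [hPdef]; rw [min_eq_right ht.2, max_eq_right ht.1]
  have hcq : Continuous fun t => q (P t) := hq.comp_continuous hPc hPm
  refine ⟨fun t => ∫ s in (0 : ℝ)..t, q (P s), by simp, ?_, fun t ht => ?_⟩
  · apply intervalIntegral.integral_congr
    intro t ht
    rw [uIcc_of_le hT] at ht
    simp only [hPe t ht]
  · have := intervalIntegral.integral_hasDerivAt_right (hcq.intervalIntegrable 0 t)
      hcq.aestronglyMeasurable.stronglyMeasurableAtFilter hcq.continuousAt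
    simp only [hPe t ht] at this
    exact this

/-- A tame profile with optimal phase, and the primitive of `2 (N / w) f²`. -/
structure OptimalProfile (b m α T A L : ℝ) (f g F : ℝ → ℝ) : Prop where
  reg : Regime m T
  one_lt : 1 < b
  abs_le : |α| ≤ A
  prof : Profile b m α T f g
  tame : Tame T L f g
  le_T : A + 1 ≤ T
  F0 : F 0 = 0
  FT : F T = 0
  hF : ∀ t ∈ Icc 0 T, HasDerivAt F (2 * (ph m α t / wt m t) * f t ^ 2) t

namespace OptimalProfile
variable {b m α T A L : ℝ} {f g F : ℝ → ℝ} {t : ℝ}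

/-- The integrand has the sign of the phase, which is increasing, so `F` first decreases from `F(0)
= 0` and then increases to `F(T) = 0`. -/
theorem F_nonpos (h : OptimalProfile b m α T A L f g F) (ht : t ∈ Icc 0 T) : F t ≤ 0 := by
  rcases le_total (ph m α t) 0 with h1 | h1
  · rw [← h.F0]
    refine le_of_hasDerivAt_nonpos (a := 0) (b := t) (fun s hs => h.hF s ⟨hs.1, hs.2.trans ht.2⟩)
      (fun s hs => ?_) le_rfl ht.1 le_rfl
    have h2 := ph_mono (α := α) h.reg hs.1 hs.2 ht.2
    have h3 : ph m α s / wt m s ≤ 0 :=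
      div_nonpos_of_nonpos_of_nonneg (h2.trans h1) (h.reg.wt_pos ⟨hs.1, hs.2.trans ht.2⟩).le
    nlinarith [sq_nonneg (f s)]
  · rw [← h.FT]
    refine le_of_hasDerivAt_nonneg (a := t) (b := T) (fun s hs => h.hF s ⟨ht.1.trans hs.1, hs.2⟩)
      (fun s hs => ?_) le_rfl ht.2 le_rfl
    have h2 := ph_mono (α := α) h.reg ht.1 hs.1 hs.2
    have h3 : 0 ≤ ph m α s / wt m s :=
      div_nonneg (h1.trans h2) (h.reg.wt_pos ⟨ht.1.trans hs.1, hs.2⟩).le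
    positivity

theorem abs_beta_le (h : OptimalProfile b m α T A L f g F) (ht : t ∈ Icc 0 T) :
    |ph m α t / wt m t| ≤ 10 / 9 * (t + A + 1) := by
  have hw := h.reg.wt_pos ht
  rw [abs_div, abs_of_pos hw, div_le_iff₀ hw]
  have h1 := h.reg.abs_ph_le ht h.abs_le
  have h2 := h.reg.wt_ge ht
  have h3 := (abs_nonneg _).trans h1
  nlinarith

theorem abs_beta_le' (h : OptimalProfile b m α T A L f g F) (ht : t ∈ Icc 0 T) :
    |ph m α t / wt m t| ≤ 3 * T := by
  have := h.abs_beta_le ht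
  have := h.le_T
  have := h.reg.T_pos
  linarith [ht.2]

theorem abs_deriv_le (h : OptimalProfile b m α T A L f g F) (ht : t ∈ Icc 0 T) :
    |g t / wt m t| ≤ 5 * L * T ^ 2 * f t := by
  have hw := h.reg.wt_pos ht
  rw [abs_div, abs_of_pos hw, div_le_iff₀ hw]
  have h1 := h.tame.abs_g_le t ht
  have h2 := h.reg.wt_ge ht
  have hf := h.tame.pos t ht
  have hL := h.tame.one_le
  have h3 : (1 + t) ^ 2 ≤ 4 * T ^ 2 := by
    have := h.reg.one_le
    have : (1 + t) ^ 2 ≤ (2 * T) ^ 2 := pow_le_pow_left₀ (by linarith [ht.1]) (by linarith [ht.2]) 2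
    linarith
  have h4 : L * (1 + t) ^ 2 * f t ≤ L * (4 * T ^ 2) * f t := by gcongr
  have h5 : 0 < L * T ^ 2 * f t := by have := h.reg.T_pos; positivity
  nlinarith

theorem le_mul (h : OptimalProfile b m α T A L f g F) {s : ℝ} (hs : 0 ≤ s) (hst : s ≤ t)
    (ht : t ≤ T) : f t ≤ L * f s := by
  have h1 := h.tame.decay s t hs hst ht
  have hL := h.tame.one_le
  refine h1.trans (mul_le_mul_of_nonneg_right ?_ (h.tame.pos s ⟨hs, hst.trans ht⟩).le)
  exact mul_le_of_le_one_right (by linarith) (Real.exp_le_one_iff.2 (by linarith))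

theorem sq_le_mul (h : OptimalProfile b m α T A L f g F) {s : ℝ} (hs : 0 ≤ s) (hst : s ≤ t)
    (ht : t ≤ T) : f t ^ 2 ≤ L ^ 2 * f s ^ 2 := by
  rw [← mul_pow]
  exact pow_le_pow_left₀ (h.tame.pos t ⟨hs.trans hst, ht⟩).le (h.le_mul hs hst ht) 2

/-- Integration from `T`, where `F` vanishes, back to `t` involves only values of `f` dominated by
`f(t)`; hence the bound is relative to `f(t)²`. -/
theorem abs_F_le (h : OptimalProfile b m α T A L f g F) (ht : t ∈ Icc 0 T) :
    |F t| ≤ 6 * L ^ 2 * T ^ 2 * f t ^ 2 := by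
  have h1 := abs_sub_le_of_abs_deriv_le (F := F) (a := t) (b := T) (C := 6 * L ^ 2 * T * f t ^ 2)
    (fun s hs => h.hF s ⟨ht.1.trans hs.1, hs.2⟩)
    (fun s hs => by
      have h2 := h.abs_beta_le' ⟨ht.1.trans hs.1, hs.2⟩
      have h3 := h.sq_le_mul ht.1 hs.1 hs.2
      rw [abs_mul, abs_mul, abs_of_pos (by norm_num : (0 : ℝ) < 2), abs_of_nonneg (sq_nonneg (f s))]
      have h4 := mul_le_mul h2 h3 (sq_nonneg _) (by linarith [h.reg.T_pos])
      linarith) (s := t) (t := T) le_rfl ht.2 le_rfl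
  rw [h.FT, zero_sub, abs_neg] at h1
  refine h1.trans ?_
  have h2 : T - t ≤ T := by linarith [ht.1]
  have h3 : 0 ≤ 6 * L ^ 2 * T * f t ^ 2 := by have := h.reg.T_pos; positivity
  nlinarith

/-- The (approximate) first integral of the Euler–Lagrange equation. -/
theorem hasDerivAt_first_integral (h : OptimalProfile b m α T A L f g F) (ht : t ∈ Icc 0 T) :
    HasDerivAt (fun t => (ph m α t / wt m t) ^ 2 * f t ^ 2 - (g t / wt m t) ^ 2 - f t ^ 2 / b +
      f t ^ 4 / (2 * b) - F t)
      (2 * m / wt m t * ((ph m α t / wt m t) ^ 2 * f t ^ 2 - (g t / wt m t) ^ 2)) t := by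
  have hw := (h.reg.wt_pos ht).ne'
  have hb : b ≠ 0 := by linarith [h.one_lt]
  have hf := h.prof.hf t ht
  have h1 := ((hasDerivAt_ph m α t).div (hasDerivAt_wt m t) hw).pow 2
  have h2 := ((h.prof.hg t ht).div (hasDerivAt_wt m t) hw).pow 2
  have h3 := (((((h1.mul (hf.pow 2)).sub h2).sub ((hf.pow 2).div_const b)).add
    ((hf.pow 4).div_const (2 * b))).sub (h.hF t ht))
  convert! h3 using 1
  simp only [coef, Pi.pow_apply, Pi.div_apply]
  norm_num
  field_simp
  ring

/-- The quantity drifts only at rate `O(m)`, and its value at `T` is negligible against `f(t)²` as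
long as `t` stays away from `T`. Both errors are relative to `f(t)²`, as needed for a statement
about logarithmic derivatives. -/
theorem first_integral_bound (h : OptimalProfile b m α T A L f g F) (ht : t ∈ Icc 0 T)
    (ht' : t ≤ 3 * T / 4) :
    |(ph m α t / wt m t) ^ 2 * f t ^ 2 - (g t / wt m t) ^ 2 - f t ^ 2 / b +
      f t ^ 4 / (2 * b) - F t| ≤ (102 * L ^ 4 * (|m| * T ^ 5) + 60 * L ^ 2 / T) * f t ^ 2 := by
  have hT := h.reg.T_pos
  have hT1 := h.reg.one_le
  have hL := h.tame.one_le
  have hb := h.one_lt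
  have hsub : ∀ s ∈ Icc t T, s ∈ Icc 0 T := fun s hs => ⟨ht.1.trans hs.1, hs.2⟩
  have h1 := abs_sub_le_of_abs_deriv_le (a := t) (b := T) (C := 102 * L ^ 4 * (|m| * T ^ 4) * f t ^ 2)
    (fun s hs => h.hasDerivAt_first_integral (hsub s hs))
    (fun s hs => by
      have hs' := hsub s hs
      have h2 : (ph m α s / wt m s) ^ 2 * f s ^ 2 ≤ 9 * T ^ 2 * f s ^ 2 := by
        have : (ph m α s / wt m s) ^ 2 ≤ (3 * T) ^ 2 := by
          rw [← sq_abs]; exact pow_le_pow_left₀ (abs_nonneg _) (h.abs_beta_le' hs') 2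
        refine mul_le_mul_of_nonneg_right (this.trans_eq (by ring)) (sq_nonneg _)
      have h3 : (g s / wt m s) ^ 2 ≤ 25 * L ^ 2 * T ^ 4 * f s ^ 2 := by
        rw [← sq_abs]
        exact (pow_le_pow_left₀ (abs_nonneg _) (h.abs_deriv_le hs') 2).trans_eq (by ring)
      have h4 : |(ph m α s / wt m s) ^ 2 * f s ^ 2 - (g s / wt m s) ^ 2| ≤
          34 * L ^ 2 * T ^ 4 * f s ^ 2 := by
        have h5 : 9 * T ^ 2 * f s ^ 2 ≤ 9 * L ^ 2 * T ^ 4 * f s ^ 2 := by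
          have : T ^ 2 ≤ L ^ 2 * T ^ 4 := by
            have e1 : 1 ≤ L ^ 2 := one_le_pow₀ hL
            have e2 : T ^ 2 ≤ T ^ 4 := pow_le_pow_right₀ hT1 (by norm_num)
            nlinarith [sq_nonneg (T ^ 2)]
          nlinarith [sq_nonneg (f s)]
        have h6 : 0 ≤ (ph m α s / wt m s) ^ 2 * f s ^ 2 := by positivity
        have h7 := sq_nonneg (g s / wt m s)
        rw [_root_.abs_le]; constructor <;> linarith
      have h5 : |2 * m / wt m s| ≤ 3 * |m| := by
        have hw := h.reg.wt_pos hs'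
        rw [abs_div, abs_mul, abs_of_pos hw, abs_of_pos (by norm_num : (0 : ℝ) < 2), div_le_iff₀ hw]
        nlinarith [h.reg.wt_ge hs', abs_nonneg m]
      have h6 := h.sq_le_mul ht.1 hs.1 hs.2
      rw [abs_mul]
      calc _ ≤ 3 * |m| * (34 * L ^ 2 * T ^ 4 * f s ^ 2) :=
            mul_le_mul h5 h4 (abs_nonneg _) (by positivity)
        _ ≤ 3 * |m| * (34 * L ^ 2 * T ^ 4 * (L ^ 2 * f t ^ 2)) := by gcongr
        _ = _ := by ring) (s := t) (t := T) le_rfl ht.2 le_rfl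
  rw [h.prof.gT, h.FT] at h1
  set GT := (ph m α T / wt m T) ^ 2 * f T ^ 2 - (0 / wt m T) ^ 2 - f T ^ 2 / b +
    f T ^ 4 / (2 * b) - 0 with hGT
  have h2 : |GT| ≤ 60 * L ^ 2 / T * f t ^ 2 := by
    have hfT1 := h.tame.le_one T h.reg.right_mem
    have hfT0 := h.tame.pos T h.reg.right_mem
    have e1 : (ph m α T / wt m T) ^ 2 * f T ^ 2 ≤ 9 * T ^ 2 * f T ^ 2 := by
      have : (ph m α T / wt m T) ^ 2 ≤ (3 * T) ^ 2 := by
        rw [← sq_abs]; exact pow_le_pow_left₀ (abs_nonneg _) (h.abs_beta_le' h.reg.right_mem) 2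
      exact mul_le_mul_of_nonneg_right (this.trans_eq (by ring)) (sq_nonneg _)
    have e0 : 0 ≤ (ph m α T / wt m T) ^ 2 * f T ^ 2 := by positivity
    have e2 : f T ^ 2 / b ≤ f T ^ 2 := div_le_self (sq_nonneg _) hb.le
    have e3 : f T ^ 4 / (2 * b) ≤ f T ^ 2 / b := by
      rw [div_le_div_iff₀ (by positivity) (by positivity)]
      have : f T ^ 4 ≤ f T ^ 2 := pow_le_pow_of_le_one hfT0.le hfT1 (by norm_num)
      nlinarith [sq_nonneg (f T)]
    have e4 : 0 ≤ f T ^ 4 / (2 * b) := by positivity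
    have e5 : f T ^ 2 ≤ T ^ 2 * f T ^ 2 := le_mul_of_one_le_left (sq_nonneg _) (one_le_pow₀ hT1)
    have e6 : |GT| ≤ 10 * T ^ 2 * f T ^ 2 := by
      rw [hGT, zero_div, _root_.abs_le]
      constructor <;> nlinarith [sq_nonneg (f T)]
    -- The squared decay factor is `exp (-4 (T - t))`, at most `exp (-T)` since `t ≤ 3 T / 4`.
    have e7 : f T ^ 2 ≤ L ^ 2 * Real.exp (-T) * f t ^ 2 := by
      have := pow_le_pow_left₀ hfT0.le (h.tame.decay t T ht.1 ht.2 le_rfl) 2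
      refine this.trans ?_
      rw [mul_pow, mul_pow, ← Real.exp_nat_mul]
      gcongr
      push_cast; linarith
    have e8 : Real.exp (-T) ≤ 6 / T ^ 3 := by
      have := Real.pow_div_factorial_le_exp T hT.le 3
      rw [Real.exp_neg, inv_le_comm₀ (Real.exp_pos _) (by positivity)]
      refine le_trans (le_of_eq ?_) this
      simp [Nat.factorial]
    calc |GT| ≤ 10 * T ^ 2 * f T ^ 2 := e6
      _ ≤ 10 * T ^ 2 * (L ^ 2 * (6 / T ^ 3) * f t ^ 2) := by
          gcongr
          exact e7.trans (by gcongr)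
      _ = 60 * L ^ 2 / T * f t ^ 2 := by field_simp; ring
  set Gt := (ph m α t / wt m t) ^ 2 * f t ^ 2 - (g t / wt m t) ^ 2 - f t ^ 2 / b +
      f t ^ 4 / (2 * b) - F t with hGt
  have h3 : 102 * L ^ 4 * (|m| * T ^ 4) * f t ^ 2 * (T - t) ≤
      102 * L ^ 4 * (|m| * T ^ 5) * f t ^ 2 := by
    have : 102 * L ^ 4 * (|m| * T ^ 5) * f t ^ 2 = 102 * L ^ 4 * (|m| * T ^ 4) * f t ^ 2 * T := by ring
    rw [this]
    apply mul_le_mul_of_nonneg_left (by linarith [ht.1]) (by positivity)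
  have h4 : Gt = GT - (GT - Gt) := by ring
  rw [h4]
  refine (abs_sub _ _).trans ?_
  rw [add_mul]
  linarith

theorem hasDerivAt_ratio (h : OptimalProfile b m α T A L f g F) (ht : t ∈ Icc 0 T) :
    HasDerivAt (fun t => -F t / f t ^ 2)
      (-2 * (ph m α t / wt m t) - 2 * (-F t / f t ^ 2) * (g t / wt m t / f t)) t := by
  have hf := (h.tame.pos t ht).ne'
  have hw := (h.reg.wt_pos ht).ne'
  have h1 := (h.hF t ht).neg.div ((h.prof.hf t ht).pow 2) (by simpa using hf)
  convert! h1 using 1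
  simp only [Pi.pow_apply, Pi.neg_apply]
  norm_num
  field_simp
  ring

/-- The square of the logarithmic derivative in terms of the ratio `-F / f²`. -/
theorem le_sq_logDeriv (h : OptimalProfile b m α T A L f g F) (ht : t ∈ Icc 0 T)
    (ht' : t ≤ 3 * T / 4) {e : ℝ} (he : 102 * L ^ 4 * (|m| * T ^ 5) + 60 * L ^ 2 / T ≤ e) :
    (ph m α t / wt m t) ^ 2 + (-F t / f t ^ 2) - 1 / b - e ≤ (g t / wt m t / f t) ^ 2 := by
  have hf := h.tame.pos t ht
  have hb : 0 < b := by linarith [h.one_lt]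
  have h1 := (_root_.abs_le.1 (h.first_integral_bound ht ht')).2
  have h2 : (102 * L ^ 4 * (|m| * T ^ 5) + 60 * L ^ 2 / T) * f t ^ 2 ≤ e * f t ^ 2 :=
    mul_le_mul_of_nonneg_right he (sq_nonneg _)
  have h3 : 0 ≤ f t ^ 4 / (2 * b) := by positivity
  rw [← mul_le_mul_iff_left₀ (by positivity : 0 < f t ^ 2)]
  have e1 : ((ph m α t / wt m t) ^ 2 + (-F t / f t ^ 2) - 1 / b - e) * f t ^ 2 =
    (ph m α t / wt m t) ^ 2 * f t ^ 2 - F t - f t ^ 2 / b - e * f t ^ 2 := by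
    field_simp; ring
  have e2 : (g t / wt m t / f t) ^ 2 * f t ^ 2 = (g t / wt m t) ^ 2 := by field_simp
  rw [e1, e2]
  linarith

end OptimalProfile
end SurfaceSC

/-! ### The ratio `-F / f²` stays below one. -/

namespace SurfaceSC
namespace OptimalProfile
variable {b m α T A L : ℝ} {f g F : ℝ → ℝ} {t : ℝ}

/-- Largeness of the interval and smallness of the curvature in terms of `γ = (1 - 1/b) / 2`. -/
structure Asymptotic (m T A L γ : ℝ) : Prop where
  T_ge_A : 20 * (A + 2) ≤ T
  T_ge_L : 2 * L ≤ T
  T_ge : 2000 * (6 * L ^ 2 + 1) ≤ γ * T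
  m_le : 408 * L ^ 4 * (|m| * T ^ 5) ≤ γ

theorem beta_le (h : OptimalProfile b m α T A L f g F) {γ : ℝ} (hA : Asymptotic m T A L γ)
    (ht : t ∈ Icc 0 T) (ht' : t ≤ 3 * T / 4) : |ph m α t / wt m t| ≤ T := by
  have := h.abs_beta_le ht
  have := hA.T_ge_A
  have := h.reg.T_pos
  linarith

/-- For a ratio close to `1`, the first integral has surplus `1 - 1 / b = 2 γ`; the errors use up at
most `γ` of it. -/
theorem le_sq_logDeriv' (h : OptimalProfile b m α T A L f g F) {γ : ℝ} (hγ : γ = (1 - 1 / b) / 2)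
    (hA : Asymptotic m T A L γ) (ht : t ∈ Icc 0 T) (ht' : t ≤ 3 * T / 4)
    (hr : 1 - γ / (100 * T ^ 2) ≤ -F t / f t ^ 2) :
    (ph m α t / wt m t) ^ 2 + γ ≤ (g t / wt m t / f t) ^ 2 := by
  have hT := h.reg.T_pos
  have hT1 := h.reg.one_le
  have hL := h.tame.one_le
  have hb1 : 1 / b < 1 := by rw [div_lt_one (by linarith [h.one_lt])]; exact h.one_lt
  have hγ0 : 0 < γ := by linarith
  have h1 := h.le_sq_logDeriv ht ht' (e := γ / 2) (by
    have h2 := hA.m_le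
    have h3 : 60 * L ^ 2 / T ≤ γ / 4 := by
      rw [div_le_iff₀ hT]; nlinarith [hA.T_ge]
    linarith)
  have h2 : γ / (100 * T ^ 2) ≤ γ / 2 := by
    apply div_le_div_of_nonneg_left hγ0.le (by norm_num); nlinarith
  linarith

/-- If the ratio `r` stayed above the threshold on `[T/2, 3T/4]`, the logarithmic derivative would
be so negative that `r' = -2β - 2rp` forces growth like `exp (2 t)`, incompatible with the
polynomial bound from `abs_F_le`. The shift `γ / (4 T)` in `Z` keeps its initial value positive. -/
theorem exists_ratio_lt (h : OptimalProfile b m α T A L f g F) {γ : ℝ} (hγ : γ = (1 - 1 / b) / 2)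
    (hA : Asymptotic m T A L γ) :
    ∃ t₁, T / 2 ≤ t₁ ∧ t₁ ≤ 3 * T / 4 ∧ -F t₁ / f t₁ ^ 2 < 1 - γ / (100 * T ^ 2) := by
  by_contra! hcon
  have hT := h.reg.T_pos
  have hT1 := h.reg.one_le
  have hL := h.tame.one_le
  have hA0 : 0 ≤ A := (abs_nonneg _).trans h.abs_le
  have hb1 : 1 / b < 1 := by rw [div_lt_one (by linarith [h.one_lt])]; exact h.one_lt
  have hb0 : 0 < 1 / b := by have := h.one_lt; positivity
  have hγ0 : 0 < γ := by linarith
  have hγ1 : γ ≤ 1 / 2 := by linarith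
  set κ := γ / (100 * T ^ 2) with hκ
  have hκ0 : 0 < κ := by positivity
  have hκT : κ * T = γ / (100 * T) := by rw [hκ]; field_simp
  have hκ1 : κ ≤ 1 / 200 := by
    rw [hκ, div_le_iff₀ (by positivity)]; nlinarith
  have hsub : ∀ s ∈ Icc (T / 2) (3 * T / 4), s ∈ Icc 0 T := fun s hs =>
    ⟨by linarith [hs.1], by linarith [hs.2]⟩
  set Z : ℝ → ℝ := fun t => Real.exp (-2 * t) * (-F t / f t ^ 2 - 1 + κ + γ / (4 * T)) with hZ
  have hZ' : ∀ s ∈ Icc (T / 2) (3 * T / 4), HasDerivAt Z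
      (Real.exp (-2 * s) * (-2 * 1) * (-F s / f s ^ 2 - 1 + κ + γ / (4 * T)) +
       Real.exp (-2 * s) * (-2 * (ph m α s / wt m s) -
        2 * (-F s / f s ^ 2) * (g s / wt m s / f s))) s := fun s hs =>
    (((hasDerivAt_id s).const_mul (-2)).exp).mul
      ((((h.hasDerivAt_ratio (hsub s hs)).sub_const 1).add_const κ).add_const _)
  have hmono := le_of_hasDerivAt_nonneg hZ' (fun s hs => by
    have hs' := hsub s hs
    have hr := hcon s hs.1 hs.2
    have hsq := h.le_sq_logDeriv' hγ hA hs' hs.2 hr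
    have hβT := h.beta_le hA hs' hs.2
    have hw := h.reg.wt_pos hs'
    have hf := h.tame.pos s hs'
    have hβ2 : 2 ≤ ph m α s / wt m s := by
      rw [le_div_iff₀ hw]
      have h1 := h.reg.ph_ge (α := α) hs'
      have h2 := (_root_.abs_le.1 h.abs_le).1
      have h3 := h.reg.wt_le hs'
      have h4 := hA.T_ge_A
      linarith [hs.1]
    set β := ph m α s / wt m s with hβ
    set p := g s / wt m s / f s with hp
    set r := -F s / f s ^ 2 with hrdef
    have hβT' : β ≤ T := (le_abs_self _).trans hβT
    have hp0 : p ≤ 0 := div_nonpos_of_nonpos_of_nonneg (div_nonpos_of_nonpos_of_nonneg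
      (h.tame.g_nonpos s hs' (by linarith [hA.T_ge_L, hs.1])) hw.le) hf.le
    -- `β + γ / (3 β)` is a lower bound for `√(β² + γ)` when `β ≥ 2`.
    have hP : β + γ / (3 * β) ≤ -p := by
      refine (pow_le_pow_iff_left₀ (by positivity) (by linarith) (two_ne_zero)).1 ?_
      rw [neg_sq]
      refine le_trans ?_ hsq
      have : (β + γ / (3 * β)) ^ 2 = β ^ 2 + 2 * γ / 3 + γ ^ 2 / (9 * β ^ 2) := by
        field_simp; ring
      rw [this]
      have : γ ^ 2 / (9 * β ^ 2) ≤ γ / 3 := by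
        rw [div_le_iff₀ (by positivity)]
        nlinarith [mul_le_mul_of_nonneg_left (show (1 : ℝ) ≤ β ^ 2 by nlinarith) hγ0.le]
      linarith
    have hγβ : γ / T ≤ γ / β := div_le_div_of_nonneg_left hγ0.le (by linarith) hβT'
    have hγβ0 : 0 < γ / β := by positivity
    have e1 : γ / (3 * β) = γ / β / 3 := by field_simp
    have e2 : γ / (4 * T) = γ / T / 4 := by field_simp
    have e3 : κ * T = γ / T / 100 := by rw [hκT]; field_simp
    rw [e1] at hP
    have h1 : 2 * (r - 1 + κ) ≤ 2 * (r - 1 + κ) * (-p) := by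
      apply le_mul_of_one_le_right (by linarith); linarith
    have h2 : 2 * (1 - κ) * (β + γ / β / 3) ≤ 2 * (1 - κ) * (-p) :=
      mul_le_mul_of_nonneg_left hP (by linarith)
    have h3 : κ * β ≤ γ / T / 100 := by
      rw [← e3]; exact mul_le_mul_of_nonneg_left hβT' hκ0.le
    have h4 : κ * (γ / β) ≤ 1 / 200 * (γ / β) := mul_le_mul_of_nonneg_right hκ1 hγβ0.le
    have hexp := Real.exp_pos (-2 * s)
    have e4 : Real.exp (-2 * s) * (-2 * 1) * (r - 1 + κ + γ / (4 * T)) +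
        Real.exp (-2 * s) * (-2 * β - 2 * r * p) = Real.exp (-2 * s) *
        (2 * (r - 1 + κ) * (-p) + 2 * (1 - κ) * (-p) - 2 * (r - 1 + κ) - γ / T / 2 - 2 * β) := by
      rw [e2]; ring
    rw [e4]
    refine mul_nonneg hexp.le ?_
    have e5 : 2 * (1 - κ) * (β + γ / β / 3) =
        2 * β + 2 * (γ / β) / 3 - 2 * (κ * β) - 2 * (κ * (γ / β)) / 3 := by ring
    rw [e5] at h2
    linarith) (s := T / 2) (t := 3 * T / 4) le_rfl (by linarith) le_rfl
  have hl := hcon (T / 2) le_rfl (by linarith)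
  have hu : -F (3 * T / 4) / f (3 * T / 4) ^ 2 ≤ 6 * L ^ 2 * T ^ 2 := by
    have hm := hsub (3 * T / 4) ⟨by linarith, le_rfl⟩
    have hf := h.tame.pos _ hm
    rw [div_le_iff₀ (by positivity)]
    exact (neg_le_abs _).trans (h.abs_F_le hm)
  have h1 : γ / (4 * T) ≤ 1 / 2 := by
    rw [div_le_iff₀ (by positivity)]; nlinarith
  have h2 : Real.exp (-2 * (T / 2)) * (γ / (4 * T)) ≤
      Real.exp (-2 * (3 * T / 4)) * (6 * L ^ 2 * T ^ 2) := by
    calc _ ≤ Z (T / 2) := by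
          simp only [hZ]
          exact mul_le_mul_of_nonneg_left (by linarith) (Real.exp_pos _).le
      _ ≤ Z (3 * T / 4) := hmono
      _ ≤ _ := by
          simp only [hZ]
          exact mul_le_mul_of_nonneg_left (by linarith) (Real.exp_pos _).le
  have h3 : Real.exp (-2 * (T / 2)) = Real.exp (-2 * (3 * T / 4)) * Real.exp (T / 2) := by
    rw [← Real.exp_add]; ring_nf
  rw [h3, mul_assoc] at h2
  have h4 := le_of_mul_le_mul_left h2 (Real.exp_pos _)
  have h5 : T ^ 4 / 384 ≤ Real.exp (T / 2) := by
    have := Real.pow_div_factorial_le_exp (T / 2) (by positivity) 4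
    refine le_trans (le_of_eq ?_) this
    norm_num [Nat.factorial]; ring
  have h6 : T ^ 4 / 384 * (γ / (4 * T)) ≤ 6 * L ^ 2 * T ^ 2 :=
    (mul_le_mul_of_nonneg_right h5 (by positivity)).trans h4
  have h7 : T ^ 4 / 384 * (γ / (4 * T)) = T ^ 2 * (γ * T) / 1536 := by field_simp; ring
  have h8 := mul_le_mul_of_nonneg_left hA.T_ge (sq_nonneg T)
  nlinarith [sq_nonneg T, mul_nonneg (sq_nonneg L) (sq_nonneg T), pow_pos hT 2]

/-- A maximum principle on `[0, t₁]`: the ratio is `0` at the left end and small enough at `t₁`. At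
an interior maximum `r p = -β`, and `r > 1 - κ` with `p² ≥ β² + γ` would give `β² ≥ (1 - κ)² (β² +
γ)`. Since `|β| ≤ T`, a margin `κ` of order `γ / T²` makes this impossible. -/
theorem ratio_le (h : OptimalProfile b m α T A L f g F) {γ : ℝ} (hγ : γ = (1 - 1 / b) / 2)
    (hA : Asymptotic m T A L γ) :
    ∃ t₁, T / 2 ≤ t₁ ∧ t₁ ≤ T ∧ ∀ t ∈ Icc 0 t₁, -F t / f t ^ 2 ≤ 1 - γ / (100 * T ^ 2) := by
  obtain ⟨t₁, h1, h2, h3⟩ := h.exists_ratio_lt hγ hA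
  have hT := h.reg.T_pos
  have hT1 := h.reg.one_le
  have hb1 : 1 / b < 1 := by rw [div_lt_one (by linarith [h.one_lt])]; exact h.one_lt
  have hb0 : 0 < 1 / b := by have := h.one_lt; positivity
  have hγ0 : 0 < γ := by linarith
  have hγ1 : γ ≤ 1 / 2 := by linarith
  set κ := γ / (100 * T ^ 2) with hκ
  have hκ0 : 0 < κ := by positivity
  have hκT : κ * T ^ 2 = γ / 100 := by rw [hκ]; field_simp
  have hκ1 : κ ≤ 1 / 200 := by
    rw [hκ, div_le_iff₀ (by positivity)]; nlinarith
  have hsub : ∀ s ∈ Icc 0 t₁, s ∈ Icc 0 T := fun s hs => ⟨hs.1, by linarith [hs.2]⟩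
  refine ⟨t₁, h1, by linarith, ?_⟩
  have hcont : ContinuousOn (fun t => -F t / f t ^ 2) (Icc 0 t₁) := fun s hs =>
    (h.hasDerivAt_ratio (hsub s hs)).continuousAt.continuousWithinAt
  obtain ⟨s, hs, hmax⟩ := isCompact_Icc.exists_isMaxOn ⟨0, le_rfl, by linarith⟩ hcont
  have hmax' : ∀ t ∈ Icc 0 t₁, -F t / f t ^ 2 ≤ -F s / f s ^ 2 := fun t ht => hmax ht
  intro t ht
  refine (hmax' t ht).trans ?_
  by_contra! hlt
  have hs' := hsub s hs
  have hs0 : 0 < s := by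
    rcases eq_or_lt_of_le hs.1 with h0 | h0
    · rw [← h0, h.F0] at hlt
      simp at hlt; linarith
    · exact h0
  have hst : s < t₁ := by
    rcases eq_or_lt_of_le hs.2 with h0 | h0
    · rw [h0] at hlt; linarith
    · exact h0
  have hloc : IsLocalMax (fun t => -F t / f t ^ 2) s := by
    filter_upwards [Icc_mem_nhds hs0 hst] with t ht using hmax' t ht
  have hd := hloc.hasDerivAt_eq_zero (h.hasDerivAt_ratio hs')
  have hsq := h.le_sq_logDeriv' hγ hA hs' (by linarith) hlt.le
  have hβT := h.beta_le hA hs' (by linarith)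
  set β := ph m α s / wt m s with hβ
  set p := g s / wt m s / f s with hp
  set r := -F s / f s ^ 2 with hrdef
  have hβ2 : β ^ 2 ≤ T ^ 2 := by rw [← sq_abs]; exact pow_le_pow_left₀ (abs_nonneg _) hβT 2
  have e1 : r * p = -β := by linarith
  have e2 : r ^ 2 * p ^ 2 = β ^ 2 := by rw [← mul_pow, e1, neg_sq]
  have e3 : (1 - κ) ^ 2 ≤ r ^ 2 := pow_le_pow_left₀ (by linarith) hlt.le 2
  have e4 : (1 - κ) ^ 2 * (β ^ 2 + γ) ≤ β ^ 2 := by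
    exact (mul_le_mul e3 hsq (by positivity) (sq_nonneg _)).trans e2.le
  have e5 : κ * β ^ 2 ≤ γ / 100 := by rw [← hκT]; gcongr
  have e6 : κ * γ ≤ 1 / 200 * γ := by gcongr
  nlinarith [mul_nonneg (sq_nonneg κ) (sq_nonneg β), mul_nonneg (sq_nonneg κ) hγ0.le]

end OptimalProfile
end SurfaceSC

/-! ### Energy splitting and its coercivity. -/

namespace SurfaceSC

theorem intervalIntegrable_of_continuousOn_Icc {q : ℝ → ℝ} {T : ℝ} (hT : 0 ≤ T)
    (hq : ContinuousOn q (Icc 0 T)) : IntervalIntegrable q volume 0 T := by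
  rw [← uIcc_of_le hT] at hq; exact hq.intervalIntegrable

namespace OptimalProfile
variable {b m α T A L m' α' : ℝ} {f g F u v : ℝ → ℝ} {t : ℝ}

/-- The positive density in the energy splitting of `u = f · (u / f)`. -/
noncomputable def splitDens (b m δ m' : ℝ) (f g F u v : ℝ → ℝ) (t : ℝ) : ℝ :=
  wt m t * (u t ^ 2 * (g t / wt m t / f t - v t / wt m' t / u t) ^ 2) +
    2 * δ * (F t / f t ^ 2) * (g t / wt m t / f t - v t / wt m' t / u t) * u t ^ 2 +
    δ ^ 2 * (u t ^ 2 / wt m t) + wt m t / (2 * b) * (f t ^ 2 - u t ^ 2) ^ 2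

theorem continuousOn_logDeriv (hR : Regime m T) (hP : Profile b m α T f g) (hT : Tame T L f g) :
    ContinuousOn (fun t => g t / wt m t / f t) (Icc 0 T) :=
  (hP.continuousOn_deriv hR).div hP.continuousOn_f fun t ht => (hT.pos t ht).ne'

/-- The two sides differ by the integral of an exact derivative. Its boundary terms vanish because
`g` and `F` vanish at both ends; for `F` at `T` this is the phase equation. -/
theorem energy_splitting (h : OptimalProfile b m α T A L f g F) (hR' : Regime m' T)
    (hP' : Profile b m' α' T u v) (hT' : Tame T L u v) :
    enr b m α' T u (fun t => v t / wt m' t) - enr b m α T f (fun t => g t / wt m t) =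
      ∫ t in (0 : ℝ)..T, splitDens b m (α' - α) m' f g F u v t := by
  have hT := h.reg.T_pos.le
  have hb : b ≠ 0 := by linarith [h.one_lt]
  have cf := h.prof.continuousOn_f
  have cu := hP'.continuousOn_f
  have cF : ContinuousOn F (Icc 0 T) := fun t ht => (h.hF t ht).continuousAt.continuousWithinAt
  have cw : ContinuousOn (fun t => wt m t) (Icc 0 T) := (continuous_wt m).continuousOn
  have cp := continuousOn_logDeriv h.reg h.prof h.tame
  have cq := continuousOn_logDeriv hR' hP' hT'
  have cR : ContinuousOn (fun t => F t / f t ^ 2) (Icc 0 T) :=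
    cF.div (cf.pow 2) fun t ht => (pow_pos (h.tame.pos t ht) 2).ne'
  have cuw : ContinuousOn (fun t => u t ^ 2 / wt m t) (Icc 0 T) :=
    (cu.pow 2).div cw fun t ht => (h.reg.wt_pos ht).ne'
  have cS : ContinuousOn (splitDens b m (α' - α) m' f g F u v) (Icc 0 T) := by
    unfold splitDens
    fun_prop
  have i1 := intervalIntegrable_of_continuousOn_Icc hT
    (continuousOn_dens (b := b) (α := α') h.reg cu (hP'.continuousOn_deriv hR'))
  have i2 := intervalIntegrable_of_continuousOn_Icc hT
    (continuousOn_dens (b := b) (α := α) h.reg cf (h.prof.continuousOn_deriv h.reg))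
  have iS := intervalIntegrable_of_continuousOn_Icc hT cS
  have hder : ∀ t ∈ Icc 0 T, HasDerivAt
      (fun t => g t / f t * u t ^ 2 + (α' - α) * (F t / f t ^ 2 * u t ^ 2) - g t * f t)
      (dens b m α' t (u t) (v t / wt m' t) - dens b m α t (f t) (g t / wt m t) -
        splitDens b m (α' - α) m' f g F u v t) t := by
    intro t ht
    have hf := h.prof.hf t ht
    have hg := h.prof.hg t ht
    have hu := hP'.hf t ht
    have hf0 := (h.tame.pos t ht).ne'
    have hu0 := (hT'.pos t ht).ne'
    have hw := (h.reg.wt_pos ht).ne'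
    have hw' := (hR'.wt_pos ht).ne'
    have hph : ph m α' t = ph m α t + (α' - α) := by unfold ph; ring
    have h1 := (((hg.div hf hf0).mul (hu.pow 2)).add
      ((((h.hF t ht).div (hf.pow 2) (by simpa using hf0)).mul (hu.pow 2)).const_mul (α' - α))).sub
      (hg.mul hf)
    convert! h1 using 1
    simp only [dens, splitDens, coef, hph, Pi.pow_apply, Pi.div_apply]
    norm_num
    field_simp
    ring
  have hint := intervalIntegral.integral_eq_sub_of_hasDerivAt
    (fun t ht => hder t (by rwa [uIcc_of_le hT] at ht)) ((i1.sub i2).sub iS)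
  rw [h.prof.g0, h.prof.gT, h.F0, h.FT, intervalIntegral.integral_sub (i1.sub i2) iS,
    intervalIntegral.integral_sub i1 i2] at hint
  unfold enr
  simp only [zero_div, zero_mul, mul_zero, add_zero, sub_zero] at hint
  linarith

/-- On `[0, t₁]` the cross term is at most `1 - κ` times the two squares, so a fraction `κ` of them
remains. Beyond `t₁ ≥ T / 2` the ratio is only polynomially bounded, but `u²` is at most of order
`exp (-2 T)`, and the loss is an exponentially small multiple of `δ²`. -/
theorem splitDens_ge {κ C δ : ℝ} (h : OptimalProfile b m α T A L f g F)
    (hT' : Tame T L u v) (hκ0 : 0 ≤ κ) (hκ1 : κ ≤ 1 / 2) (hC : 1 ≤ C)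
    {t₁ : ℝ} (ht₁ : T / 2 ≤ t₁) (hin : ∀ t ∈ Icc 0 t₁, |F t / f t ^ 2| ≤ 1 - κ)
    (hall : ∀ t ∈ Icc 0 T, |F t / f t ^ 2| ≤ C) (ht : t ∈ Icc 0 T) :
    κ * (wt m t * (u t ^ 2 * (g t / wt m t / f t - v t / wt m' t / u t) ^ 2)) +
      wt m t / (2 * b) * (f t ^ 2 - u t ^ 2) ^ 2 +
      δ ^ 2 * (κ * (u t ^ 2 / wt m t) - 3 * C ^ 2 * L ^ 2 * Real.exp (-2 * T)) ≤
      splitDens b m δ m' f g F u v t := by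
  have hw := h.reg.wt_pos ht
  have hL := hT'.one_le
  unfold splitDens
  set D := g t / wt m t / f t - v t / wt m' t / u t with hD
  set R := F t / f t ^ 2 with hRdef
  set U := u t ^ 2 with hU
  set w := wt m t with hwdef
  have hU0 : 0 ≤ U := sq_nonneg _
  have hsq : ∀ ρ : ℝ, 0 ≤ ρ → |R| ≤ ρ → -(ρ * (w * (U * D ^ 2) + δ ^ 2 * (U / w))) ≤
      2 * δ * R * D * U := by
    intro ρ hρ0 hρ
    have h1 : 0 ≤ U / w * (w * D + δ) ^ 2 := by positivity
    have h2 : 0 ≤ U / w * (w * D - δ) ^ 2 := by positivity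
    have e1 : U / w * (w * D + δ) ^ 2 = w * (U * D ^ 2) + δ ^ 2 * (U / w) + 2 * δ * D * U := by
      field_simp; ring
    have e2 : U / w * (w * D - δ) ^ 2 = w * (U * D ^ 2) + δ ^ 2 * (U / w) - 2 * δ * D * U := by
      field_simp; ring
    have h3 : |2 * δ * D * U| ≤ w * (U * D ^ 2) + δ ^ 2 * (U / w) := by
      rw [_root_.abs_le]; constructor <;> linarith
    have h4 : |R * (2 * δ * D * U)| ≤ ρ * (w * (U * D ^ 2) + δ ^ 2 * (U / w)) := by
      rw [abs_mul]; exact mul_le_mul hρ h3 (abs_nonneg _) hρ0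
    have h5 := (_root_.abs_le.1 h4).1
    linarith
  have hA0 : 0 ≤ w * (U * D ^ 2) := by positivity
  have hB0 : 0 ≤ δ ^ 2 * (U / w) := by positivity
  rcases le_total t t₁ with h1 | h1
  · have h2 := hsq (1 - κ) (by linarith) (hin t ⟨ht.1, h1⟩)
    have h3 : 0 ≤ δ ^ 2 * (3 * C ^ 2 * L ^ 2 * Real.exp (-2 * T)) := by positivity
    linarith
  · have hu2 : U ≤ L ^ 2 * Real.exp (-2 * T) := by
      have h2 := hT'.decay 0 t le_rfl ht.1 ht.2
      have h3 : u t ≤ L * Real.exp (-T) := by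
        refine h2.trans ?_
        have h4 : Real.exp (-2 * (t - 0)) ≤ Real.exp (-T) := Real.exp_le_exp.2 (by linarith)
        have h5 := hT'.le_one 0 h.reg.zero_mem
        have h6 := hT'.pos 0 h.reg.zero_mem
        calc L * Real.exp (-2 * (t - 0)) * u 0 ≤ L * Real.exp (-T) * 1 := by gcongr
          _ = _ := mul_one _
      have e : Real.exp (-2 * T) = Real.exp (-T) ^ 2 := by
        rw [← Real.exp_nat_mul]; push_cast; ring_nf
      rw [e, ← mul_pow]
      exact pow_le_pow_left₀ (hT'.pos t ht).le h3 2
    have hUw : U / w ≤ 10 / 9 * (L ^ 2 * Real.exp (-2 * T)) := by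
      rw [div_le_iff₀ hw]
      have := h.reg.wt_ge ht
      have h7 : 0 ≤ L ^ 2 * Real.exp (-2 * T) := by positivity
      nlinarith
    have hkey : -(1 / 2 * (w * (U * D ^ 2)) + 2 * C ^ 2 * (δ ^ 2 * (U / w))) ≤
        2 * δ * R * D * U := by
      have e1 : 0 ≤ U / (2 * w) * (w * D + 2 * δ * R) ^ 2 := by positivity
      have e2 : U / (2 * w) * (w * D + 2 * δ * R) ^ 2 =
          1 / 2 * (w * (U * D ^ 2)) + 2 * δ * R * D * U + 2 * R ^ 2 * (δ ^ 2 * (U / w)) := by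
        field_simp; ring
      have e3 : R ^ 2 ≤ C ^ 2 := by
        rw [← sq_abs R]; exact pow_le_pow_left₀ (abs_nonneg _) (hall t ht) 2
      have e4 := mul_le_mul_of_nonneg_right e3 hB0
      linarith
    have h2 : κ * (w * (U * D ^ 2)) ≤ 1 / 2 * (w * (U * D ^ 2)) := by gcongr
    have h3 : (κ + 2 * C ^ 2) * (U / w) ≤ 3 * C ^ 2 * L ^ 2 * Real.exp (-2 * T) := by
      have hC2 : 1 ≤ C ^ 2 := one_le_pow₀ hC
      have h4 : (κ + 2 * C ^ 2) * (U / w) ≤ (κ + 2 * C ^ 2) *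
        (10 / 9 * (L ^ 2 * Real.exp (-2 * T))) := by gcongr
      have h5 : 0 ≤ L ^ 2 * Real.exp (-2 * T) := by positivity
      nlinarith
    have h4 := mul_le_mul_of_nonneg_left h3 (sq_nonneg δ)
    linarith

end OptimalProfile
end SurfaceSC

namespace SurfaceSC
theorem abs_four_mul_le (y z : ℝ) : |4 * y * z| ≤ 2 * y ^ 2 + 2 * z ^ 2 := by
  rw [abs_le]; constructor <;> nlinarith [sq_nonneg (y + z), sq_nonneg (y - z)]

namespace OptimalProfile
variable {b m α T A L m' α' : ℝ} {f g F u v : ℝ → ℝ} {t : ℝ}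

/-- Coercivity of the energy splitting. -/
theorem coercivity (h : OptimalProfile b m α T A L f g F) {γ : ℝ} (hγ : γ = (1 - 1 / b) / 2)
    (hA : Asymptotic m T A L γ) (hA' : 10 ^ 7 * L ^ 8 ≤ γ * T) (hR' : Regime m' T)
    (hP' : Profile b m' α' T u v) (hT' : Tame T L u v) {X : ℝ}
    (hX : enr b m α' T u (fun t => v t / wt m' t) - enr b m α T f (fun t => g t / wt m t) ≤ X) :
    γ * (α' - α) ^ 2 ≤ 400 * L ^ 2 * T ^ 2 * X ∧
    γ * (∫ t in (0 : ℝ)..T, u t ^ 2 * (g t / wt m t / f t - v t / wt m' t / u t) ^ 2) ≤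
      200 * T ^ 2 * X ∧
    (∫ t in (0 : ℝ)..T, (f t ^ 2 - u t ^ 2) ^ 2) ≤ 3 * b * X := by
  have hT := h.reg.T_pos
  have hT1 := h.reg.one_le
  have hL := h.tame.one_le
  have hb := h.one_lt
  have hb1 : 1 / b < 1 := by rw [div_lt_one (by linarith [h.one_lt])]; exact h.one_lt
  have hb0 : 0 < 1 / b := by have := h.one_lt; positivity
  have hγ0 : 0 < γ := by linarith
  have hγ1 : γ ≤ 1 / 2 := by linarith
  obtain ⟨t₁, ht₁, ht₁T, hr⟩ := h.ratio_le hγ hA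
  set κ := γ / (100 * T ^ 2) with hκ
  have hκ0 : 0 < κ := by positivity
  have hκ1 : κ ≤ 1 / 2 := by
    rw [hκ, div_le_iff₀ (by positivity)]; nlinarith
  set C := 6 * L ^ 2 * T ^ 2 with hC
  have hC1 : 1 ≤ C := by
    have : 1 ≤ L ^ 2 * T ^ 2 := one_le_mul_of_one_le_of_one_le (one_le_pow₀ hL) (one_le_pow₀ hT1)
    linarith
  have hin : ∀ t ∈ Icc 0 t₁, |F t / f t ^ 2| ≤ 1 - κ := by
    intro t ht
    have ht' : t ∈ Icc 0 T := ⟨ht.1, ht.2.trans ht₁T⟩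
    rw [abs_of_nonpos (div_nonpos_of_nonpos_of_nonneg (h.F_nonpos ht') (sq_nonneg _)), ← neg_div]
    exact hr t ht
  have hall : ∀ t ∈ Icc 0 T, |F t / f t ^ 2| ≤ C := by
    intro t ht
    have := h.tame.pos t ht
    rw [abs_div, abs_of_nonneg (sq_nonneg (f t)), div_le_iff₀ (by positivity)]
    exact h.abs_F_le ht
  set δ := α' - α with hδ
  set ω := 3 * C ^ 2 * L ^ 2 * Real.exp (-2 * T) with hω
  have cf := h.prof.continuousOn_f
  have cu := hP'.continuousOn_f
  have cw : ContinuousOn (fun t => wt m t) (Icc 0 T) := (continuous_wt m).continuousOn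
  have cp := continuousOn_logDeriv h.reg h.prof h.tame
  have cq := continuousOn_logDeriv hR' hP' hT'
  have cF : ContinuousOn F (Icc 0 T) := fun t ht => (h.hF t ht).continuousAt.continuousWithinAt
  have cR : ContinuousOn (fun t => F t / f t ^ 2) (Icc 0 T) :=
    cF.div (cf.pow 2) fun t ht => (pow_pos (h.tame.pos t ht) 2).ne'
  have cuw : ContinuousOn (fun t => u t ^ 2 / wt m t) (Icc 0 T) :=
    (cu.pow 2).div cw fun t ht => (h.reg.wt_pos ht).ne'
  have cS : ContinuousOn (splitDens b m δ m' f g F u v) (Icc 0 T) := by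
    unfold splitDens; fun_prop
  have cD : ContinuousOn (fun t => u t ^ 2 * (g t / wt m t / f t - v t / wt m' t / u t) ^ 2)
    (Icc 0 T) := by fun_prop
  have cY : ContinuousOn (fun t => (f t ^ 2 - u t ^ 2) ^ 2) (Icc 0 T) := by fun_prop
  have iD := intervalIntegrable_of_continuousOn_Icc hT.le cD
  have iY := intervalIntegrable_of_continuousOn_Icc hT.le cY
  have iu := intervalIntegrable_of_continuousOn_Icc hT.le cuw
  have hsplit := h.energy_splitting hR' hP' hT'
  rw [hsplit] at hX
  set ID := ∫ t in (0 : ℝ)..T, u t ^ 2 * (g t / wt m t / f t - v t / wt m' t / u t) ^ 2 with hID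
  set IY := ∫ t in (0 : ℝ)..T, (f t ^ 2 - u t ^ 2) ^ 2 with hIY
  set IU := ∫ t in (0 : ℝ)..T, u t ^ 2 / wt m t with hIU
  have hID0 : 0 ≤ ID := intervalIntegral.integral_nonneg hT.le fun t _ => by positivity
  have hIY0 : 0 ≤ IY := intervalIntegral.integral_nonneg hT.le fun t _ => by positivity
  have hlow : ∫ t in (0 : ℝ)..T, (κ * (9 / 10) * (u t ^ 2 *
      (g t / wt m t / f t - v t / wt m' t / u t) ^ 2) +
      9 / (20 * b) * (f t ^ 2 - u t ^ 2) ^ 2 + (δ ^ 2 * κ * (u t ^ 2 / wt m t) - δ ^ 2 * ω)) ≤ X := by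
    refine le_trans ?_ hX
    apply intervalIntegral.integral_mono_on hT.le
    · exact ((iD.const_mul _).add (iY.const_mul _)).add ((iu.const_mul _).sub (by simp))
    · exact intervalIntegrable_of_continuousOn_Icc hT.le cS
    · intro t ht
      refine le_trans ?_ (h.splitDens_ge hT' hκ0.le hκ1 hC1 ht₁ hin hall ht)
      have hw := h.reg.wt_ge ht
      have h1 : κ * (9 / 10) * (u t ^ 2 * (g t / wt m t / f t - v t / wt m' t / u t) ^ 2) ≤
          κ * (wt m t * (u t ^ 2 * (g t / wt m t / f t - v t / wt m' t / u t) ^ 2)) := by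
        rw [mul_assoc]; gcongr
      have h2 : 9 / (20 * b) * (f t ^ 2 - u t ^ 2) ^ 2 ≤
          wt m t / (2 * b) * (f t ^ 2 - u t ^ 2) ^ 2 := by
        have : 9 / (20 * b) = (9 / 10) / (2 * b) := by field_simp; norm_num
        rw [this]; gcongr
      linarith
  rw [intervalIntegral.integral_add ((iD.const_mul _).add (iY.const_mul _))
      ((iu.const_mul _).sub (by simp)),
    intervalIntegral.integral_add (iD.const_mul _) (iY.const_mul _),
    intervalIntegral.integral_sub (iu.const_mul _) (by simp),
    intervalIntegral.integral_const_mul, intervalIntegral.integral_const_mul,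
    intervalIntegral.integral_const_mul, intervalIntegral.integral_const] at hlow
  simp only [sub_zero, smul_eq_mul] at hlow
  -- The lower bound of `u` on `[0, 1]` makes the coefficient of `δ²` nondegenerate.
  have hIUlow : 1 / (2 * L ^ 2) ≤ IU := by
    have h1 : ∫ t in (0 : ℝ)..1, 1 / (2 * L ^ 2) ≤ ∫ t in (0 : ℝ)..1, u t ^ 2 / wt m t := by
      apply intervalIntegral.integral_mono_on zero_le_one (by simp)
      · exact intervalIntegrable_of_continuousOn_Icc zero_le_one
          (cuw.mono (Icc_subset_Icc_right hT1))
      · intro t ht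
        have ht' : t ∈ Icc 0 T := ⟨ht.1, ht.2.trans hT1⟩
        have h2 := hT'.lower t ht
        have hw := h.reg.wt_le ht'
        have hw0 := h.reg.wt_pos ht'
        rw [le_div_iff₀ hw0]
        have h3 : (1 / L) ^ 2 ≤ u t ^ 2 := pow_le_pow_left₀ (by positivity) h2 2
        have h4 : 1 / (2 * L ^ 2) = (1 / L) ^ 2 / 2 := by field_simp
        rw [h4]
        have h5 : 0 ≤ (1 / L) ^ 2 := by positivity
        nlinarith
    have h2 : ∫ t in (0 : ℝ)..1, u t ^ 2 / wt m t ≤ IU := by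
      rw [hIU]
      apply intervalIntegral.integral_mono_interval le_rfl zero_le_one hT1 _ iu
      rw [Filter.EventuallyLE, ae_restrict_iff' measurableSet_Ioc]
      refine Filter.Eventually.of_forall fun t ht => ?_
      have := h.reg.wt_pos (Ioc_subset_Icc_self ht)
      simp only [Pi.zero_apply]
      positivity
    simp at h1
    simp only [one_div, mul_inv] at h1 h2 ⊢
    linarith
  -- The exponentially small loss takes at most half of the `δ²` term; `158` exceeds `8! / 2⁸`, and
  -- `T⁸` outweighs the factors of `T` in `C²` and `κ⁻¹`.
  have hωT : T * ω ≤ κ / (4 * L ^ 2) := by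
    have h1 : Real.exp (-2 * T) ≤ 158 / T ^ 8 := by
      have := Real.pow_div_factorial_le_exp (2 * T) (by positivity) 8
      have e : Real.exp (-2 * T) = (Real.exp (2 * T))⁻¹ := by rw [← Real.exp_neg]; ring_nf
      rw [e, inv_le_comm₀ (Real.exp_pos _) (by positivity)]
      refine le_trans ?_ this
      norm_num [Nat.factorial]
      rw [mul_pow]
      have : 0 < T ^ 8 := by positivity
      linarith
    rw [le_div_iff₀ (by positivity), hκ, le_div_iff₀ (by positivity)]
    calc T * ω * (4 * L ^ 2) * (100 * T ^ 2)
        ≤ T * (3 * C ^ 2 * L ^ 2 * (158 / T ^ 8)) * (4 * L ^ 2) * (100 * T ^ 2) := by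
          rw [hω]; gcongr
      _ = 6825600 * L ^ 8 / T := by rw [hC]; field_simp; ring
      _ ≤ γ := by
          rw [div_le_iff₀ hT]
          have : 0 < L ^ 8 := by positivity
          linarith
  have h0 : 0 ≤ δ ^ 2 * κ * (IU - 1 / (2 * L ^ 2)) := mul_nonneg (by positivity) (by linarith)
  have h1 : δ ^ 2 * (T * ω) ≤ δ ^ 2 * (κ / (4 * L ^ 2)) := by gcongr
  have e1 : κ / (4 * L ^ 2) = κ * (1 / (2 * L ^ 2)) / 2 := by field_simp; norm_num
  have e2 : δ ^ 2 * κ * (1 / (2 * L ^ 2)) = 2 * (δ ^ 2 * (κ / (4 * L ^ 2))) := by rw [e1]; ring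
  have h2 : 0 ≤ δ ^ 2 * (κ / (4 * L ^ 2)) := by positivity
  have h3 : 0 ≤ κ * (9 / 10) * ID := by positivity
  have h4 : 0 ≤ 9 / (20 * b) * IY := by positivity
  have k1 : δ ^ 2 * (κ / (4 * L ^ 2)) ≤ X := by linarith
  have k2 : κ * (9 / 10) * ID ≤ X := by linarith
  have k3 : 9 / (20 * b) * IY ≤ X := by linarith
  refine ⟨?_, ?_, ?_⟩
  · have e : δ ^ 2 * (κ / (4 * L ^ 2)) = γ * δ ^ 2 / (400 * L ^ 2 * T ^ 2) := by
      rw [hκ]; field_simp; ring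
    rw [e, div_le_iff₀ (by positivity)] at k1
    linarith
  · have e : κ * (9 / 10) * ID = γ * ID * 9 / (1000 * T ^ 2) := by
      rw [hκ]; field_simp; ring
    rw [e, div_le_iff₀ (by positivity)] at k2
    have : 0 ≤ γ * ID := by positivity
    linarith
  · have e : 9 / (20 * b) * IY = 9 * IY / (20 * b) := by ring
    rw [e, div_le_iff₀ (by positivity)] at k3
    linarith

set_option maxHeartbeats 600000 in
/-- Uniform closeness of the densities. -/
theorem sup_sq_sub_sq_le (h : OptimalProfile b m α T A L f g F) {γ : ℝ} (hγ : γ = (1 - 1 / b) / 2)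
    (hA : Asymptotic m T A L γ) (hA' : 10 ^ 7 * L ^ 8 ≤ γ * T) (hR' : Regime m' T)
    (hP' : Profile b m' α' T u v) (hT' : Tame T L u v) {X : ℝ}
    (hX : enr b m α' T u (fun t => v t / wt m' t) - enr b m α T f (fun t => g t / wt m t) ≤ X)
    (ht : t ∈ Icc 0 T) :
    γ * ((f t ^ 2 - u t ^ 2) ^ 2) ≤ (69 * L * b + 400) * T ^ 2 * X := by
  obtain ⟨-, hD, hY⟩ := h.coercivity hγ hA hA' hR' hP' hT' hX
  have hT := h.reg.T_pos
  have hT1 := h.reg.one_le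
  have hL := h.tame.one_le
  have hb := h.one_lt
  have hb1 : 1 / b < 1 := by rw [div_lt_one (by linarith [h.one_lt])]; exact h.one_lt
  have hb0 : 0 < 1 / b := by have := h.one_lt; positivity
  have hγ0 : 0 < γ := by linarith
  have hγ1 : γ ≤ 1 / 2 := by linarith
  have cf := h.prof.continuousOn_f
  have cu := hP'.continuousOn_f
  have cp := continuousOn_logDeriv h.reg h.prof h.tame
  have cq := continuousOn_logDeriv hR' hP' hT'
  have cD : ContinuousOn (fun t => u t ^ 2 * (g t / wt m t / f t - v t / wt m' t / u t) ^ 2)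
    (Icc 0 T) := by fun_prop
  have cY : ContinuousOn (fun t => (f t ^ 2 - u t ^ 2) ^ 2) (Icc 0 T) := by fun_prop
  have iD := intervalIntegrable_of_continuousOn_Icc hT.le cD
  have iY := intervalIntegrable_of_continuousOn_Icc hT.le cY
  obtain ⟨Q, hQ0, hQT, hQ⟩ := exists_primitive (q := fun t => 22 * L * T ^ 2 *
      (f t ^ 2 - u t ^ 2) ^ 2 +
      2 * (u t ^ 2 * (g t / wt m t / f t - v t / wt m' t / u t) ^ 2)) hT.le
    (((continuousOn_const (c := 22 * L * T ^ 2)).mul cY).add ((continuousOn_const (c := 2)).mul cD))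
  rw [intervalIntegral.integral_add (iY.const_mul _) (iD.const_mul _),
    intervalIntegral.integral_const_mul, intervalIntegral.integral_const_mul] at hQT
  set ID := ∫ t in (0 : ℝ)..T, u t ^ 2 * (g t / wt m t / f t - v t / wt m' t / u t) ^ 2 with hID
  set IY := ∫ t in (0 : ℝ)..T, (f t ^ 2 - u t ^ 2) ^ 2 with hIY
  set Y2 : ℝ → ℝ := fun t => (f t ^ 2 - u t ^ 2) ^ 2 with hY2
  -- With `p = f' / f` and `q = u' / u`, `(f² - u²)' = 2 p (f² - u²) + 2 (p - q) u²`, so only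
  -- quantities controlled by `coercivity` appear.
  have hYd : ∀ s ∈ Icc 0 T, HasDerivAt Y2
      (4 * (g s / wt m s / f s) * Y2 s + 4 * (f s ^ 2 - u s ^ 2) * u s ^ 2 *
        (g s / wt m s / f s - v s / wt m' s / u s)) s := by
    intro s hs
    have h1 := (((h.prof.hf s hs).pow 2).sub ((hP'.hf s hs).pow 2)).pow 2
    have hf0 := (h.tame.pos s hs).ne'
    have hu0 := (hT'.pos s hs).ne'
    convert! h1 using 1
    simp only [hY2, Pi.pow_apply, Pi.sub_apply]
    norm_num
    field_simp
    ring
  have hYb : ∀ s ∈ Icc 0 T, |4 * (g s / wt m s / f s) * Y2 s + 4 * (f s ^ 2 - u s ^ 2) * u s ^ 2 *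
        (g s / wt m s / f s - v s / wt m' s / u s)| ≤ 22 * L * T ^ 2 * Y2 s +
        2 * (u s ^ 2 * (g s / wt m s / f s - v s / wt m' s / u s) ^ 2) := by
    intro s hs
    have hf0 := h.tame.pos s hs
    have hu1 := hT'.le_one s hs
    have hu0 := hT'.pos s hs
    have hp : |g s / wt m s / f s| ≤ 5 * L * T ^ 2 := by
      rw [abs_div, abs_of_pos hf0, div_le_iff₀ hf0]; exact h.abs_deriv_le hs
    set D := g s / wt m s / f s - v s / wt m' s / u s
    have hY0 : 0 ≤ Y2 s := sq_nonneg _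
    have e1 : |4 * (g s / wt m s / f s) * Y2 s| ≤ 20 * L * T ^ 2 * Y2 s := by
      rw [abs_mul, abs_mul, abs_of_nonneg hY0, abs_of_pos (by norm_num : (0 : ℝ) < 4)]
      have := mul_le_mul_of_nonneg_right hp hY0
      linarith
    have e2 : |4 * (f s ^ 2 - u s ^ 2) * u s ^ 2 * D| ≤ 2 * Y2 s + 2 * (u s ^ 2 * D ^ 2) := by
      have e3 : (u s ^ 2 * D) ^ 2 ≤ u s ^ 2 * D ^ 2 := by
        have : u s ^ 2 ≤ 1 := by nlinarith
        have h5 : 0 ≤ u s ^ 2 * D ^ 2 := by positivity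
        nlinarith
      have h6 := abs_four_mul_le (f s ^ 2 - u s ^ 2) (u s ^ 2 * D)
      rw [mul_assoc (4 * (f s ^ 2 - u s ^ 2))]
      exact h6.trans (add_le_add le_rfl (mul_le_mul_of_nonneg_left e3 (by norm_num)))
    have e3 : 2 * Y2 s ≤ 2 * L * T ^ 2 * Y2 s := by
      have : 1 ≤ L * T ^ 2 := one_le_mul_of_one_le_of_one_le hL (one_le_pow₀ hT1)
      nlinarith
    refine (abs_add_le _ _).trans ?_
    linarith
  obtain ⟨s, hs, hmin⟩ := isCompact_Icc.exists_isMinOn ⟨0, h.reg.zero_mem⟩ cY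
  have hmin' : ∀ r ∈ Icc 0 T, Y2 s ≤ Y2 r := fun r hr => hmin hr
  -- The minimum is at most the integral because `T ≥ 1`.
  have hYs : Y2 s ≤ IY := by
    have h1 : ∫ r in (0 : ℝ)..T, Y2 s ≤ IY :=
      intervalIntegral.integral_mono_on hT.le (by simp) iY hmin'
    simp at h1
    have : 0 ≤ Y2 s := sq_nonneg _
    nlinarith
  have hm1 : ∀ {x y : ℝ}, 0 ≤ x → x ≤ y → y ≤ T → Q x - Y2 x ≤ Q y - Y2 y := fun hx hxy hy =>
    le_of_hasDerivAt_nonneg (fun r hr => (hQ r hr).sub (hYd r hr))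
      (fun r hr => by linarith [(_root_.abs_le.1 (hYb r hr)).2]) hx hxy hy
  have hm2 : ∀ {x y : ℝ}, 0 ≤ x → x ≤ y → y ≤ T → Q x + Y2 x ≤ Q y + Y2 y := fun hx hxy hy =>
    le_of_hasDerivAt_nonneg (fun r hr => (hQ r hr).add (hYd r hr))
      (fun r hr => by linarith [(_root_.abs_le.1 (hYb r hr)).1]) hx hxy hy
  have hm3 : ∀ {x y : ℝ}, 0 ≤ x → x ≤ y → y ≤ T → Q x ≤ Q y := fun hx hxy hy => by
    linarith [hm1 hx hxy hy, hm2 hx hxy hy]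
  -- `Q` dominates the variation of `Y2`, hence the increment from the minimum is at most `Q(T)`.
  have hmain : Y2 t ≤ Y2 s + Q T := by
    have q1 := hm3 le_rfl hs.1 hs.2
    have q2 := hm3 le_rfl ht.1 ht.2
    have q3 := hm3 hs.1 hs.2 le_rfl
    have q4 := hm3 ht.1 ht.2 le_rfl
    rcases le_total s t with hst | hst
    · linarith [hm1 hs.1 hst ht.2]
    · linarith [hm2 ht.1 hst hs.2]
  have hIY0 : 0 ≤ IY := (sq_nonneg _).trans hYs
  have hX0 : 0 ≤ X := by
    have : 0 ≤ 3 * b * X := hIY0.trans hY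
    by_contra! hneg
    nlinarith
  have hLT : 1 ≤ L * T ^ 2 := one_le_mul_of_one_le_of_one_le hL (one_le_pow₀ hT1)
  have k1 : Y2 t ≤ 23 * L * T ^ 2 * IY + 2 * ID := by
    rw [hQT] at hmain
    nlinarith
  have k2 : γ * (23 * L * T ^ 2 * IY) ≤ 1 * (23 * L * T ^ 2 * (3 * b * X)) := by
    gcongr; linarith
  have k3 := mul_le_mul_of_nonneg_left k1 hγ0.le
  simp only [hY2] at k3
  linarith

end OptimalProfile
end SurfaceSC

/-! ### From close phases and densities to close logarithmic derivatives. -/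

namespace SurfaceSC

theorem abs_wt_sub_le {m m' T t η : ℝ} (hη : |m - m'| ≤ η) (ht : t ∈ Icc 0 T) :
    |wt m t - wt m' t| ≤ η * T := by
  have h1 : wt m t - wt m' t = -((m - m') * t) := by unfold wt; ring
  rw [h1, abs_neg, abs_mul, abs_of_nonneg ht.1]
  exact mul_le_mul hη ht.2 ht.1 ((abs_nonneg _).trans hη)

theorem abs_inv_wt_sub_le {m m' T t η : ℝ} (hR : Regime m T) (hR' : Regime m' T)
    (hη : |m - m'| ≤ η) (ht : t ∈ Icc 0 T) : |1 / wt m t - 1 / wt m' t| ≤ 13 / 10 * (η * T) := by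
  have hw := hR.wt_pos ht
  have hw' := hR'.wt_pos ht
  have h1 := abs_wt_sub_le hη ht
  rw [div_sub_div _ _ hw.ne' hw'.ne', abs_div, one_mul, mul_one, abs_sub_comm,
    abs_of_pos (mul_pos hw hw'), div_le_iff₀ (mul_pos hw hw')]
  have h2 : 81 / 100 ≤ wt m t * wt m' t := by nlinarith [hR.wt_ge ht, hR'.wt_ge ht]
  have h3 : 0 ≤ η * T := (abs_nonneg _).trans h1
  nlinarith

theorem abs_coef_sub_le {b m m' α α' T A t y z η : ℝ} (hR : Regime m T) (hR' : Regime m' T)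
    (hb : 1 ≤ b) (hα : |α| ≤ A) (hα' : |α'| ≤ A) (hAT : A + 1 ≤ T) (ht : t ∈ Icc 0 T)
    (hm : |m - m'| ≤ η) (hδ : |α - α'| ≤ η) (hyz : |y ^ 2 - z ^ 2| ≤ η)
    (hz0 : 0 ≤ z) (hz1 : z ≤ 1) :
    |coef b m α t y - coef b m' α' t z| ≤ 20 * η * T ^ 3 := by
  have hT := hR.T_pos
  have hT1 := hR.one_le
  have hη0 : 0 ≤ η := (abs_nonneg _).trans hm
  have hw := hR.wt_pos ht
  have hw' := hR'.wt_pos ht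
  have e1 := abs_wt_sub_le hm ht
  have n1 : |ph m α t| ≤ 2 * T := (hR.abs_ph_le ht hα).trans (by linarith [ht.2])
  have n2 : |ph m' α' t| ≤ 2 * T := (hR'.abs_ph_le ht hα').trans (by linarith [ht.2])
  have n3 : |ph m α t - ph m' α' t| ≤ 2 * η * T ^ 2 := by
    have h1 : ph m α t - ph m' α' t = (α - α') - (m - m') * (t ^ 2 / 2) := by unfold ph; ring
    have ht2 : t ^ 2 ≤ T ^ 2 := pow_le_pow_left₀ ht.1 ht.2 2
    have h2 : |(m - m') * (t ^ 2 / 2)| ≤ η * (T ^ 2 / 2) := by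
      rw [abs_mul, abs_of_nonneg (by positivity : 0 ≤ t ^ 2 / 2)]
      exact mul_le_mul hm (by linarith) (by positivity) hη0
    rw [h1]
    refine (abs_sub _ _).trans ?_
    have h3 : η ≤ η * T ^ 2 := le_mul_of_one_le_right hη0 (one_le_pow₀ hT1)
    linarith
  have hfirst : |ph m α t ^ 2 / wt m t - ph m' α' t ^ 2 / wt m' t| ≤ 17 * η * T ^ 3 := by
    rw [div_sub_div _ _ hw.ne' hw'.ne', abs_div, abs_of_pos (mul_pos hw hw'),
      div_le_iff₀ (mul_pos hw hw')]
    have f1 : |ph m α t ^ 2 * (wt m' t - wt m t)| ≤ (2 * T) ^ 2 * (η * T) := by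
      rw [abs_mul, abs_pow, abs_sub_comm]
      exact mul_le_mul (pow_le_pow_left₀ (abs_nonneg _) n1 2) e1 (abs_nonneg _) (by positivity)
    have f2 : |wt m t * ((ph m α t - ph m' α' t) * (ph m α t + ph m' α' t))| ≤
        11 / 10 * (2 * η * T ^ 2 * (4 * T)) := by
      rw [abs_mul, abs_of_pos hw, abs_mul]
      have f3 : |ph m α t + ph m' α' t| ≤ 4 * T := (abs_add_le _ _).trans (by linarith)
      exact mul_le_mul (hR.wt_le ht) (mul_le_mul n3 f3 (abs_nonneg _) (by positivity))
        (by positivity) (by norm_num)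
    have f4 : ph m α t ^ 2 * wt m' t - wt m t * ph m' α' t ^ 2 =
        ph m α t ^ 2 * (wt m' t - wt m t) +
          wt m t * ((ph m α t - ph m' α' t) * (ph m α t + ph m' α' t)) := by ring
    rw [f4]
    refine (abs_add_le _ _).trans ?_
    have f5 : 81 / 100 ≤ wt m t * wt m' t := by nlinarith [hR.wt_ge ht, hR'.wt_ge ht]
    have f6 : 0 ≤ η * T ^ 3 := by positivity
    have f7 := mul_le_mul_of_nonneg_left f5 f6
    linarith
  have hsecond : |wt m t / b * (1 - y ^ 2) - wt m' t / b * (1 - z ^ 2)| ≤ 3 * η * T ^ 3 := by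
    have g1 : wt m t / b * (1 - y ^ 2) - wt m' t / b * (1 - z ^ 2) =
        ((wt m t - wt m' t) * (1 - z ^ 2) - wt m t * (y ^ 2 - z ^ 2)) / b := by ring
    rw [g1, abs_div, abs_of_pos (by linarith : 0 < b)]
    refine (div_le_self (abs_nonneg _) hb).trans ((abs_sub _ _).trans ?_)
    have g2 : |(wt m t - wt m' t) * (1 - z ^ 2)| ≤ η * T * 1 := by
      rw [abs_mul]
      refine mul_le_mul e1 ?_ (abs_nonneg _) (by positivity)
      rw [abs_of_nonneg (by nlinarith)]; linarith [sq_nonneg z]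
    have g3 : |wt m t * (y ^ 2 - z ^ 2)| ≤ 11 / 10 * η := by
      rw [abs_mul, abs_of_pos hw]
      exact mul_le_mul (hR.wt_le ht) hyz (abs_nonneg _) (by norm_num)
    have g4 : η * T ≤ η * T ^ 3 := by
      apply mul_le_mul_of_nonneg_left _ hη0
      exact le_self_pow₀ hT1 (by norm_num)
    have g5 : η ≤ η * T ^ 3 := le_mul_of_one_le_right hη0 (one_le_pow₀ hT1)
    linarith
  have e : coef b m α t y - coef b m' α' t z = (ph m α t ^ 2 / wt m t - ph m' α' t ^ 2 / wt m' t) -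
      (wt m t / b * (1 - y ^ 2) - wt m' t / b * (1 - z ^ 2)) := by unfold coef; ring
  rw [e]
  refine (abs_sub _ _).trans ?_
  linarith

/-- Wronskian estimate for the difference of logarithmic derivatives. -/
theorem abs_logDeriv_sub_le {b m m' α α' T A L η : ℝ} {f g u v : ℝ → ℝ}
    (hR : Regime m T) (hR' : Regime m' T) (hb : 1 ≤ b) (hα : |α| ≤ A) (hα' : |α'| ≤ A)
    (hAT : A + 1 ≤ T) (hP : Profile b m α T f g) (hP' : Profile b m' α' T u v)
    (hf : Tame T L f g) (hu : Tame T L u v)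
    (hm : |m - m'| ≤ η) (hδ : |α - α'| ≤ η) (hY : ∀ t ∈ Icc 0 T, |f t ^ 2 - u t ^ 2| ≤ η)
    {t : ℝ} (ht : t ∈ Icc 0 T) :
    |g t / wt m t / f t - v t / wt m' t / u t| ≤ 52 * L ^ 4 * T ^ 6 * η := by
  have hT := hR.T_pos
  have hT1 := hR.one_le
  have hL := hf.one_le
  have hη0 : 0 ≤ η := (abs_nonneg _).trans hm
  have hft := hf.pos t ht
  have hut := hu.pos t ht
  have hw := hR.wt_pos ht
  have hw' := hR'.wt_pos ht
  have hsub : ∀ s ∈ Icc t T, s ∈ Icc 0 T := fun s hs => ⟨ht.1.trans hs.1, hs.2⟩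
  have hlog : ∀ s ∈ Icc 0 T, (1 + s) ^ 2 ≤ 4 * T ^ 2 := fun s hs => by
    have : (1 + s) ^ 2 ≤ (2 * T) ^ 2 := pow_le_pow_left₀ (by linarith [hs.1]) (by linarith [hs.2]) 2
    linarith
  have hmono : ∀ {f g : ℝ → ℝ}, Tame T L f g → ∀ s ∈ Icc t T, f s ≤ L * f t := by
    intro f g h s hs
    have h1 := h.decay t s ht.1 hs.1 hs.2
    refine h1.trans (mul_le_mul_of_nonneg_right ?_ (h.pos t ht).le)
    exact mul_le_of_le_one_right (by linarith) (Real.exp_le_one_iff.2 (by linarith [hs.1]))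
  -- The Wronskian is integrated only over `[t, T]`, where `f u` is at most `L²` times its value at
  -- `t`; the final division by `f(t) u(t)` is then harmless even where both are tiny.
  have hW := abs_sub_le_of_abs_deriv_le (F := fun s => g s * u s - v s * f s) (a := t) (b := T)
    (F' := fun s => (coef b m α s (f s) - coef b m' α' s (u s)) * (f s * u s) +
      g s * v s * (1 / wt m' s - 1 / wt m s)) (C := 41 * L ^ 4 * T ^ 5 * η * (f t * u t))
    (fun s hs => by
      have hs' := hsub s hs
      have h1 := ((hP.hg s hs').mul (hP'.hf s hs')).sub ((hP'.hg s hs').mul (hP.hf s hs'))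
      convert! h1 using 1
      ring)
    (fun s hs => by
      have hs' := hsub s hs
      have hfs := hf.pos s hs'
      have hus := hu.pos s hs'
      have h1 := abs_coef_sub_le hR hR' hb hα hα' hAT hs' hm hδ (hY s hs') hus.le (hu.le_one s hs')
      have h2 := abs_inv_wt_sub_le hR hR' hm hs'
      rw [abs_sub_comm] at h2
      have h3 : |g s| ≤ 4 * L * T ^ 2 * f s := (hf.abs_g_le s hs').trans (by
        have := mul_le_mul_of_nonneg_right (hlog s hs') (by positivity : 0 ≤ L * f s)
        linarith)
      have h4 : |v s| ≤ 4 * L * T ^ 2 * u s := (hu.abs_g_le s hs').trans (by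
        have := mul_le_mul_of_nonneg_right (hlog s hs') (by positivity : 0 ≤ L * u s)
        linarith)
      have h5 : f s * u s ≤ L ^ 2 * (f t * u t) := by
        have := mul_le_mul (hmono hf s hs) (hmono hu s hs) hus.le (by positivity)
        linarith
      have h6 : |(coef b m α s (f s) - coef b m' α' s (u s)) * (f s * u s)| ≤
          20 * η * T ^ 3 * (f s * u s) := by
        rw [abs_mul, abs_of_pos (mul_pos hfs hus)]
        exact mul_le_mul_of_nonneg_right h1 (mul_pos hfs hus).le
      have h7 : |g s * v s * (1 / wt m' s - 1 / wt m s)| ≤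
          (4 * L * T ^ 2 * f s) * (4 * L * T ^ 2 * u s) * (13 / 10 * (η * T)) := by
        rw [abs_mul, abs_mul]
        exact mul_le_mul (mul_le_mul h3 h4 (abs_nonneg _) (by positivity)) h2 (abs_nonneg _)
          (by positivity)
      refine (abs_add_le _ _).trans ((add_le_add h6 h7).trans ?_)
      have h8 : 20 * η * T ^ 3 * (f s * u s) ≤ 20 * L ^ 2 * T ^ 5 * η * (f s * u s) := by
        have e1 : T ^ 3 ≤ T ^ 5 := pow_le_pow_right₀ hT1 (by norm_num)
        have e2 : 1 ≤ L ^ 2 := one_le_pow₀ hL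
        have e3 : T ^ 3 ≤ L ^ 2 * T ^ 5 := by nlinarith [pow_pos hT 5]
        have := mul_le_mul_of_nonneg_left e3 (by positivity : 0 ≤ 20 * η * (f s * u s))
        linarith
      have h9 := mul_le_mul_of_nonneg_left h5 (by positivity : 0 ≤ 41 * L ^ 2 * T ^ 5 * η)
      have h10 : 0 ≤ L ^ 4 * T ^ 5 * η * (f t * u t) := by positivity
      have h11 : 0 ≤ L ^ 2 * T ^ 5 * η * (f s * u s) := by positivity
      linarith) (s := t) (t := T) le_rfl ht.2 le_rfl
  have hWt : |g t * u t - v t * f t| ≤ 41 * L ^ 4 * T ^ 6 * η * (f t * u t) := by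
    rw [hP.gT, hP'.gT, zero_mul, zero_mul, sub_zero, zero_sub, abs_neg] at hW
    refine hW.trans ?_
    have h1 : 0 ≤ 41 * L ^ 4 * T ^ 5 * η * (f t * u t) := by positivity
    have h2 := mul_le_mul_of_nonneg_left (sub_le_self T ht.1) h1
    linarith
  -- The Wronskian compares `g / f` with `v / u`; the second summand accounts for the two different
  -- weights.
  have hsplit : g t / wt m t / f t - v t / wt m' t / u t =
      (g t * u t - v t * f t) / (f t * u t) * (1 / wt m t) +
        v t / u t * (1 / wt m t - 1 / wt m' t) := by
    field_simp
    ring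
  have hfirst : |(g t * u t - v t * f t) / (f t * u t) * (1 / wt m t)| ≤
      41 * L ^ 4 * T ^ 6 * η * (10 / 9) := by
    rw [abs_mul, abs_div, abs_of_pos (mul_pos hft hut), abs_of_pos (one_div_pos.2 hw)]
    exact mul_le_mul ((div_le_iff₀ (mul_pos hft hut)).2 hWt) (hR.inv_wt_le ht)
      (one_div_pos.2 hw).le (by positivity)
  have hsecond : |v t / u t * (1 / wt m t - 1 / wt m' t)| ≤
      L * (4 * T ^ 2) * (13 / 10 * (η * T)) := by
    rw [abs_mul, abs_div, abs_of_pos hut]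
    refine mul_le_mul ((div_le_iff₀ hut).2 ((hu.abs_g_le t ht).trans ?_))
      (abs_inv_wt_sub_le hR hR' hm ht) (abs_nonneg _) (by positivity)
    have := mul_le_mul_of_nonneg_right (hlog t ht) (by positivity : 0 ≤ L * u t)
    linarith
  have hpow : L * T ^ 3 ≤ L ^ 4 * T ^ 6 :=
    mul_le_mul (le_self_pow₀ hL (by norm_num)) (pow_le_pow_right₀ hT1 (by norm_num))
      (by positivity) (by positivity)
  have := mul_le_mul_of_nonneg_right hpow hη0
  have h0 : 0 ≤ L ^ 4 * T ^ 6 * η := by positivity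
  rw [hsplit]
  refine (abs_add_le _ _).trans ((add_le_add hfirst hsecond).trans ?_)
  linarith

end SurfaceSC

/-! ### Optimal pairs as profiles, exclusion of the mirror phase, and the phase equation. -/

namespace SurfaceSC

theorem Profile.memH1 {b m α T : ℝ} {f g : ℝ → ℝ} (hP : Profile b m α T f g) (hR : Regime m T) :
    MemH1 T f :=
  .of_contDiff hR.T_pos.le hP.hf (hP.continuousOn_deriv hR)

theorem Profile.enr_deriv {b m α T : ℝ} {f g : ℝ → ℝ} (hP : Profile b m α T f g)
    (hR : Regime m T) (m' β : ℝ) :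
    enr b m' β T f (deriv f) = enr b m' β T f (fun t => g t / wt m t) :=
  enr_congr hR.T_pos.le (fun _ _ => rfl) (.of_forall fun t ht => (hP.hf t ht).deriv)

/-- Completing the square in the nonlinear term leaves only `-w / (2 b)`. The bound makes the set of
energies bounded below, so that its infimum is meaningful. -/
theorem le_enr {b m β T : ℝ} (hR : Regime m T) (hb : 0 < b) (h d : ℝ → ℝ) :
    -(11 / 10 / (2 * b) * T) ≤ enr b m β T h d := by
  have hT := hR.T_pos
  unfold enr
  by_cases hi : IntervalIntegrable (fun t => dens b m β t (h t) (d t)) volume 0 T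
  · have h1 : ∫ _ in (0 : ℝ)..T, -(11 / 10 / (2 * b)) ≤
        ∫ t in (0 : ℝ)..T, dens b m β t (h t) (d t) := by
      apply intervalIntegral.integral_mono_on hT.le (by simp) hi
      intro t ht
      have hw := hR.wt_pos ht
      have e : dens b m β t (h t) (d t) = wt m t * d t ^ 2 + ph m β t ^ 2 / wt m t * h t ^ 2 +
          wt m t / (2 * b) * (1 - h t ^ 2) ^ 2 - wt m t / (2 * b) := by
        unfold dens
        field_simp
        ring
      have h2 : wt m t / (2 * b) ≤ 11 / 10 / (2 * b) :=
        div_le_div_of_nonneg_right (hR.wt_le ht) (by positivity)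
      have h3 : 0 ≤ wt m t * d t ^ 2 + ph m β t ^ 2 / wt m t * h t ^ 2 +
          wt m t / (2 * b) * (1 - h t ^ 2) ^ 2 := by positivity
      linarith
    rw [intervalIntegral.integral_const, smul_eq_mul] at h1
    linarith
  -- A non-integrable density has integral `0` by convention, which also satisfies the bound.
  · rw [intervalIntegral.integral_undef hi]
    have : 0 ≤ 11 / 10 / (2 * b) * T := by positivity
    linarith

/-- A profile whose phase is optimal among all (for `m ≤ 0`: all large enough) phases. -/
structure PhaseOptimal (b m α T : ℝ) (f g : ℝ → ℝ) : Prop where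
  reg : Regime m T
  prof : Profile b m α T f g
  mem : m ≤ 0 → -(T / 2) ≤ α
  le : ∀ β, (m ≤ 0 → -(T / 2) ≤ β) → ∀ h, MemH1 T h →
    enr b m α T f (fun t => g t / wt m t) ≤ enr b m β T h (deriv h)

theorem IsOptimalPair.exists_phaseOptimal {b c₀ ε k α : ℝ} {f : ℝ → ℝ} (hb : 0 < b) (hε : 0 < ε)
    (hR : Regime (ε * k) (tEnd c₀ ε)) (h : IsOptimalPair b c₀ ε k α f) :
    ∃ F g : ℝ → ℝ, PhaseOptimal b (ε * k) α (tEnd c₀ ε) F g ∧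
      (∀ t ∈ Icc 0 (tEnd c₀ ε), f t = F t) ∧
      ∀ᵐ t, t ∈ Icc 0 (tEnd c₀ ε) → deriv f t = g t / wt (ε * k) t := by
  have hk : ε * k ≤ 0 ↔ k ≤ 0 := mul_nonpos_iff_neg_imp_nonneg.trans (by
    constructor
    · intro h1; by_contra h2; have := h1.1; have := h1.2; grind
    · grind)
  have hbdd : ∀ β, BddBelow (energy1D b c₀ ε k β '' {h | MemH1 (tEnd c₀ ε) h}) := by
    intro β
    refine ⟨-(11 / 10 / (2 * b) * tEnd c₀ ε), ?_⟩
    rintro _ ⟨u, -, rfl⟩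
    rw [energy1D_eq_enr hR]
    exact le_enr hR hb _ _
  have hmin := h.profile_min.2
  obtain ⟨F, g, hP, hF, hd⟩ := exists_profile hR (b := b) (α := α) h.profile_min.1
    (fun u hu => by
      rw [← energy1D_eq_enr hR, ← energy1D_eq_enr hR]
      exact hmin u hu) h.profile_nonneg
  have hground : groundEnergy1D b c₀ ε k α = energy1D b c₀ ε k α f :=
    IsLeast.csInf_eq ⟨⟨f, h.profile_min.1, rfl⟩, by rintro _ ⟨u, hu, rfl⟩; exact hmin u hu⟩
  refine ⟨F, g, ⟨hR, hP, fun h0 => h.mem_phases (hk.1 h0), fun β hβ u hu => ?_⟩, hF, hd⟩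
  rw [← enr_congr hR.T_pos.le hF hd, ← energy1D_eq_enr hR, ← energy1D_eq_enr hR, ← hground]
  refine (h.phase_min (show β ∈ phases c₀ ε k from fun h0 => hβ (hk.2 h0))).trans ?_
  exact csInf_le (hbdd β) ⟨u, hu, rfl⟩

namespace PhaseOptimal
variable {b m α T : ℝ} {f g : ℝ → ℝ}

theorem le_profile (h : PhaseOptimal b m α T f g) {β m' α' : ℝ} {u v : ℝ → ℝ}
    (hβ : m ≤ 0 → -(T / 2) ≤ β) (hR' : Regime m' T) (hP : Profile b m' α' T u v) :
    enr b m α T f (fun t => g t / wt m t) ≤ enr b m β T u (fun t => v t / wt m' t) := by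
  rw [← hP.enr_deriv hR']
  exact h.le β hβ u (hP.memH1 hR')

/-- The mirror phase, near `-T`, is not optimal. -/
theorem abs_lt {A L R c : ℝ} (h : PhaseOptimal b m α T f g) (hb : 1 < b) (hc : 0 < c)
    (hE : enr b m α T f (fun t => g t / wt m t) ≤ -c) (hA : 2 * R ≤ A)
    (hloc : |α| < R ∨ |ph m α T| < R)
    (htame : ∀ (m T α : ℝ) (f g : ℝ → ℝ), Regime m T → L ≤ T → |α| ≤ A →
      Profile b m α T f g → enr b m α T f (fun t => g t / wt m t) ≤ -c → Tame T L f g)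
    (hL : L ≤ T) (hRT : 2 * (R + 1) ≤ T) (hm : |m| * T ^ 2 ≤ 9 / 100)
    (hT : 3 * (54 * (5 * L ^ 2) ^ 2 * (3 * (A + 1) ^ 2 + 2)) < T * c) : |α| < R := by
  have hR := h.reg
  refine hloc.resolve_right fun hph => ?_
  -- For `m ≤ 0` the constraint `α ≥ -T / 2` puts the phase at `T` above `R`. For `m > 0` the
  -- reflected pair is a competitor.
  rcases le_or_gt m 0 with hm0 | hm0
  · have h1 := h.mem hm0
    have h2 := hR.ph_ge (α := α) hR.right_mem
    have h3 := le_abs_self (ph m α T)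
    linarith
  have hTp := hR.T_pos
  have hw := hR.wt_pos hR.right_mem
  have hw9 := hR.wt_ge hR.right_mem
  have hiw := hR.inv_wt_le hR.right_mem
  have hw1 : wt m T ≤ 1 := by unfold wt; nlinarith
  have hdiv : ∀ x : ℝ, |-x / wt m T| ≤ 10 / 9 * |x| := fun x => by
    rw [abs_div, abs_neg, abs_of_pos hw, div_eq_mul_one_div, mul_comm]
    exact mul_le_mul_of_nonneg_right hiw (abs_nonneg _)
  -- The factor `1 / w(T) ≤ 10 / 9` turns `9 / 100` into the `1 / 10` of `Regime`.
  have hR' : Regime (-m / wt m T) T := ⟨hR.one_le, by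
    have := mul_le_mul_of_nonneg_right (hdiv m) (sq_nonneg T)
    linarith⟩
  have hα' : |-ph m α T / wt m T| ≤ A := by
    have := hdiv (ph m α T)
    have := abs_nonneg (ph m α T)
    linarith
  have hP' := h.prof.reflect hR
  have hE' := h.prof.enr_reflect hR hR'
  set e := enr b (-m / wt m T) (-ph m α T / wt m T) T (fun s => f (T - s))
        (fun s => (-g (T - s) / wt m T) / wt (-m / wt m T) s) with he
  have hec : e ≤ -c := by
    rw [hE'] at hE
    by_contra! hcon
    nlinarith
  have htm := htame _ _ _ _ _ hR' hL hα' hP' hec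
  obtain ⟨hx1, hx2⟩ := htm.le_exp hR'
  have h1 := enr_le_enr_add hR hR' hb.le hα' (hP'.continuousOn_f) (hP'.continuousOn_deriv hR')
    (fun t ht => (htm.pos t ht).le) htm.le_one hx1 hx2
  have h2 := h.le_profile (β := -ph m α T / wt m T) (fun h0 => absurd h0 hm0.not_ge) hR' hP'
  set C := 54 * (5 * L ^ 2) ^ 2 * (3 * (A + 1) ^ 2 + 2) with hC
  have hC0 : 0 ≤ C := by positivity
  have h3 : |m - -m / wt m T| ≤ 3 * m := by
    have := abs_sub m (-m / wt m T)
    have := hdiv m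
    rw [abs_of_pos hm0] at *
    linarith
  have h4 := mul_le_mul_of_nonneg_left h3 hC0
  -- Optimality against the reflected pair, whose energy changes by `O(m)` when the curvature goes
  -- back to `m`. As `w(T) = 1 - m T`, dividing by `m` leaves `-T e ≤ 3 C`, contrary to `e ≤ -c` and
  -- `3 C < T c`.
  have h5 : wt m T * e ≤ e + 3 * C * m := by
    rw [← hE']
    linarith
  have h6 : wt m T * e = e - m * (T * e) := by unfold wt; ring
  have h7 : 0 ≤ m * (3 * C + T * e) := by linarith
  have h8 : T * e ≤ T * -c := mul_le_mul_of_nonneg_left hec hTp.le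
  nlinarith

/-- The phase equation. -/
theorem exists_optimalProfile {A L : ℝ} (h : PhaseOptimal b m α T f g) (hb : 1 < b)
    (hα : |α| ≤ A) (hT : Tame T L f g) (hAT : 2 * (A + 1) ≤ T) :
    ∃ F, OptimalProfile b m α T A L f g F := by
  have hR := h.reg
  have hTp := hR.T_pos
  have cf := h.prof.continuousOn_f
  have cw : ContinuousOn (fun t => wt m t) (Icc 0 T) := (continuous_wt m).continuousOn
  have cp : ContinuousOn (fun t => ph m α t) (Icc 0 T) := (continuous_ph m α).continuousOn
  have hw0 : ∀ t ∈ Icc 0 T, wt m t ≠ 0 := fun t ht => (hR.wt_pos ht).ne'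
  have cq : ContinuousOn (fun t => 2 * (ph m α t / wt m t) * f t ^ 2) (Icc 0 T) := by
    fun_prop (disch := assumption)
  have cr : ContinuousOn (fun t => f t ^ 2 / wt m t) (Icc 0 T) := by
    fun_prop (disch := assumption)
  obtain ⟨F, hF0, hFT, hF⟩ := exists_primitive hTp.le cq
  refine ⟨F, hR, hb, hα, h.prof, hT, ?_, hF0, ?_, hF⟩
  · have := (abs_nonneg α).trans hα
    linarith
  rw [hFT]
  set I := ∫ t in (0 : ℝ)..T, 2 * (ph m α t / wt m t) * f t ^ 2 with hI
  set J := ∫ t in (0 : ℝ)..T, f t ^ 2 / wt m t with hJ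
  have hJ0 : 0 ≤ J := intervalIntegral.integral_nonneg hTp.le fun t ht =>
    div_nonneg (sq_nonneg _) (hR.wt_pos ht).le
  -- With the profile fixed, the energy is quadratic in the phase, and its slope at `α` is `I =
  -- F(T)`.
  have hexp : ∀ s, enr b m (α + s) T f (fun t => g t / wt m t) =
      enr b m α T f (fun t => g t / wt m t) + (s * I + s ^ 2 * J) := fun s => by
    have i0 := intervalIntegrable_of_continuousOn_Icc hTp.le
      (continuousOn_dens (b := b) (α := α) hR cf (h.prof.continuousOn_deriv hR))
    have i1 := (intervalIntegrable_of_continuousOn_Icc hTp.le cq).const_mul s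
    have i2 := (intervalIntegrable_of_continuousOn_Icc hTp.le cr).const_mul (s ^ 2)
    unfold enr
    rw [hI, hJ, ← intervalIntegral.integral_const_mul, ← intervalIntegral.integral_const_mul,
      ← intervalIntegral.integral_add i1 i2, ← intervalIntegral.integral_add i0 (i1.add i2)]
    congr 1
    ext t
    have : ph m (α + s) t = ph m α t + s := by unfold ph; ring
    simp only [dens, this]
    ring
  have hopt : ∀ s, |s| ≤ 1 → 0 ≤ s * I + s ^ 2 * J := fun s hs => by
    have := h.le_profile (β := α + s) (fun _ => by
      have := neg_abs_le α
      have := neg_abs_le s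
      linarith) hR h.prof
    rw [hexp] at this
    linarith
  -- The trial shift `-I / D` has modulus at most `1`, hence keeps the phase admissible, and makes
  -- the quadratic negative unless `I = 0`.
  set D := I ^ 2 + J + 1 with hD
  have hD0 : 0 < D := by positivity
  have h1 := hopt (-I / D) (by
    rw [abs_div, abs_neg, abs_of_pos hD0, div_le_one hD0]
    nlinarith [sq_abs I, sq_nonneg (|I| - 1), abs_nonneg I])
  have h2 : -I / D * I + (-I / D) ^ 2 * J = -(I ^ 2 * (I ^ 2 + 1) / D ^ 2) := by
    field_simp
    rw [hD]
    ring
  rw [h2] at h1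
  have h3 : I ^ 2 * (I ^ 2 + 1) / D ^ 2 ≤ 0 := by linarith
  have h4 : I ^ 2 * (I ^ 2 + 1) ≤ 0 := by
    by_contra! hcon
    have := div_pos hcon (pow_pos hD0 2)
    linarith
  have h5 : I ^ 2 = 0 := by nlinarith [sq_nonneg I]
  exact pow_eq_zero_iff (two_ne_zero) |>.1 h5

end PhaseOptimal

end SurfaceSC

/-! ### Choice of constants and conclusion. -/

namespace SurfaceSC

open Filter in
/-- The estimate of logarithmic derivatives, in terms of `m = ε k` and of the length `T`. -/
theorem exists_logDeriv_bound {b : ℝ} (hb1 : 1 < b) (hb2 : b < Theta0⁻¹) :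
    ∃ T₀ κ C : ℝ, 0 < κ ∧ 0 < C ∧ ∀ m m' T α α' : ℝ, ∀ f g u v : ℝ → ℝ, T₀ ≤ T →
      |m| * T ^ 5 ≤ κ → |m'| * T ^ 5 ≤ κ →
      PhaseOptimal b m α T f g → PhaseOptimal b m' α' T u v →
      ∀ t ∈ Icc 0 T, 0 < f t ∧ 0 < u t ∧
        |g t / wt m t / f t - v t / wt m' t / u t| ≤ C * T ^ 7 * Real.sqrt |m - m'| := by
  obtain ⟨R, hR2, hloc⟩ := exists_localization hb1
  obtain ⟨α₀, c, T₁, η, hc, hη, htrial⟩ := exists_trial hb1 hb2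
  set A := 2 * R with hA
  have hA0 : 0 ≤ A := by linarith
  obtain ⟨L, hL1, htame⟩ := Profile.exists_tame hb1 hA0 hc
  set γ := (1 - 1 / b) / 2 with hγ
  have hγ0 : 0 < γ := by
    have : 1 / b < 1 := by rw [div_lt_one (by linarith)]; exact hb1
    linarith
  set C₆ := 54 * (5 * L ^ 2) ^ 2 * (3 * (A + 1) ^ 2 + 2) with hC₆
  have hC₆0 : 0 < C₆ := by positivity
  -- `γ B` dominates the constants of both closeness estimates, and the `+ 1` gives `B ≤ B²`.
  set B := (400 * L ^ 2 + (69 * L * b + 400)) * (2 * C₆) / γ + 1 with hB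
  have hB1 : 1 ≤ B := by
    have : 0 ≤ (400 * L ^ 2 + (69 * L * b + 400)) * (2 * C₆) / γ := by positivity
    linarith
  have hlarge : ∀ᶠ T : ℝ in atTop, 1 ≤ T ∧ T₁ ≤ T ∧ 20 * (A + 2) ≤ T ∧ 2 * L ≤ T ∧
      2000 * (6 * L ^ 2 + 1) ≤ T * γ ∧ 10 ^ 7 * L ^ 8 ≤ T * γ ∧ 3 * C₆ < T * c ∧
      -2 * α₀ ≤ T := by
    refine (eventually_ge_atTop _).and <| (eventually_ge_atTop _).and <|
      (eventually_ge_atTop _).and <| (eventually_ge_atTop _).and <|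
      ((tendsto_id.atTop_mul_const hγ0).eventually_ge_atTop _).and <|
      ((tendsto_id.atTop_mul_const hγ0).eventually_ge_atTop _).and <|
      ((tendsto_id.atTop_mul_const hc).eventually_gt_atTop _).and <| eventually_ge_atTop _
  obtain ⟨T₀, hT₀⟩ := eventually_atTop.1 hlarge
  refine ⟨T₀, min (9 / 100) (min η (γ / (408 * L ^ 4))), 52 * L ^ 4 * B, by positivity,
    by positivity, ?_⟩
  intro m m' T α α' f g u v hTT hm hm' hf hu
  obtain ⟨hT1, hT1', hTA, hTL, hTγ, hTγ', hTc, hTα⟩ := hT₀ T hTT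
  have hT0 : 0 < T := by linarith
  have hsmall : ∀ {m : ℝ}, |m| * T ^ 5 ≤ min (9 / 100) (min η (γ / (408 * L ^ 4))) →
      |m| ≤ 9 / 100 ∧ |m| * T ^ 2 ≤ 9 / 100 ∧ |m| * T ^ 2 ≤ η ∧ 408 * L ^ 4 * (|m| * T ^ 5) ≤ γ := by
    intro m hm
    obtain ⟨h1, h2⟩ := le_min_iff.1 hm
    obtain ⟨h2, h3⟩ := le_min_iff.1 h2
    have h4 : |m| * T ^ 2 ≤ |m| * T ^ 5 :=
      mul_le_mul_of_nonneg_left (pow_le_pow_right₀ hT1 (by norm_num)) (abs_nonneg _)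
    have h5 : |m| ≤ |m| * T ^ 5 := le_mul_of_one_le_right (abs_nonneg _) (one_le_pow₀ hT1)
    rw [le_div_iff₀ (by positivity)] at h3
    exact ⟨h5.trans h1, h4.trans h1, h4.trans h2, by linarith⟩
  obtain ⟨hm1, hm2, hm3, hm4⟩ := hsmall hm
  obtain ⟨hm1', hm2', hm3', -⟩ := hsmall hm'
  have key : ∀ {m α : ℝ} {f g : ℝ → ℝ}, |m| * T ^ 2 ≤ 9 / 100 → |m| * T ^ 2 ≤ η →
      PhaseOptimal b m α T f g → |α| ≤ A ∧ -(T / 2) ≤ α ∧ Tame T L f g := by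
    intro m α f g hm hm' h
    obtain ⟨w, hw, hwc⟩ := htrial m T h.reg hT1' hm'
    have hE := (h.le α₀ (fun _ => by linarith) w hw).trans hwc
    have hα := h.abs_lt hb1 hc hE le_rfl (hloc m T α f g h.reg h.prof (by linarith)) htame
      (by linarith) (by linarith) hm hTc
    have hαA : |α| ≤ A := by linarith
    refine ⟨hαA, ?_, htame m T α f g h.reg (by linarith) hαA h.prof hE⟩
    have := neg_abs_le α
    linarith
  obtain ⟨hα, hα2, hft⟩ := key hm2 hm3 hf
  obtain ⟨hα', -, hut⟩ := key hm2' hm3' hu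
  obtain ⟨F, hF⟩ := hf.exists_optimalProfile hb1 hα hft (by linarith)
  have hasym : OptimalProfile.Asymptotic m T A L γ := ⟨hTA, hTL, by linarith, hm4⟩
  set Δ := |m - m'| with hΔ
  have hΔ0 : 0 ≤ Δ := abs_nonneg _
  have hΔ1 : Δ ≤ 1 := by
    have := abs_sub m m'
    linarith
  -- Replace `m` by `m'` at `(α', u)`, use optimality of `(α', u)` for `m'` against `(α, f)`, and
  -- return to `m`; each change of curvature costs `C₆ Δ`. The phase `α` is admissible for `m'`
  -- because it exceeds `-T / 2`.
  have hX : enr b m α' T u (fun t => v t / wt m' t) - enr b m α T f (fun t => g t / wt m t) ≤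
      2 * C₆ * Δ := by
    obtain ⟨hx1, hx2⟩ := hut.le_exp hu.reg
    obtain ⟨hy1, hy2⟩ := hft.le_exp hf.reg
    have h1 := enr_le_enr_add hf.reg hu.reg hb1.le hα' hu.prof.continuousOn_f
      (hu.prof.continuousOn_deriv hu.reg) (fun t ht => (hut.pos t ht).le) hut.le_one hx1 hx2
    have h2 := enr_le_enr_add hu.reg hf.reg hb1.le hα hf.prof.continuousOn_f
      (hf.prof.continuousOn_deriv hf.reg) (fun t ht => (hft.pos t ht).le) hft.le_one hy1 hy2
    have h3 := hu.le_profile (β := α) (fun _ => hα2) hf.reg hf.prof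
    rw [abs_sub_comm m' m] at h2
    linarith
  obtain ⟨hcα, -, -⟩ := hF.coercivity hγ hasym (by linarith) hu.reg hu.prof hut hX
  -- A common bound for the differences of curvature, phase and density. The factor `T` is the
  -- square root of the `T²` lost in coercivity; `Δ ≤ 1` lets `√Δ` dominate `Δ`.
  set σ := B * T * Real.sqrt Δ with hσ
  have hσ0 : 0 ≤ σ := by positivity
  have hσ2 : σ ^ 2 = B ^ 2 * T ^ 2 * Δ := by rw [hσ, mul_pow, mul_pow, Real.sq_sqrt hΔ0]
  have hle : ∀ {x N : ℝ}, 0 ≤ N → N ≤ 400 * L ^ 2 + (69 * L * b + 400) →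
      γ * x ^ 2 ≤ N * T ^ 2 * (2 * C₆ * Δ) → |x| ≤ σ := by
    intro x N hN0 hN hx
    apply abs_le_of_sq_le_sq _ hσ0
    have h1 : N * (2 * C₆) ≤ γ * B ^ 2 := by
      have h2 : N * (2 * C₆) ≤ γ * B := by
        rw [hB, mul_add, mul_div_cancel₀ _ hγ0.ne']
        have := mul_le_mul_of_nonneg_right hN (by positivity : 0 ≤ 2 * C₆)
        linarith
      exact h2.trans (mul_le_mul_of_nonneg_left (le_self_pow₀ hB1 two_ne_zero) hγ0.le)
    have h2 := mul_le_mul_of_nonneg_right h1 (by positivity : 0 ≤ T ^ 2 * Δ)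
    rw [hσ2]
    refine le_of_mul_le_mul_left ?_ hγ0
    linarith
  have hσm : Δ ≤ σ := by
    have h1 : Δ ≤ Real.sqrt Δ := Real.le_sqrt_of_sq_le (by nlinarith)
    refine h1.trans (le_mul_of_one_le_left (Real.sqrt_nonneg _) ?_)
    exact one_le_mul_of_one_le_of_one_le hB1 hT1
  have hσα : |α - α'| ≤ σ := by
    rw [abs_sub_comm]
    refine hle (N := 400 * L ^ 2) (by positivity) ?_ (by linarith)
    have : 0 ≤ 69 * L * b + 400 := by positivity
    linarith
  have hσY : ∀ t ∈ Icc 0 T, |f t ^ 2 - u t ^ 2| ≤ σ := fun t ht => by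
    refine hle (N := 69 * L * b + 400) (by positivity) ?_
      (hF.sup_sq_sub_sq_le hγ hasym (by linarith) hu.reg hu.prof hut hX ht)
    have : 0 ≤ 400 * L ^ 2 := by positivity
    linarith
  intro t ht
  refine ⟨hft.pos t ht, hut.pos t ht, ?_⟩
  refine (abs_logDeriv_sub_le hf.reg hu.reg hb1.le hα hα' (by linarith) hf.prof hu.prof hft hut
    hσm hσα hσY ht).trans (le_of_eq ?_)
  rw [hσ]
  ring

open Filter Topology in
-- Both claims are limits as `ε → 0⁺`: `|log ε|` tends to infinity, and `ε |log ε|⁵` tends to `0` as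
-- the fifth power of `ε^(1/5) |log ε|`.
theorem eventually_regime (c₀ K T₀ κ : ℝ) (hc₀ : 0 < c₀) (hκ : 0 < κ) :
    ∃ ε₀ > (0 : ℝ), ε₀ < 1 ∧ ∀ ε : ℝ, 0 < ε → ε < ε₀ → T₀ ≤ tEnd c₀ ε ∧
      ∀ k, |k| ≤ K → |ε * k| * tEnd c₀ ε ^ 5 ≤ κ := by
  have h1 : Tendsto (tEnd c₀) (𝓝[>] 0) atTop :=
    (tendsto_abs_atBot_atTop.comp Real.tendsto_log_nhdsGT_zero).const_mul_atTop hc₀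
  have h2 : Tendsto (fun ε : ℝ => K * c₀ ^ 5 * |Real.log ε * ε ^ (1 / 5 : ℝ)| ^ 5) (𝓝[>] 0)
      (𝓝 0) := by
    simpa using ((tendsto_log_mul_rpow_nhdsGT_zero (by norm_num : (0 : ℝ) < 1 / 5)).abs.pow
      5).const_mul (K * c₀ ^ 5)
  obtain ⟨ε₁, hε₁, hsub⟩ := mem_nhdsGT_iff_exists_Ioo_subset.1
    ((h1.eventually_ge_atTop T₀).and (h2.eventually_le_const hκ))
  have hε₁0 : 0 < ε₁ := hε₁
  refine ⟨min ε₁ (1 / 2), by positivity, (min_le_right _ _).trans_lt (by norm_num), ?_⟩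
  intro ε hε hε'
  obtain ⟨h3, h4⟩ := hsub ⟨hε, hε'.trans_le (min_le_left _ _)⟩
  refine ⟨h3, fun k hk => le_trans ?_ h4⟩
  have h5 : |Real.log ε * ε ^ (1 / 5 : ℝ)| ^ 5 = |Real.log ε| ^ 5 * ε := by
    rw [abs_mul, mul_pow, abs_of_pos (Real.rpow_pos_of_pos hε _), ← Real.rpow_natCast (ε ^ _),
      ← Real.rpow_mul hε.le]
    norm_num
  rw [h5, abs_mul, abs_of_pos hε, tEnd]
  have := mul_le_mul_of_nonneg_right hk (by positivity : 0 ≤ ε * (c₀ * |Real.log ε|) ^ 5)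
  linarith

end SurfaceSC

theorem proposition3p2 (b : ℝ) (hb1 : 1 < b) (hb2 : b < SurfaceSC.Theta0⁻¹) :
    ∃ cmin > (0 : ℝ), ∃ a > (0 : ℝ), ∀ c₀ ≥ cmin, ∀ K > (0 : ℝ),
      ∃ C > (0 : ℝ), ∃ ε₀ > (0 : ℝ), ε₀ < 1 ∧
        ∀ ε : ℝ, 0 < ε → ε < ε₀ →
        ∀ k k' : ℝ, |k| ≤ K → |k'| ≤ K →
        ∀ (α α' : ℝ) (f f' : ℝ → ℝ),
          SurfaceSC.IsOptimalPair b c₀ ε k α f →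
          SurfaceSC.IsOptimalPair b c₀ ε k' α' f' →
          (∀ t ∈ Set.Icc 0 (SurfaceSC.tEnd c₀ ε), 0 < f t ∧ 0 < f' t) ∧
          MeasureTheory.eLpNorm (fun t => deriv f t / f t - deriv f' t / f' t) ⊤
              (MeasureTheory.volume.restrict (Set.Icc 0 (SurfaceSC.tEnd c₀ ε))) ≤
            ENNReal.ofReal (C * Real.sqrt (ε * |k - k'|) * |Real.log ε| ^ a) := by
  obtain ⟨T₀, κ, C, hκ, hC, hmain⟩ := SurfaceSC.exists_logDeriv_bound hb1 hb2
  -- The exponent `7` collects `T⁶` from the Wronskian estimate and one `T` from the closeness of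
  -- the densities and phases.
  refine ⟨1, one_pos, 7, by norm_num, fun c₀ hc₀ K hK => ?_⟩
  have hc₀' : 0 < c₀ := by linarith
  obtain ⟨ε₀, hε₀, hε₀1, hreg⟩ := SurfaceSC.eventually_regime c₀ K (max 1 T₀) (min κ (1 / 10))
    hc₀' (by positivity)
  refine ⟨C * c₀ ^ 7, by positivity, ε₀, hε₀, hε₀1, ?_⟩
  intro ε hε hεε₀ k k' hk hk' α α' f f' hf hf'
  obtain ⟨hT, hsmall⟩ := hreg ε hε hεε₀
  obtain ⟨hT1, hT0⟩ := max_le_iff.1 hT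
  have hR : ∀ k, |k| ≤ K → SurfaceSC.Regime (ε * k) (SurfaceSC.tEnd c₀ ε) := fun k hk => ⟨hT1,
    (mul_le_mul_of_nonneg_left (pow_le_pow_right₀ hT1 (by norm_num)) (abs_nonneg _)).trans
      ((hsmall k hk).trans (min_le_right _ _))⟩
  have hb0 : 0 < b := by linarith
  obtain ⟨F, g, hF, hfF, hdf⟩ := hf.exists_phaseOptimal hb0 hε (hR k hk)
  obtain ⟨U, v, hU, hfU, hdu⟩ := hf'.exists_phaseOptimal hb0 hε (hR k' hk')
  have hbound := hmain _ _ _ _ _ _ _ _ _ hT0 ((hsmall k hk).trans (min_le_left _ _))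
    ((hsmall k' hk').trans (min_le_left _ _)) hF hU
  refine ⟨fun t ht => ?_, ?_⟩
  · rw [hfF t ht, hfU t ht]
    exact ⟨(hbound t ht).1, (hbound t ht).2.1⟩
  · rw [eLpNorm_exponent_top]
    apply eLpNormEssSup_le_of_ae_bound
    rw [ae_restrict_iff' measurableSet_Icc]
    filter_upwards [hdf, hdu] with t h1 h2 ht
    rw [h1 ht, h2 ht, hfF t ht, hfU t ht, Real.norm_eq_abs]
    refine ((hbound t ht).2.2).trans (le_of_eq ?_)
    rw [← mul_sub, abs_mul, abs_of_pos hε, SurfaceSC.tEnd, mul_pow,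
      show (7 : ℝ) = ((7 : ℕ) : ℝ) by norm_num, Real.rpow_natCast]
    ring
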